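/- Theorem (Regularity). Consider on $(0,1)$ the semilinear hyperbolic system $$\partial_t p+\partial_x u=0,\qquad \partial_t u+\partial_x p+a(u)=0,\qquad x\in(0,1),\ 0<t\le T,$$ with boundary conditions $u(0,t)=g_0(t)$, $u(1,t)=g_1(t)$ and initial conditions $p(x,0)=c$, $u(x,0)=0$, where $T>0$ and $c\in\mathbb{R}$. Assume that (A1) $a\in W^{3,\infty}_{loc}(\mathbb{R})$, $a(0)=0$, $a_0\le a'\le a_1$, $|a''|\le a_2$ and $|a'''|\le a_3$ almost everywhere, with positive constants $a_0,a_1,a_2,a_3$; (A2) the initial data are $p_0=c$ and $u_0=0$, as above; (A3) $g_0,g_1\in C^4([0,T])$ with $g_0(0)=g_1(0)=0$ and $g_0'(0)=g_1'(0)=0$. Then the problem has a unique classical solution $(p,u)\in C^1([0,T];L^2(0,1)\times L^2(0,1))\cap C([0,T];H^1(0,1)\times H^1(0,1))$, and this solution satisfies $$(p,u)\in C^1([0,T];H^1(0,1)\times H^1(0,1))\cap C^2([0,T];L^2(0,1)\times L^2(0,1)).$$ Moreover, for every $M$ there is a constant $C''$, depending only on $T,a_0,a_1,a_2,a_3$ and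 $M$, such that $$\|(p,u)\|_{C^1([0,T];H^1\times H^1)}+\|(p,u)\|_{C^2([0,T];L^2\times L^2)}\le C''$$ holds for all such $a$, $c$, $g_0$, $g_1$ with $|c|\le M$, $\|g_0\|_{C^4([0,T])}\le M$ and $\|g_1\|_{C^4([0,T])}\le M$. -/

import Mathlib

open MeasureTheory Set
open scoped ContDiff ENNReal

namespace DampedWave

noncomputable section

/-- `g` is the weak (distributional) derivative of `f` on the open set `U ⊆ ℝ`. -/
def IsWeakDeriv (U : Set ℝ) (f g : ℝ → ℝ) : Prop :=
  LocallyIntegrableOn f U ∧ LocallyIntegrableOn g U ∧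
    ∀ φ : ℝ → ℝ, ContDiff ℝ ∞ φ → HasCompactSupport φ → tsupport φ ⊆ U →
      ∫ x in U, f x * deriv φ x = - ∫ x in U, g x * φ x

/-- The Lebesgue space `L²(0,1)`. -/
abbrev L2 : Type := Lp ℝ 2 (volume.restrict (Ioo (0 : ℝ) 1))

theorem L2.integrable (f : L2) : IntegrableOn (f : ℝ → ℝ) (Ioo (0 : ℝ) 1) :=
  (Lp.memLp f).integrable (by norm_num)

theorem L2.locallyIntegrableOn (f : L2) :
    LocallyIntegrableOn (f : ℝ → ℝ) (Ioo (0 : ℝ) 1) :=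
  (L2.integrable f).locallyIntegrableOn

theorem L2.integrable_mul (f : L2) {φ : ℝ → ℝ} (hφ : Continuous φ) (hc : HasCompactSupport φ) :
    IntegrableOn (fun x => f x * φ x) (Ioo (0 : ℝ) 1) := by
  obtain ⟨B, hB⟩ := hφ.bounded_above_of_compact_support hc
  exact Integrable.mul_bdd (L2.integrable f) hφ.aestronglyMeasurable
    (Filter.Eventually.of_forall hB)

/-- The Sobolev space `H¹(0,1)`: the functions in `L²(0,1)` with weak derivative in `L²(0,1)`,
stored as the pairs `(f, f')`. The norm inherited from the Hilbert sum `L² ⊕ L²` is the usual one,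
`‖f‖² = ‖f‖²_{L²} + ‖f'‖²_{L²}`. -/
def h1Submodule : Submodule ℝ (WithLp 2 (L2 × L2)) where
  carrier := {v | IsWeakDeriv (Ioo (0 : ℝ) 1) (v.fst : L2) (v.snd : L2)}
  zero_mem' := by
    refine ⟨L2.locallyIntegrableOn _, L2.locallyIntegrableOn _, fun φ _ _ _ => ?_⟩
    have key : ∀ ψ : ℝ → ℝ, ∫ x in Ioo (0 : ℝ) 1, ((0 : L2) : ℝ → ℝ) x * ψ x = 0 := by
      intro ψ
      refine integral_eq_zero_of_ae ?_
      filter_upwards [Lp.coeFn_zero ℝ 2 (volume.restrict (Ioo (0 : ℝ) 1))] with x hx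
      simp only [hx, Pi.zero_apply, zero_mul]
    rw [WithLp.zero_fst, WithLp.zero_snd, key, key, neg_zero]
  add_mem' := by
    rintro v w ⟨-, -, hv⟩ ⟨-, -, hw⟩
    refine ⟨L2.locallyIntegrableOn _, L2.locallyIntegrableOn _, fun φ h h' h'' => ?_⟩
    have key : ∀ (f g : L2) {ψ : ℝ → ℝ}, Continuous ψ → HasCompactSupport ψ →
        ∫ x in Ioo (0 : ℝ) 1, ((f + g : L2) : ℝ → ℝ) x * ψ x =
          (∫ x in Ioo (0 : ℝ) 1, f x * ψ x) + ∫ x in Ioo (0 : ℝ) 1, g x * ψ x := by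
      intro f g ψ hψ hc
      rw [← integral_add (L2.integrable_mul f hψ hc) (L2.integrable_mul g hψ hc)]
      refine integral_congr_ae ?_
      filter_upwards [Lp.coeFn_add f g] with x hx
      rw [hx, Pi.add_apply, add_mul]
    have hd : Continuous (deriv φ) := h.continuous_deriv (by simp)
    have e1 := key v.fst w.fst hd h'.deriv
    have e2 := key v.snd w.snd h.continuous h'
    have e3 := hv φ h h' h''
    have e4 := hw φ h h' h''
    rw [WithLp.add_fst, WithLp.add_snd, e1, e2, e3, e4]
    ring
  smul_mem' := by
    rintro c v ⟨-, -, hv⟩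
    refine ⟨L2.locallyIntegrableOn _, L2.locallyIntegrableOn _, fun φ h h' h'' => ?_⟩
    have key : ∀ (f : L2) (ψ : ℝ → ℝ),
        ∫ x in Ioo (0 : ℝ) 1, ((c • f : L2) : ℝ → ℝ) x * ψ x =
          c * ∫ x in Ioo (0 : ℝ) 1, f x * ψ x := by
      intro f ψ
      rw [← integral_const_mul]
      refine integral_congr_ae ?_
      filter_upwards [Lp.coeFn_smul c f] with x hx
      rw [hx, Pi.smul_apply, smul_eq_mul, mul_assoc]
    rw [WithLp.smul_fst, WithLp.smul_snd, key, key, hv φ h h' h'']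
    ring

/-- `H¹(0,1)` as a normed space. -/
abbrev H1 : Type := h1Submodule

/-- The embedding `H¹(0,1) → L²(0,1)`. -/
def H1.toL2 (v : H1) : L2 := (v : WithLp 2 (L2 × L2)).fst

/-- The weak derivative `∂ₓ : H¹(0,1) → L²(0,1)`. -/
def H1.dx (v : H1) : L2 := (v : WithLp 2 (L2 × L2)).snd

/-- The boundary values of `v ∈ H¹(0,1)`, i.e. the values at `0` and `1` of its continuous
representative on `[0,1]`, are `b₀` and `b₁`. -/
def H1.HasBoundaryValues (v : H1) (b₀ b₁ : ℝ) : Prop :=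
  ∃ w : ℝ → ℝ, ContinuousOn w (Icc 0 1) ∧
    (v.toL2 : ℝ → ℝ) =ᵐ[volume.restrict (Ioo (0 : ℝ) 1)] w ∧ w 0 = b₀ ∧ w 1 = b₁

/-- The norm of `C^k([0,T]; E)`: the sum over `j ≤ k` of the suprema over `[0,T]` of the norm of the
`j`-th time derivative (one-sided at the end points). It is used for `C^k` functions and `T > 0`. -/
def ckNorm {E : Type*} [NormedAddCommGroup E] [NormedSpace ℝ E]
    (k : ℕ) (T : ℝ) (f : ℝ → E) : ℝ :=
  ∑ j ∈ Finset.range (k + 1), ⨆ t : Icc (0 : ℝ) T, ‖iteratedDerivWithin j f (Icc 0 T) t‖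

/-- The assumptions on the damping law: `a ∈ W^{3,∞}_loc(ℝ)` (continuous representative) with
`a(0) = 0`, `a₀ ≤ a' ≤ a₁`, `|a''| ≤ a₂` and `|a'''| ≤ a₃` almost everywhere, the derivatives
`d₁ = a'`, `d₂ = a''`, `d₃ = a'''` being weak ones. (Their boundedness makes them locally
`L^∞`.) -/
def IsDampingLaw (a₀ a₁ a₂ a₃ : ℝ) (a : ℝ → ℝ) : Prop :=
  Continuous a ∧ a 0 = 0 ∧
    ∃ d₁ d₂ d₃ : ℝ → ℝ,
      IsWeakDeriv univ a d₁ ∧ IsWeakDeriv univ d₁ d₂ ∧ IsWeakDeriv univ d₂ d₃ ∧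
      (∀ᵐ ξ : ℝ, a₀ ≤ d₁ ξ ∧ d₁ ξ ≤ a₁) ∧ (∀ᵐ ξ : ℝ, |d₂ ξ| ≤ a₂) ∧ (∀ᵐ ξ : ℝ, |d₃ ξ| ≤ a₃)

/-- The assumptions on a boundary datum: `g ∈ C⁴([0,T])` with `g(0) = g'(0) = 0`. -/
def IsBoundaryDatum (T : ℝ) (g : ℝ → ℝ) : Prop :=
  ContDiffOn ℝ 4 g (Icc 0 T) ∧ g 0 = 0 ∧ derivWithin g (Icc 0 T) 0 = 0

/-- `(p,u) ∈ C¹([0,T]; L² × L²) ∩ C([0,T]; H¹ × H¹)` is a classical solution of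
`∂ₜ p + ∂ₓ u = 0`, `∂ₜ u + ∂ₓ p + a(u) = 0` on `(0,1)` with boundary values
`u(0,t) = g₀(t)`, `u(1,t) = g₁(t)` and initial values `p(·,0) = c`, `u(·,0) = 0`. Only the values of
`p` and `u` at times in `[0,T]` matter. -/
structure IsClassicalSolution (T : ℝ) (a : ℝ → ℝ) (c : ℝ) (g₀ g₁ : ℝ → ℝ)
    (p u : ℝ → H1) : Prop where
  continuousOn_H1 : ContinuousOn (fun t => (p t, u t)) (Icc 0 T)
  contDiffOn_L2 : ContDiffOn ℝ 1 (fun t => ((p t).toL2, (u t).toL2)) (Icc 0 T)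
  mass : ∀ t ∈ Ioc 0 T, ∀ᵐ x ∂(volume.restrict (Ioo (0 : ℝ) 1)),
    derivWithin (fun s => (p s).toL2) (Icc 0 T) t x + (u t).dx x = 0
  momentum : ∀ t ∈ Ioc 0 T, ∀ᵐ x ∂(volume.restrict (Ioo (0 : ℝ) 1)),
    derivWithin (fun s => (u s).toL2) (Icc 0 T) t x + (p t).dx x + a ((u t).toL2 x) = 0
  boundary : ∀ t ∈ Ioc 0 T, (u t).HasBoundaryValues (g₀ t) (g₁ t)
  initial_p : ∀ᵐ x ∂(volume.restrict (Ioo (0 : ℝ) 1)), (p 0).toL2 x = c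
  initial_u : ∀ᵐ x ∂(volume.restrict (Ioo (0 : ℝ) 1)), (u 0).toL2 x = 0

end

end DampedWave

/-!
The system is a transport equation in disguise. Let `G(t)` be affine in `x` with the boundary values
of `u`, and put `v = u - G`, which vanishes at both end points. Extend `p` to an even and `v` to an
odd function on the circle `ℝ / 2ℤ`. Then `W = p + v` on the circle satisfies

  `∂ₜ W + ∂ᵧ W = f`,   `f = (g₀ - g₁) - sgn · (∂ₜ G + a(u))`,

where `sgn` is the odd sign function and `u = sgn · (odd part of W) + G` is regarded as an even
function. The left-hand side generates the translation group, a group of isometries of `L²`, and the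
boundary condition has become the oddness of `v`. A mild solution is `W(t) = c + ∫₀ᵗ S(t-s) f(s) ds`.

The main difficulty is that superposition with `a` is Lipschitz but not differentiable on `L²`. It is
differentiable along curves that are Lipschitz in the supremum norm (`hasDerivAt_superposition`), and
the translations preserve this norm as well. So the differentiated equation is solved for
`V = ∂ₜ W` by a fixed point argument in `L²` within the closed set of curves with a given
supremum bound (`IsometryGroup.exists_volterra`, `exists_regular_mild`); the solution is
`W = W₀ + ∫ V`, and it is `C¹` in time. For the second time derivative, the same result is applied to
the system for the pair `(W, V)`, whose nonlinearity is `(a(r), a'(r) τ(s))` with a cutoff `τ` that is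
inactive on the range of `V`; the Lipschitz continuity of `a''` is what this step needs. By uniqueness
of mild solutions the second component is `V` (`exists_C2_mild`). Since `g₀`, `g₁` and their first
derivatives vanish at `0`, the forcing vanishes at `0` and `V` starts from `0`.

Conversely, `∂ᵧ W = f - V` holds in the sense of the generator, so that `W` is a primitive of `f - V`
on the circle (`ae_eq_primitive_of_generator`, `half_of_generator`). Restriction of the even and odd
parts to `(0,1)` gives `p` and `u` with their space derivatives, the boundary values, and the two
equations; since `V` and `f` are `C¹` in time with values in `L²`, so are the space derivatives
(`exists_solution_of_mild`). Every bound depends only on `T`, `a₁`, `a₂` and `M`.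

Uniqueness is the energy argument for the difference of two solutions, with the monotonicity of `a`
(`IsClassicalSolution.unique`).
-/

open Filter
open scoped Topology NNReal

namespace DampedWave

noncomputable section

/-! ### Weak derivatives on intervals -/

theorem intervalIntegrable_of_locallyIntegrable {G : ℝ → ℝ} (hG : LocallyIntegrable G) (x y : ℝ) :
    IntervalIntegrable G volume x y :=
  intervalIntegrable_iff.mpr <|
    (hG.integrableOn_isCompact isCompact_uIcc).mono_set uIoc_subset_uIcc

theorem primitive_absolutelyContinuous {G : ℝ → ℝ} (hG : LocallyIntegrable G) (α κ x y : ℝ) :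
    AbsolutelyContinuousOnInterval (fun x => κ + ∫ s in α..x, G s) x y := by
  have h := (intervalIntegrable_of_locallyIntegrable hG x y
    ).absolutelyContinuousOnInterval_intervalIntegral (c := x) (by simp)
  have hc : AbsolutelyContinuousOnInterval (fun _ : ℝ => κ + ∫ s in α..x, G s) x y :=
    contDiffOn_const.absolutelyContinuousOnInterval
  have e : (fun z => κ + ∫ s in α..z, G s) =
      fun z => (κ + ∫ s in α..x, G s) + ∫ s in x..z, G s := by
    funext z
    rw [add_assoc, intervalIntegral.integral_add_adjacent_intervals
      (intervalIntegrable_of_locallyIntegrable hG _ _)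
      (intervalIntegrable_of_locallyIntegrable hG _ _)]
  rw [e]
  exact hc.fun_add h

theorem primitive_continuous {G : ℝ → ℝ} (hG : LocallyIntegrable G) (α κ : ℝ) :
    Continuous (fun x => κ + ∫ s in α..x, G s) :=
  continuous_const.add (intervalIntegral.continuous_primitive
    (fun x y => intervalIntegrable_of_locallyIntegrable hG x y) α)

theorem primitive_ae_deriv {G : ℝ → ℝ} (hG : LocallyIntegrable G) (α κ : ℝ) :
    ∀ᵐ x, deriv (fun x => κ + ∫ s in α..x, G s) x = G x := by
  filter_upwards [LocallyIntegrable.ae_hasDerivAt_integral hG] with x hx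
  exact ((hx α).const_add κ).deriv

/-- Integration by parts of a primitive against a test function. -/
theorem integral_primitive_mul_deriv {G : ℝ → ℝ} (hG : LocallyIntegrable G) (α κ : ℝ)
    {φ : ℝ → ℝ} (hφ : ContDiff ℝ ∞ φ) (hc : HasCompactSupport φ) :
    ∫ x, (κ + ∫ s in α..x, G s) * deriv φ x = - ∫ x, G x * φ x := by
  obtain ⟨R, hR⟩ := hc.isCompact.isBounded.subset_ball_lt 0 0
  have hR0 := hR.1
  have hzero : ∀ x, x ∉ Ioo (-R) R → x ∉ tsupport φ := by
    intro x hx h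
    have := hR.2 h
    rw [Real.ball_eq_Ioo] at this
    simp at this
    exact hx this
  have h0 : ∀ x, x ∉ Ioo (-R) R → φ x = 0 := fun x hx =>
    image_eq_zero_of_notMem_tsupport (hzero x hx)
  have h1 : ∀ x, x ∉ Ioo (-R) R → deriv φ x = 0 := fun x hx =>
    image_eq_zero_of_notMem_tsupport fun h => hzero x hx (tsupport_deriv_subset h)
  have hφac : AbsolutelyContinuousOnInterval φ (-R) R :=
    ((hφ.of_le (by norm_cast)).contDiffOn).absolutelyContinuousOnInterval
  have key := (primitive_absolutelyContinuous hG α κ (-R) R).integral_mul_deriv_eq_deriv_mul hφac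
  rw [h0 R (by simp), h0 (-R) (by simp)] at key
  have e1 : ∫ x, (κ + ∫ s in α..x, G s) * deriv φ x =
      ∫ x in (-R)..R, (κ + ∫ s in α..x, G s) * deriv φ x := by
    rw [intervalIntegral.integral_of_le (by linarith),
      setIntegral_eq_integral_of_forall_compl_eq_zero]
    intro x hx
    rw [h1 x (fun h => hx (Ioo_subset_Ioc_self h)), mul_zero]
  have e2 : ∫ x, G x * φ x = ∫ x in (-R)..R, G x * φ x := by
    rw [intervalIntegral.integral_of_le (by linarith),
      setIntegral_eq_integral_of_forall_compl_eq_zero]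
    intro x hx
    rw [h0 x (fun h => hx (Ioo_subset_Ioc_self h)), mul_zero]
  have e3 : ∫ x in (-R)..R, deriv (fun x => κ + ∫ s in α..x, G s) x * φ x =
      ∫ x in (-R)..R, G x * φ x := by
    refine intervalIntegral.integral_congr_ae ?_
    filter_upwards [primitive_ae_deriv hG α κ] with x hx _
    rw [hx]
  rw [e1, e2, key, e3]
  ring

/-- A smooth function with compact support and vanishing integral is the derivative of a smooth
function with compact support in any interval that contains the support. -/
theorem exists_primitive_test {U : Set ℝ} (hU : U.OrdConnected) {ψ : ℝ → ℝ}
    (hψ : ContDiff ℝ ∞ ψ) (hc : HasCompactSupport ψ) (hs : tsupport ψ ⊆ U) (h0 : ∫ x, ψ x = 0) :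
    ∃ φ : ℝ → ℝ, ContDiff ℝ ∞ φ ∧ HasCompactSupport φ ∧ tsupport φ ⊆ U ∧ deriv φ = ψ := by
  by_cases hne : (tsupport ψ).Nonempty
  swap
  · have : ψ = 0 := by
      rw [not_nonempty_iff_eq_empty, tsupport_eq_empty_iff] at hne
      exact hne
    refine ⟨0, contDiff_const, HasCompactSupport.zero, ?_, ?_⟩
    · simp [tsupport_eq_empty_iff.mpr rfl]
    · rw [this]; funext x; simp
  obtain ⟨α, hα, hαm⟩ := hc.isCompact.exists_isLeast hne
  obtain ⟨β, hβ, hβm⟩ := hc.isCompact.exists_isGreatest hne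
  have hint : ∀ x y, IntervalIntegrable ψ volume x y :=
    fun x y => hψ.continuous.intervalIntegrable x y
  have hI : Integrable ψ := hψ.continuous.integrable_of_hasCompactSupport hc
  have hout : ∀ x, x ∉ Icc α β → ψ x = 0 := fun x hx =>
    image_eq_zero_of_notMem_tsupport fun h => hx ⟨hαm h, hβm h⟩
  have hder : ∀ x, HasDerivAt (fun x => ∫ s in α..x, ψ s) (ψ x) x := fun x =>
    hψ.continuous.integral_hasStrictDerivAt α x |>.hasDerivAt
  have hsupp : Function.support (fun x => ∫ s in α..x, ψ s) ⊆ Icc α β := by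
    intro x hx
    by_contra hx'
    apply hx
    rw [mem_Icc, not_and_or, not_le, not_le] at hx'
    rcases hx' with hx' | hx'
    · show ∫ s in α..x, ψ s = 0
      rw [intervalIntegral.integral_symm, intervalIntegral.integral_zero_ae, neg_zero]
      have : ∀ᵐ y : ℝ, y ≠ α := by simp [ae_iff]
      filter_upwards [this] with y hy hy'
      rw [uIoc_of_le hx'.le] at hy'
      exact hout y fun h => hy (le_antisymm hy'.2 h.1)
    · have hαβ : α ≤ β := hαm hβ
      show ∫ s in α..x, ψ s = 0
      rw [intervalIntegral.integral_of_le (by linarith), ← integral_Icc_eq_integral_Ioc,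
        setIntegral_eq_integral_of_forall_compl_eq_zero, h0]
      intro y hy
      exact hout y fun h => hy ⟨h.1, h.2.trans hx'.le⟩
  have htsupp : tsupport (fun x => ∫ s in α..x, ψ s) ⊆ Icc α β :=
    closure_minimal hsupp isClosed_Icc
  have hd : deriv (fun x => ∫ s in α..x, ψ s) = ψ := funext fun x => (hder x).deriv
  refine ⟨fun x => ∫ s in α..x, ψ s, ?_, ?_, htsupp.trans (hU.out (hs hα) (hs hβ)), hd⟩
  · rw [contDiff_infty_iff_deriv]
    refine ⟨fun x => (hder x).differentiableAt, ?_⟩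
    rw [hd]
    exact hψ
  · exact HasCompactSupport.of_support_subset_isCompact isCompact_Icc hsupp

theorem integrable_mul_test {U : Set ℝ} {F : ℝ → ℝ} (hF : LocallyIntegrableOn F U)
    {φ : ℝ → ℝ} (hφ : Continuous φ) (hc : HasCompactSupport φ) (hs : tsupport φ ⊆ U) :
    Integrable (fun x => F x * φ x) (volume.restrict U) := by
  have h1 : IntegrableOn (fun x => F x * φ x) (tsupport φ) :=
    (hF.integrableOn_compact_subset hs hc.isCompact).mul_continuousOn hφ.continuousOn hc.isCompact
  have h2 : Integrable (fun x => F x * φ x) :=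
    h1.integrable_of_forall_notMem_eq_zero fun x hx => by
      rw [image_eq_zero_of_notMem_tsupport hx, mul_zero]
  exact h2.integrableOn

/-- The lemma of du Bois-Reymond: a function with vanishing weak derivative is constant. -/
theorem ae_const_of_weakDeriv_zero {U : Set ℝ} (hU : IsOpen U) (hUc : U.OrdConnected)
    (hne : U.Nonempty) {F : ℝ → ℝ} (hF : LocallyIntegrableOn F U)
    (h : ∀ φ : ℝ → ℝ, ContDiff ℝ ∞ φ → HasCompactSupport φ → tsupport φ ⊆ U →
      ∫ x in U, F x * deriv φ x = 0) :
    ∃ κ : ℝ, ∀ᵐ x ∂(volume.restrict U), F x = κ := by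
  obtain ⟨x₀, hx₀⟩ := hne
  obtain ⟨ε, hε, hball⟩ := Metric.isOpen_iff.mp hU x₀ hx₀
  let b : ContDiffBump x₀ := ⟨ε / 4, ε / 2, by positivity, by linarith⟩
  let ρ : ℝ → ℝ := b.normed volume
  have hρ : ContDiff ℝ ∞ ρ := b.contDiff_normed
  have hρc : HasCompactSupport ρ := b.hasCompactSupport_normed
  have hρ1 : ∫ x, ρ x = 1 := b.integral_normed
  have hρs : tsupport ρ ⊆ U := by
    rw [show tsupport ρ = _ from b.tsupport_normed_eq]
    exact (Metric.closedBall_subset_ball (by simp [b]; linarith)).trans hball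
  set κ := ∫ x in U, F x * ρ x with hκ
  refine ⟨κ, ?_⟩
  have key := hU.ae_eq_zero_of_integral_contDiff_smul_eq_zero (μ := volume)
    (f := fun x => F x - κ) (hF.sub ((locallyIntegrable_const κ).locallyIntegrableOn U)) ?_
  · rw [ae_restrict_iff' hU.measurableSet]
    filter_upwards [key] with x hx hxU
    linarith [hx hxU]
  intro g hg hgc hgs
  set m := ∫ x, g x with hm
  have hgI : Integrable g := hg.continuous.integrable_of_hasCompactSupport hgc
  have hρI : Integrable ρ := hρ.continuous.integrable_of_hasCompactSupport hρc
  obtain ⟨φ, hφ, hφc, hφs, hφd⟩ := exists_primitive_test hUc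
    (ψ := fun x => g x - m * ρ x) (hg.sub (contDiff_const.mul hρ))
    (hgc.sub hρc.mul_left) ((tsupport_sub _ _).trans (union_subset hgs
      ((tsupport_mul_subset_right (f := fun _ => m)).trans hρs))) (by
      rw [integral_sub hgI (hρI.const_mul m), integral_const_mul, hρ1, mul_one, sub_self])
  have h1 := h φ hφ hφc hφs
  rw [hφd] at h1
  have i1 := integrable_mul_test hF hg.continuous hgc hgs
  have i2 := integrable_mul_test hF hρ.continuous hρc hρs
  have e0 : ∫ x, g x • (F x - κ) = ∫ x in U, g x • (F x - κ) := by
    rw [setIntegral_eq_integral_of_forall_compl_eq_zero]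
    intro x hx
    rw [image_eq_zero_of_notMem_tsupport (fun h => hx (hgs h)), zero_smul]
  have e1 : ∫ x in U, g x = m := by
    rw [hm, setIntegral_eq_integral_of_forall_compl_eq_zero]
    intro x hx
    rw [image_eq_zero_of_notMem_tsupport (fun h => hx (hgs h))]
  have e2 : ∫ x in U, F x * (g x - m * ρ x) = (∫ x in U, F x * g x) - m * κ := by
    rw [hκ, ← integral_const_mul, ← integral_sub i1 (i2.const_mul m)]
    congr 1; funext x; ring
  have e3 : ∫ x in U, g x • (F x - κ) = (∫ x in U, F x * g x) - κ * m := by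
    rw [← e1, ← integral_const_mul, ← integral_sub i1 (hgI.integrableOn.const_mul κ)]
    congr 1; funext x; simp only [smul_eq_mul]; ring
  rw [e0, e3, mul_comm κ m, ← e2, h1]

/-- A function with a locally integrable weak derivative is a.e. a primitive of it. -/
theorem IsWeakDeriv.ae_eq_primitive {U : Set ℝ} (hU : IsOpen U) (hUc : U.OrdConnected)
    (hne : U.Nonempty) {f g G : ℝ → ℝ} (h : IsWeakDeriv U f g) (hG : LocallyIntegrable G)
    (hGg : ∀ᵐ x ∂(volume.restrict U), G x = g x) (α : ℝ) :
    ∃ κ : ℝ, ∀ᵐ x ∂(volume.restrict U), f x = κ + ∫ s in α..x, G s := by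
  have hP : Continuous (fun x => ∫ s in α..x, G s) := by simpa using primitive_continuous hG α 0
  obtain ⟨κ, hκ⟩ := ae_const_of_weakDeriv_zero hU hUc hne
    (F := fun x => f x - ∫ s in α..x, G s)
    (h.1.sub (hP.locallyIntegrable.locallyIntegrableOn U)) (by
      intro φ hφ hc hs
      have hd : Continuous (deriv φ) := hφ.continuous_deriv (by simp)
      have hds : tsupport (deriv φ) ⊆ U := tsupport_deriv_subset.trans hs
      have e1 : ∫ x in U, (∫ s in α..x, G s) * deriv φ x = - ∫ x in U, g x * φ x := by
        have := integral_primitive_mul_deriv hG α 0 hφ hc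
        simp only [zero_add] at this
        rw [setIntegral_eq_integral_of_forall_compl_eq_zero, this]
        · congr 1
          rw [← setIntegral_eq_integral_of_forall_compl_eq_zero (s := U)]
          · refine integral_congr_ae ?_
            filter_upwards [hGg] with x hx
            rw [hx]
          · intro x hx
            rw [image_eq_zero_of_notMem_tsupport (fun h => hx (hs h)), mul_zero]
        · intro x hx
          rw [image_eq_zero_of_notMem_tsupport (fun h => hx (hds h)), mul_zero]
      have e2 := h.2.2 φ hφ hc hs
      simp only [sub_mul]
      rw [integral_sub (integrable_mul_test h.1 hd hc.deriv hds)
        (integrable_mul_test (hP.locallyIntegrable.locallyIntegrableOn U) hd hc.deriv hds),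
        e1, e2, sub_self])
  refine ⟨κ, ?_⟩
  filter_upwards [hκ] with x hx
  linarith

/-! ### The space `H¹(0,1)` -/

/-- The extension of an element of `L²(0,1)` by zero. -/
def L2.ext (f : L2) : ℝ → ℝ := (Ioo (0 : ℝ) 1).indicator f

theorem L2.integrable_ext (f : L2) : Integrable f.ext :=
  (integrable_indicator_iff measurableSet_Ioo).mpr (L2.integrable f)

theorem L2.locallyIntegrable_ext (f : L2) : LocallyIntegrable f.ext :=
  (L2.integrable_ext f).locallyIntegrable

theorem L2.ext_ae (f : L2) : ∀ᵐ x ∂(volume.restrict (Ioo (0 : ℝ) 1)), f.ext x = f x := by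
  rw [ae_restrict_iff' measurableSet_Ioo]
  exact Eventually.of_forall fun x hx => indicator_of_mem hx _

/-- The primitive of an element of `L²(0,1)` with value `κ` at `0`. -/
def L2.prim (κ : ℝ) (f : L2) (x : ℝ) : ℝ := κ + ∫ s in (0 : ℝ)..x, f.ext s

theorem L2.continuous_prim (κ : ℝ) (f : L2) : Continuous (L2.prim κ f) :=
  primitive_continuous (L2.locallyIntegrable_ext f) 0 κ

theorem L2.prim_zero (κ : ℝ) (f : L2) : L2.prim κ f 0 = κ := by simp [L2.prim]

theorem setIntegral_eq_integral_of_ae_eq {U : Set ℝ} {F G : ℝ → ℝ}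
    (h : ∀ᵐ x ∂(volume.restrict U), F x = G x) (h0 : ∀ x, x ∉ U → G x = 0) :
    ∫ x in U, F x = ∫ x, G x := by
  rw [integral_congr_ae h, setIntegral_eq_integral_of_forall_compl_eq_zero h0]

theorem isWeakDeriv_of_ae_eq_prim {f g : L2} {κ : ℝ}
    (h : (f : ℝ → ℝ) =ᵐ[volume.restrict (Ioo (0 : ℝ) 1)] L2.prim κ g) :
    IsWeakDeriv (Ioo (0 : ℝ) 1) f g := by
  refine ⟨L2.locallyIntegrableOn _, L2.locallyIntegrableOn _, fun φ hφ hc hs => ?_⟩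
  have hds : tsupport (deriv φ) ⊆ Ioo (0 : ℝ) 1 := tsupport_deriv_subset.trans hs
  have e1 : ∫ x in Ioo (0 : ℝ) 1, f x * deriv φ x = ∫ x, L2.prim κ g x * deriv φ x := by
    refine setIntegral_eq_integral_of_ae_eq ?_ fun x hx => ?_
    · filter_upwards [h] with x hx
      rw [hx]
    · rw [image_eq_zero_of_notMem_tsupport (fun h => hx (hds h)), mul_zero]
  have e2 : ∫ x in Ioo (0 : ℝ) 1, g x * φ x = ∫ x, g.ext x * φ x := by
    refine setIntegral_eq_integral_of_ae_eq ?_ fun x hx => ?_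
    · filter_upwards [L2.ext_ae g] with x hx
      rw [hx]
    · rw [image_eq_zero_of_notMem_tsupport (fun h => hx (hs h)), mul_zero]
  rw [e1, e2]
  exact integral_primitive_mul_deriv (L2.locallyIntegrable_ext g) 0 κ hφ hc

theorem IsWeakDeriv.exists_ae_eq_prim {f g : L2} (h : IsWeakDeriv (Ioo (0 : ℝ) 1) f g) :
    ∃ κ : ℝ, (f : ℝ → ℝ) =ᵐ[volume.restrict (Ioo (0 : ℝ) 1)] L2.prim κ g :=
  h.ae_eq_primitive isOpen_Ioo ordConnected_Ioo (nonempty_Ioo.mpr one_pos)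
    (L2.locallyIntegrable_ext g) (L2.ext_ae g) 0

theorem H1.isWeakDeriv (v : H1) : IsWeakDeriv (Ioo (0 : ℝ) 1) v.toL2 v.dx := v.2

theorem H1.exists_ae_eq_prim (v : H1) :
    ∃ κ : ℝ, (v.toL2 : ℝ → ℝ) =ᵐ[volume.restrict (Ioo (0 : ℝ) 1)] L2.prim κ v.dx :=
  v.isWeakDeriv.exists_ae_eq_prim

theorem eqOn_Icc_of_ae_eq {w₁ w₂ : ℝ → ℝ} (h₁ : ContinuousOn w₁ (Icc 0 1))
    (h₂ : ContinuousOn w₂ (Icc 0 1)) (h : w₁ =ᵐ[volume.restrict (Ioo (0 : ℝ) 1)] w₂) :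
    EqOn w₁ w₂ (Icc 0 1) := by
  have hopen : EqOn w₁ w₂ (Ioo 0 1) :=
    Measure.eqOn_open_of_ae_eq h isOpen_Ioo (h₁.mono Ioo_subset_Icc_self)
      (h₂.mono Ioo_subset_Icc_self)
  have hc : closure (Ioo (0 : ℝ) 1) = Icc 0 1 := closure_Ioo (by norm_num)
  exact hopen.of_subset_closure h₁ h₂ Ioo_subset_Icc_self (by rw [hc])

theorem H1.HasBoundaryValues.prim {v : H1} {b₀ b₁ κ : ℝ} (hv : v.HasBoundaryValues b₀ b₁)
    (h : (v.toL2 : ℝ → ℝ) =ᵐ[volume.restrict (Ioo (0 : ℝ) 1)] L2.prim κ v.dx) :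
    L2.prim κ v.dx 0 = b₀ ∧ L2.prim κ v.dx 1 = b₁ := by
  obtain ⟨w, hw, hvw, h0, h1⟩ := hv
  have := eqOn_Icc_of_ae_eq hw (L2.continuous_prim κ v.dx).continuousOn (hvw.symm.trans h)
  rw [← this (by simp), ← this (by simp)]
  exact ⟨h0, h1⟩

theorem H1.ext' {v w : H1} (h : v.toL2 = w.toL2) (h' : v.dx = w.dx) : v = w := by
  apply Subtype.ext
  apply WithLp.ofLp_injective
  exact Prod.ext h h'

theorem H1.toL2_sub (v w : H1) : (v - w).toL2 = v.toL2 - w.toL2 := rfl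

theorem H1.dx_sub (v w : H1) : (v - w).dx = v.dx - w.dx := rfl

/-- The weak derivative of an `L²` function is unique. -/
theorem H1.toL2_injective {v w : H1} (h : v.toL2 = w.toL2) : v = w := by
  have hz : (v - w).toL2 = 0 := by rw [H1.toL2_sub, h, sub_self]
  have hd : (v - w).dx = 0 := by
    rw [Lp.eq_zero_iff_ae_eq_zero]
    have key := isOpen_Ioo.ae_eq_zero_of_integral_contDiff_smul_eq_zero
      (L2.locallyIntegrableOn (v - w).dx) (fun φ hφ hc hs => ?_)
    · exact (ae_restrict_iff' measurableSet_Ioo).mpr key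
    · have h1 := (v - w).isWeakDeriv.2.2 φ hφ hc hs
      have h2 : ∫ x in Ioo (0 : ℝ) 1, (v - w).toL2 x * deriv φ x = 0 := by
        refine integral_eq_zero_of_ae ?_
        rw [hz]
        filter_upwards [Lp.coeFn_zero ℝ 2 (volume.restrict (Ioo (0 : ℝ) 1))] with x hx
        simp only [hx, Pi.zero_apply, zero_mul]
      rw [h2] at h1
      rw [← setIntegral_eq_integral_of_forall_compl_eq_zero (s := Ioo (0 : ℝ) 1)]
      · simp only [smul_eq_mul, mul_comm (φ _)]
        linarith
      · intro x hx
        rw [image_eq_zero_of_notMem_tsupport (fun h => hx (hs h)), zero_smul]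
  refine H1.ext' h ?_
  rw [H1.dx_sub] at hd
  exact sub_eq_zero.mp hd

/-- Integration by parts in `H¹(0,1)` without boundary terms. -/
theorem H1.integral_by_parts {v q : H1} (hv : v.HasBoundaryValues 0 0) :
    inner ℝ q.toL2 v.dx + inner ℝ v.toL2 q.dx = 0 := by
  obtain ⟨κ, hκ⟩ := v.exists_ae_eq_prim
  obtain ⟨μ, hμ⟩ := q.exists_ae_eq_prim
  obtain ⟨b0, b1⟩ := hv.prim hκ
  have h := (primitive_absolutelyContinuous (L2.locallyIntegrable_ext q.dx) 0 μ 0 1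
    ).integral_deriv_mul_eq_sub
    (primitive_absolutelyContinuous (L2.locallyIntegrable_ext v.dx) 0 κ 0 1)
  change _ = L2.prim μ q.dx 1 * L2.prim κ v.dx 1 - L2.prim μ q.dx 0 * L2.prim κ v.dx 0 at h
  rw [b0, b1, mul_zero, mul_zero, sub_zero] at h
  rw [L2.inner_def, L2.inner_def, ← integral_add (L2.integrable_inner _ _)
    (L2.integrable_inner _ _)]
  rw [intervalIntegral.integral_of_le zero_le_one, integral_Ioc_eq_integral_Ioo] at h
  refine Eq.trans (integral_congr_ae ?_) h
  filter_upwards [hκ, hμ, L2.ext_ae v.dx, L2.ext_ae q.dx,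
    ae_restrict_of_ae (primitive_ae_deriv (L2.locallyIntegrable_ext v.dx) 0 κ),
    ae_restrict_of_ae (primitive_ae_deriv (L2.locallyIntegrable_ext q.dx) 0 μ)] with
    x h1 h2 h3 h4 h5 h6
  rw [h5, h6, h1, h2, h3, h4]
  simp only [L2.prim, RCLike.inner_apply, conj_trivial]
  ring

theorem H1.HasBoundaryValues.sub {v w : H1} {b₀ b₁ c₀ c₁ : ℝ} (hv : v.HasBoundaryValues b₀ b₁)
    (hw : w.HasBoundaryValues c₀ c₁) : (v - w).HasBoundaryValues (b₀ - c₀) (b₁ - c₁) := by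
  obtain ⟨f, hf, hvf, f0, f1⟩ := hv
  obtain ⟨g, hg, hwg, g0, g1⟩ := hw
  refine ⟨f - g, hf.sub hg, ?_, by simp [f0, g0], by simp [f1, g1]⟩
  rw [H1.toL2_sub]
  exact (Lp.coeFn_sub _ _).trans (hvf.sub hwg)

/-- The integral of an element of `L²(0,1)` against a test function, as a functional. -/
theorem continuous_integral_mul_test {φ : ℝ → ℝ} (hφ : Continuous φ) (hc : HasCompactSupport φ) :
    Continuous (fun f : L2 => ∫ x in Ioo (0 : ℝ) 1, f x * φ x) := by
  have hm : MemLp φ 2 (volume.restrict (Ioo (0 : ℝ) 1)) :=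
    (hφ.memLp_of_hasCompactSupport hc).restrict _
  have e : (fun f : L2 => ∫ x in Ioo (0 : ℝ) 1, f x * φ x) =
      fun f : L2 => inner ℝ (hm.toLp φ) f := by
    funext f
    rw [L2.inner_def]
    refine integral_congr_ae ?_
    filter_upwards [hm.coeFn_toLp] with x hx
    rw [hx]
    simp
  rw [e]
  exact continuous_const.inner continuous_id

theorem isClosed_h1Submodule : IsClosed (h1Submodule : Set (WithLp 2 (L2 × L2))) := by
  have e : (h1Submodule : Set (WithLp 2 (L2 × L2))) =
      ⋂ (φ : ℝ → ℝ) (_ : ContDiff ℝ ∞ φ) (_ : HasCompactSupport φ)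
        (_ : tsupport φ ⊆ Ioo (0 : ℝ) 1),
        {v : WithLp 2 (L2 × L2) | ∫ x in Ioo (0 : ℝ) 1, v.fst x * deriv φ x =
          - ∫ x in Ioo (0 : ℝ) 1, v.snd x * φ x} := by
    ext v
    simp only [mem_iInter, mem_ofPred_eq]
    exact ⟨fun h => h.2.2, fun h => ⟨L2.locallyIntegrableOn _, L2.locallyIntegrableOn _, h⟩⟩
  rw [e]
  refine isClosed_iInter fun φ => isClosed_iInter fun hφ => isClosed_iInter fun hc =>
    isClosed_iInter fun _ => isClosed_eq ?_ ?_
  · exact (continuous_integral_mul_test (hφ.continuous_deriv (by simp)) hc.deriv).comp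
      (WithLp.continuous_fst _ _ _)
  · exact ((continuous_integral_mul_test hφ.continuous hc).comp
      (WithLp.continuous_snd _ _ _)).neg

instance : CompleteSpace H1 := isClosed_h1Submodule.completeSpace_coe

/-! ### The damping law -/

theorem primitive_of_weakDeriv_univ {f g G : ℝ → ℝ} (h : IsWeakDeriv univ f g)
    (hG : Continuous G) (hGg : ∀ᵐ x, g x = G x) :
    ∃ F : ℝ → ℝ, (∀ x, HasDerivAt F (G x) x) ∧ ∀ᵐ x, f x = F x := by
  obtain ⟨κ, hκ⟩ := h.ae_eq_primitive isOpen_univ ordConnected_univ univ_nonempty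
    hG.locallyIntegrable (by rw [Measure.restrict_univ]; filter_upwards [hGg] with x hx; rw [hx]) 0
  rw [Measure.restrict_univ] at hκ
  exact ⟨_, fun x => (hG.integral_hasStrictDerivAt 0 x).hasDerivAt.const_add κ, hκ⟩

theorem forall_of_ae_of_continuous {P : ℝ → Prop} {f : ℝ → ℝ} {s : Set ℝ} (hf : Continuous f)
    (hs : IsClosed s) (h : ∀ᵐ x, P x) (hP : ∀ᵐ x, P x → f x ∈ s) (x : ℝ) : f x ∈ s := by
  have hd : Dense {x | f x ∈ s} := by
    refine Measure.dense_of_ae (μ := volume) ?_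
    filter_upwards [h, hP] with x h1 h2 using h2 h1
  have hc : IsClosed {x | f x ∈ s} := hs.preimage hf
  have : x ∈ closure {x | f x ∈ s} := hd x
  rwa [hc.closure_eq] at this

/-- The classical regularity of a damping law: it is twice differentiable, the second derivative is
Lipschitz, and the bounds hold everywhere. -/
theorem IsDampingLaw.regular {a₀ a₁ a₂ a₃ : ℝ} {a : ℝ → ℝ} (h : IsDampingLaw a₀ a₁ a₂ a₃ a) :
    ∃ a' a'' : ℝ → ℝ, (∀ x, HasDerivAt a (a' x) x) ∧ (∀ x, HasDerivAt a' (a'' x) x) ∧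
      (∀ x y, |a'' x - a'' y| ≤ a₃ * |x - y|) ∧ (∀ x, a₀ ≤ a' x ∧ a' x ≤ a₁) ∧
      (∀ x, |a'' x| ≤ a₂) := by
  obtain ⟨hac, -, d₁, d₂, d₃, h1, h2, h3, b1, b2, b3⟩ := h
  have hd3 : LocallyIntegrable d₃ := locallyIntegrableOn_univ.mp h3.2.1
  obtain ⟨κ, hκ⟩ := h3.ae_eq_primitive isOpen_univ ordConnected_univ univ_nonempty hd3
    (ae_of_all _ fun x => rfl) 0
  rw [Measure.restrict_univ] at hκ
  set D₂ : ℝ → ℝ := fun x => κ + ∫ s in (0 : ℝ)..x, d₃ s with hD2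
  have cD2 : Continuous D₂ := primitive_continuous hd3 0 κ
  obtain ⟨D₁, hD1, e1⟩ := primitive_of_weakDeriv_univ h2 cD2 hκ
  have cD1 : Continuous D₁ := continuous_iff_continuousAt.mpr fun x => (hD1 x).continuousAt
  obtain ⟨A, hA, e0⟩ := primitive_of_weakDeriv_univ h1 cD1 e1
  have cA : Continuous A := continuous_iff_continuousAt.mpr fun x => (hA x).continuousAt
  have haA : a = A := (hac.ae_eq_iff_eq volume cA).mp e0
  subst haA
  refine ⟨D₁, D₂, hA, hD1, fun x y => ?_, fun x => ?_, fun x => ?_⟩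
  · have : D₂ x - D₂ y = ∫ s in y..x, d₃ s := by
      simp only [hD2, add_sub_add_left_eq_sub]
      exact intervalIntegral.integral_interval_sub_left
        (intervalIntegrable_of_locallyIntegrable hd3 _ _)
        (intervalIntegrable_of_locallyIntegrable hd3 _ _)
    rw [this, ← Real.norm_eq_abs]
    exact intervalIntegral.norm_integral_le_of_norm_le_const_ae
      (by filter_upwards [b3] with s hs _ using hs)
  · have := forall_of_ae_of_continuous cD1 (isClosed_Icc (a := a₀) (b := a₁)) (e1.and b1)
      (ae_of_all _ fun x h => by rw [← h.1]; exact h.2) x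
    exact this
  · have := forall_of_ae_of_continuous cD2 (isClosed_Icc (a := -a₂) (b := a₂)) (hκ.and b2)
      (ae_of_all _ fun x h => by rw [← show d₂ x = D₂ x from h.1]; exact abs_le.mp h.2) x
    exact abs_le.mpr this

/-! ### Groups of isometries and mild solutions -/

/-- A strongly continuous one-parameter group of linear isometries of a normed space. -/
structure IsometryGroup (X : Type*) [NormedAddCommGroup X] [NormedSpace ℝ X] where
  /-- The isometries. -/
  toFun : ℝ → X →ₗᵢ[ℝ] X
  zero_apply : ∀ x, toFun 0 x = x
  add_apply : ∀ s t x, toFun (s + t) x = toFun s (toFun t x)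
  continuous_apply : ∀ x, Continuous fun t => toFun t x

namespace IsometryGroup

variable {X : Type*} [NormedAddCommGroup X] [NormedSpace ℝ X]

instance : CoeFun (IsometryGroup X) fun _ => ℝ → X →ₗᵢ[ℝ] X := ⟨toFun⟩

variable (S : IsometryGroup X)

theorem continuous_comp {α : Type*} [TopologicalSpace α] {φ : α → ℝ} {f : α → X}
    (hφ : Continuous φ) (hf : Continuous f) : Continuous fun t => S (φ t) (f t) := by
  rw [continuous_iff_continuousAt]
  intro t
  have h1 : Tendsto (fun s => S (φ s) (f s - f t)) (𝓝 t) (𝓝 0) := by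
    rw [tendsto_zero_iff_norm_tendsto_zero]
    simp only [LinearIsometry.norm_map]
    rw [← tendsto_zero_iff_norm_tendsto_zero]
    have := (hf.tendsto t).sub_const (f t)
    rwa [sub_self] at this
  have h2 : Tendsto (fun s => S (φ s) (f t)) (𝓝 t) (𝓝 (S (φ t) (f t))) :=
    ((S.continuous_apply (f t)).comp hφ).tendsto t
  have h3 := h1.add h2
  simp only [map_sub, sub_add_cancel, zero_add] at h3
  exact h3

theorem neg_apply (t : ℝ) (x : X) : S t (S (-t) x) = x := by
  rw [← S.add_apply, add_neg_cancel, S.zero_apply]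

/-- The derivative of `S (φ h) (f h)` at a zero of `f`. -/
theorem hasDerivAt_apply_of_eq_zero {φ : ℝ → ℝ} {f : ℝ → X} {f' : X} {t : ℝ} (hφ : Continuous φ)
    (hf : HasDerivAt f f' t) (h0 : f t = 0) :
    HasDerivAt (fun h => S (φ h) (f h)) (S (φ t) f') t := by
  rw [hasDerivAt_iff_tendsto_slope] at hf ⊢
  have h1 : Tendsto (fun s => S (φ s) (slope f t s - f')) (𝓝[≠] t) (𝓝 0) := by
    rw [tendsto_zero_iff_norm_tendsto_zero]
    simp only [LinearIsometry.norm_map]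
    rw [← tendsto_zero_iff_norm_tendsto_zero]
    have := hf.sub_const f'
    rwa [sub_self] at this
  have h2 : Tendsto (fun s => S (φ s) f') (𝓝[≠] t) (𝓝 (S (φ t) f')) :=
    (((S.continuous_apply f').comp hφ).tendsto t).mono_left nhdsWithin_le_nhds
  have h3 := h1.add h2
  simp only [map_sub, sub_add_cancel, zero_add] at h3
  refine h3.congr fun s => ?_
  simp only [slope, vsub_eq_sub, h0, sub_zero, map_zero, map_smul]

/-- The mild solution `∫₀ᵗ S(t-s) f(s) ds` with forcing `f`. -/
def mild (f : ℝ → X) (t : ℝ) : X := ∫ s in (0 : ℝ)..t, S (t - s) (f s)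

theorem continuous_pullback {f : ℝ → X} (hf : Continuous f) : Continuous fun s => S (-s) (f s) :=
  S.continuous_comp continuous_neg hf

variable [CompleteSpace X]

theorem map_integral (t : ℝ) {a b : ℝ} (f : ℝ → X) :
    S t (∫ s in a..b, f s) = ∫ s in a..b, S t (f s) := by
  simp only [intervalIntegral, map_sub, LinearIsometry.integral_comp_comm]

theorem mild_eq (f : ℝ → X) (t : ℝ) : S.mild f t = S t (∫ s in (0 : ℝ)..t, S (-s) (f s)) := by
  rw [S.map_integral]
  simp only [mild, sub_eq_add_neg, S.add_apply]

theorem hasDerivAt_pullback {f : ℝ → X} (hf : Continuous f) (t : ℝ) :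
    HasDerivAt (fun t => ∫ s in (0 : ℝ)..t, S (-s) (f s)) (S (-t) (f t)) t :=
  ((S.continuous_pullback hf).integral_hasStrictDerivAt 0 t).hasDerivAt

theorem continuous_mild {f : ℝ → X} (hf : Continuous f) : Continuous (S.mild f) := by
  have : S.mild f = fun t => S t (∫ s in (0 : ℝ)..t, S (-s) (f s)) := funext (S.mild_eq f)
  rw [this]
  exact S.continuous_comp continuous_id
    (continuous_iff_continuousAt.mpr fun t => (S.hasDerivAt_pullback hf t).continuousAt)

/-- A mild solution with continuously differentiable forcing is differentiable. -/
theorem hasDerivAt_mild {f f' : ℝ → X} (hf : ∀ t, HasDerivAt f (f' t) t) (hf' : Continuous f')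
    (t : ℝ) : HasDerivAt (S.mild f) (S t (f 0) + S.mild f' t) t := by
  have cf : Continuous f := continuous_iff_continuousAt.mpr fun t => (hf t).continuousAt
  have shift : ∀ h, S.mild f (t + h) = S (t + h) (∫ s in (0 : ℝ)..h, S (-s) (f s)) +
      ∫ s in (0 : ℝ)..t, S (t - s) (f (s + h)) := by
    intro h
    have e : ∫ s in (0 : ℝ)..t, S (t - s) (f (s + h)) = ∫ s in h..(t + h), S (t + h - s) (f s) := by
      have := intervalIntegral.integral_comp_add_right (a := 0) (b := t)
        (fun s => S (t + h - s) (f s)) h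
      rw [zero_add] at this
      rw [← this]
      simp only [add_sub_add_right_eq_sub]
    have c : Continuous fun s => S (t + h - s) (f s) :=
      S.continuous_comp (by fun_prop) cf
    rw [e, S.map_integral, mild]
    simp only [← S.add_apply, ← sub_eq_add_neg]
    rw [intervalIntegral.integral_add_adjacent_intervals (c.intervalIntegrable _ _)
      (c.intervalIntegrable _ _)]
  have d1 : HasDerivAt (fun h => S (t + h) (∫ s in (0 : ℝ)..h, S (-s) (f s))) (S t (f 0)) 0 := by
    have h1 := S.hasDerivAt_pullback cf 0
    rw [neg_zero, S.zero_apply] at h1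
    have := S.hasDerivAt_apply_of_eq_zero (φ := fun h => t + h) (by fun_prop) h1 (by simp)
    simpa using this
  have d2 : HasDerivAt (fun h => ∫ s in (0 : ℝ)..t, S (t - s) (f (s + h))) (S.mild f' t) 0 := by
    obtain ⟨C, hC⟩ := (isCompact_Icc (a := -|t| - 1) (b := |t| + 1)).exists_bound_of_continuousOn
      hf'.continuousOn
    have := (intervalIntegral.hasDerivAt_integral_of_dominated_loc_of_deriv_le (𝕜 := ℝ)
      (μ := volume) (a := 0) (b := t) (s := Metric.ball (0 : ℝ) 1)
      (F := fun h s => S (t - s) (f (s + h))) (F' := fun h s => S (t - s) (f' (s + h)))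
      (x₀ := 0) (bound := fun _ => C) (Metric.ball_mem_nhds _ one_pos) ?_ ?_ ?_ ?_ ?_ ?_).2
    · simpa [mild] using this
    · exact Eventually.of_forall fun h =>
        (S.continuous_comp (by fun_prop) (cf.comp (by fun_prop))).aestronglyMeasurable
    · exact (S.continuous_comp (by fun_prop) (cf.comp (by fun_prop))).intervalIntegrable _ _
    · exact (S.continuous_comp (by fun_prop) (hf'.comp (by fun_prop))).aestronglyMeasurable
    · refine ae_of_all _ fun s hs h hh => ?_
      rw [LinearIsometry.norm_map]
      apply hC
      have h1 : |s| ≤ |t| := by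
        have := abs_sub_left_of_mem_uIcc (uIoc_subset_uIcc hs)
        simpa using this
      rw [mem_ball_zero_iff, Real.norm_eq_abs, abs_lt] at hh
      have := abs_le.mp h1
      constructor <;> linarith [hh.1, hh.2]
    · exact intervalIntegrable_const
    · refine ae_of_all _ fun s hs h hh => ?_
      have h1 : HasDerivAt (fun h => f (s + h)) (f' (s + h)) h := by
        simpa using (hf (s + h)).comp_const_add s h
      exact (S (t - s)).toContinuousLinearMap.hasFDerivAt.comp_hasDerivAt h h1
  have d3 : HasDerivAt (fun h => S.mild f (t + h)) (S t (f 0) + S.mild f' t) 0 := by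
    have := d1.add d2
    refine this.congr_of_eventuallyEq (Eventually.of_forall fun h => ?_)
    exact shift h
  have := HasDerivAt.comp_add_const (f := fun h => S.mild f (t + h)) t (-t) (by simpa using d3)
  simpa using this

/-- The generator of the group on a mild solution. -/
theorem hasDerivAt_translate_mild {f : ℝ → X} (hf : Continuous f) {x₀ w' : X}
    (hx₀ : ∀ t, S t x₀ = x₀) {t : ℝ} (hw : HasDerivAt (fun t => x₀ + S.mild f t) w' t) :
    HasDerivAt (fun h => S h (x₀ + S.mild f t)) (w' - f t) 0 := by
  have e : ∀ h, S h (x₀ + S.mild f t) = (x₀ + S.mild f (t + h)) -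
      S (t + h) ((∫ s in (0 : ℝ)..(t + h), S (-s) (f s)) - ∫ s in (0 : ℝ)..t, S (-s) (f s)) := by
    intro h
    rw [map_sub, ← S.mild_eq, map_add, hx₀, S.mild_eq f t, ← S.add_apply, add_comm h t]
    abel
  have d1 : HasDerivAt (fun h => x₀ + S.mild f (t + h)) w' 0 := by
    simpa using HasDerivAt.comp_const_add (f := fun t => x₀ + S.mild f t) t 0 (by simpa using hw)
  have d2 : HasDerivAt (fun h => (∫ s in (0 : ℝ)..(t + h), S (-s) (f s)) -
      ∫ s in (0 : ℝ)..t, S (-s) (f s)) (S (-t) (f t)) 0 := by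
    have := HasDerivAt.comp_const_add (f := fun t => ∫ s in (0 : ℝ)..t, S (-s) (f s)) t 0
      (by simpa using S.hasDerivAt_pullback hf t)
    exact (by simpa using this : HasDerivAt (fun h => ∫ s in (0 : ℝ)..(t + h), S (-s) (f s)) _ 0
      ).sub_const _
  have d3 := S.hasDerivAt_apply_of_eq_zero (φ := fun h => t + h) (by fun_prop) d2 (by simp)
  simp only [add_zero, S.neg_apply] at d3
  exact (d1.sub d3).congr_of_eventuallyEq (Eventually.of_forall e)

end IsometryGroup

/-! ### Volterra equations -/

/-- Grönwall's inequality in integral form, for a nonnegative function. -/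
theorem eq_zero_of_le_integral {d : ℝ → ℝ} {T ℓ : ℝ} (hd : Continuous d) (h0 : ∀ t, 0 ≤ d t)
    (h : ∀ t ∈ Icc 0 T, d t ≤ ℓ * ∫ s in (0 : ℝ)..t, d s) : ∀ t ∈ Icc 0 T, d t = 0 := by
  have hder : ∀ t, HasDerivAt (fun t => ∫ s in (0 : ℝ)..t, d s) (d t) t := fun t =>
    (hd.integral_hasStrictDerivAt 0 t).hasDerivAt
  have hpos : ∀ t ∈ Icc 0 T, 0 ≤ ∫ s in (0 : ℝ)..t, d s := fun t ht =>
    intervalIntegral.integral_nonneg ht.1 fun s _ => h0 s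
  have key := norm_le_gronwallBound_of_norm_deriv_right_le (f := fun t => ∫ s in (0 : ℝ)..t, d s)
    (f' := d) (δ := 0) (K := ℓ) (ε := 0) (a := 0) (b := T)
    (continuous_iff_continuousAt.mpr fun t => (hder t).continuousAt).continuousOn
    (fun t _ => (hder t).hasDerivWithinAt) (by simp) (fun t ht => by
      have ht' := Ico_subset_Icc_self ht
      rw [Real.norm_of_nonneg (h0 t), Real.norm_of_nonneg (hpos t ht'), add_zero]
      exact h t ht')
  intro t ht
  have h1 := key t ht
  rw [gronwallBound_ε0, zero_mul, norm_le_zero_iff] at h1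
  have h2 := h t ht
  rw [h1, mul_zero] at h2
  exact le_antisymm h2 (h0 t)

namespace IsometryGroup

variable {X : Type*} [NormedAddCommGroup X] [NormedSpace ℝ X]
  (S : IsometryGroup X)

theorem norm_mild_le {f : ℝ → X} {m : ℝ → ℝ} {t : ℝ} (ht : 0 ≤ t) (hm : Continuous m)
    (h : ∀ s ∈ Icc 0 t, ‖f s‖ ≤ m s) : ‖S.mild f t‖ ≤ ∫ s in (0 : ℝ)..t, m s := by
  refine intervalIntegral.norm_integral_le_of_norm_le ht ?_ (hm.intervalIntegrable _ _)
  refine ae_of_all _ fun s hs => ?_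
  rw [LinearIsometry.norm_map]
  exact h s (Ioc_subset_Icc_self hs)

theorem mild_sub {f g : ℝ → X} (hf : Continuous f) (hg : Continuous g) (t : ℝ) :
    S.mild f t - S.mild g t = S.mild (fun s => f s - g s) t := by
  rw [mild, mild, mild, ← intervalIntegral.integral_sub]
  · simp only [map_sub]
  · exact (S.continuous_comp (by fun_prop) hf).intervalIntegrable _ _
  · exact (S.continuous_comp (by fun_prop) hg).intervalIntegrable _ _

/-- Two mild solutions whose forcing terms differ by a multiple of their distance coincide. -/
theorem eq_of_mild {x₀ : X} {V₁ V₂ k₁ k₂ : ℝ → X} {T ℓ : ℝ} (c₁ : Continuous V₁)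
    (c₂ : Continuous V₂) (hk₁ : Continuous k₁) (hk₂ : Continuous k₂)
    (h₁ : ∀ t ∈ Icc 0 T, V₁ t = x₀ + S.mild k₁ t) (h₂ : ∀ t ∈ Icc 0 T, V₂ t = x₀ + S.mild k₂ t)
    (h : ∀ t ∈ Icc 0 T, ‖k₁ t - k₂ t‖ ≤ ℓ * ‖V₁ t - V₂ t‖) : ∀ t ∈ Icc 0 T, V₁ t = V₂ t := by
  have key := eq_zero_of_le_integral (d := fun t => ‖V₁ t - V₂ t‖) (T := T) (ℓ := ℓ)
    (c₁.sub c₂).norm (fun t => norm_nonneg _) (fun t ht => by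
      rw [h₁ t ht, h₂ t ht, add_sub_add_left_eq_sub, S.mild_sub hk₁ hk₂,
        ← intervalIntegral.integral_const_mul]
      exact S.norm_mild_le ht.1 (continuous_const.mul (c₁.sub c₂).norm)
        fun s hs => h s ⟨hs.1, hs.2.trans ht.2⟩)
  intro t ht
  exact sub_eq_zero.mp (norm_eq_zero.mp (key t ht))

variable [CompleteSpace X]

/-- Global solvability of a Volterra equation `V(t) = S(t) x₀ + ∫₀ᵗ S(t-s) k(V)(s) ds` with a causal
Lipschitz right-hand side, within a family of closed constraints preserved by the equation. The
term `S(t) x₀` may be any continuous function `v`. -/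
theorem exists_volterra {T ℓ : ℝ} (hℓ : 0 ≤ ℓ) (v : ℝ → X) (hv : Continuous v)
    (k : C(Icc (0 : ℝ) T, X) → ℝ → X) (hk : ∀ V, Continuous (k V))
    (hlip : ∀ V₁ V₂ : C(Icc (0 : ℝ) T, X), ∀ t : Icc (0 : ℝ) T, ∀ m : ℝ,
      (∀ s ≤ t, ‖V₁ s - V₂ s‖ ≤ m) → ‖k V₁ t - k V₂ t‖ ≤ ℓ * m)
    (P : Icc (0 : ℝ) T → Set X) (hP : ∀ t, IsClosed (P t))
    (hP0 : ∃ V : C(Icc (0 : ℝ) T, X), ∀ t, V t ∈ P t)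
    (hinv : ∀ V : C(Icc (0 : ℝ) T, X), (∀ t, V t ∈ P t) →
      ∀ t : Icc (0 : ℝ) T, v t + S.mild (k V) t ∈ P t) :
    ∃ V : C(Icc (0 : ℝ) T, X), (∀ t, V t ∈ P t) ∧
      ∀ t : Icc (0 : ℝ) T, V t = v t + S.mild (k V) t := by
  let Φ : C(Icc (0 : ℝ) T, X) → C(Icc (0 : ℝ) T, X) := fun V =>
    ⟨fun t => v t + S.mild (k V) t,
      (hv.add (S.continuous_mild (hk V))).comp continuous_subtype_val⟩
  have hΦ : ∀ V t, Φ V t = v t + S.mild (k V) t := fun _ _ => rfl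
  -- the iterates of `Φ` satisfy the factorial bound, so that some iterate is a contraction
  have iter : ∀ (n : ℕ) (V₁ V₂ : C(Icc (0 : ℝ) T, X)) (t : Icc (0 : ℝ) T),
      ‖(Φ^[n] V₁) t - (Φ^[n] V₂) t‖ ≤ (ℓ * t) ^ n / n.factorial * ‖V₁ - V₂‖ := by
    intro n V₁ V₂
    induction n with
    | zero =>
      intro t
      simpa using (V₁ - V₂).norm_coe_le_norm t
    | succ n ih =>
      intro t
      rw [Function.iterate_succ_apply', Function.iterate_succ_apply', hΦ, hΦ,
        add_sub_add_left_eq_sub, S.mild_sub (hk _) (hk _)]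
      refine (S.norm_mild_le t.2.1
        (m := fun s => ℓ * ((ℓ * s) ^ n / n.factorial * ‖V₁ - V₂‖)) (by fun_prop) ?_).trans
        (le_of_eq ?_)
      · intro s hs
        refine hlip _ _ ⟨s, hs.1, hs.2.trans t.2.2⟩ _ fun r hr => (ih r).trans ?_
        have hr' : (r : ℝ) ≤ s := hr
        have hr0 : 0 ≤ (r : ℝ) := r.2.1
        gcongr
      · have e : (fun s : ℝ => ℓ * ((ℓ * s) ^ n / n.factorial * ‖V₁ - V₂‖)) =
            fun s => (ℓ ^ (n + 1) / n.factorial * ‖V₁ - V₂‖) * s ^ n := by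
          funext s
          rw [mul_pow, pow_succ]
          ring
        rw [e, intervalIntegral.integral_const_mul, integral_pow, Nat.factorial_succ]
        push_cast
        have : (n.factorial : ℝ) ≠ 0 := by positivity
        have : (n : ℝ) + 1 ≠ 0 := by positivity
        field_simp
        rw [zero_pow n.succ_ne_zero, sub_zero, mul_pow]
        ring
  obtain ⟨n, hn⟩ : ∃ n : ℕ, (ℓ * T) ^ n / n.factorial < 1 / 2 :=
    ((FloorSemiring.tendsto_pow_div_factorial_atTop (ℓ * T)).eventually
      (gt_mem_nhds (by norm_num))).exists
  have hcontr : ContractingWith (1 / 2) (Φ^[n]) := by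
    refine ⟨by rw [← NNReal.coe_lt_coe]; norm_num, LipschitzWith.of_dist_le_mul fun V₁ V₂ => ?_⟩
    rw [dist_eq_norm, dist_eq_norm]
    refine (ContinuousMap.norm_le _ (by positivity)).mpr fun t => ?_
    refine (iter n V₁ V₂ t).trans ?_
    have h1 : (ℓ * t) ^ n / n.factorial ≤ (ℓ * T) ^ n / n.factorial := by
      have h0 : 0 ≤ (t : ℝ) := t.2.1
      have h1 : (t : ℝ) ≤ T := t.2.2
      gcongr
    have : ((1 / 2 : ℝ≥0) : ℝ) = 1 / 2 := by norm_num
    rw [this]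
    exact mul_le_mul_of_nonneg_right (h1.trans hn.le) (norm_nonneg _)
  obtain ⟨V₀, hV₀⟩ := hP0
  have : Nonempty C(Icc (0 : ℝ) T, X) := ⟨V₀⟩
  refine ⟨ContractingWith.fixedPoint _ hcontr, ?_, ?_⟩
  · have hclosed : IsClosed {V : C(Icc (0 : ℝ) T, X) | ∀ t, V t ∈ P t} := by
      have : {V : C(Icc (0 : ℝ) T, X) | ∀ t, V t ∈ P t} = ⋂ t, (fun V => V t) ⁻¹' P t := by
        ext V; simp
      rw [this]
      exact isClosed_iInter fun t => (hP t).preimage (by fun_prop)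
    have hmem : ∀ j : ℕ, ∀ V : C(Icc (0 : ℝ) T, X), (∀ t, V t ∈ P t) → ∀ t, (Φ^[j] V) t ∈ P t := by
      intro j
      induction j with
      | zero => intro V hV; simpa using hV
      | succ j ih =>
        intro V hV
        rw [Function.iterate_succ_apply]
        exact ih _ (hinv V hV)
    refine hclosed.mem_of_tendsto (hcontr.tendsto_iterate_fixedPoint V₀)
      (Eventually.of_forall fun j => ?_)
    rw [← Function.iterate_mul]
    exact hmem _ V₀ hV₀
  · intro t
    have h1 : Φ (ContractingWith.fixedPoint _ hcontr) = ContractingWith.fixedPoint _ hcontr :=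
      ContractingWith.isFixedPt_fixedPoint_iterate hcontr
    conv_lhs => rw [← h1]
    exact hΦ _ _

end IsometryGroup

/-! ### Essentially bounded elements of `L²` -/

section EssBdd

variable {α E : Type*} [MeasurableSpace α] {μ : Measure α} [NormedAddCommGroup E]

/-- `f` is essentially bounded by `K`. -/
def EssBdd (K : ℝ) (f : Lp E 2 μ) : Prop := ∀ᵐ y ∂μ, ‖f y‖ ≤ K

theorem EssBdd.mono {K K' : ℝ} {f : Lp E 2 μ} (h : EssBdd K f) (hK : K ≤ K') : EssBdd K' f :=
  Eventually.mono h fun _ hy => hy.trans hK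

theorem EssBdd.add {K K' : ℝ} {f g : Lp E 2 μ} (hf : EssBdd K f) (hg : EssBdd K' g) :
    EssBdd (K + K') (f + g) := by
  filter_upwards [hf, hg, Lp.coeFn_add f g] with y h1 h2 h3
  rw [h3]
  exact (norm_add_le _ _).trans (add_le_add h1 h2)

theorem EssBdd.sub {K K' : ℝ} {f g : Lp E 2 μ} (hf : EssBdd K f) (hg : EssBdd K' g) :
    EssBdd (K + K') (f - g) := by
  filter_upwards [hf, hg, Lp.coeFn_sub f g] with y h1 h2 h3
  rw [h3]
  exact (norm_sub_le _ _).trans (add_le_add h1 h2)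

theorem essBdd_zero {K : ℝ} (hK : 0 ≤ K) : EssBdd K (0 : Lp E 2 μ) := by
  filter_upwards [Lp.coeFn_zero E 2 μ] with y h
  rw [h]
  simpa using hK

theorem EssBdd.norm_le [IsFiniteMeasure μ] {K : ℝ} (hK : 0 ≤ K) {f : Lp E 2 μ} (h : EssBdd K f) :
    ‖f‖ ≤ √(μ.real univ) * K := by
  rw [Lp.norm_def, Real.sqrt_eq_rpow]
  refine ENNReal.toReal_le_of_le_ofReal (by positivity) ((eLpNorm_le_of_ae_bound h).trans ?_)
  rw [ENNReal.ofReal_mul (by positivity),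
    ← ENNReal.ofReal_rpow_of_nonneg measureReal_nonneg (by norm_num), ofReal_measureReal]
  norm_num

variable [NormedSpace ℝ E]

theorem EssBdd.smul {K : ℝ} {f : Lp E 2 μ} (hf : EssBdd K f) (r : ℝ) :
    EssBdd (|r| * K) (r • f) := by
  filter_upwards [hf, Lp.coeFn_smul r f] with y h1 h2
  rw [h2, Pi.smul_apply, norm_smul, Real.norm_eq_abs]
  exact mul_le_mul_of_nonneg_left h1 (abs_nonneg r)

/-- Restriction of square integrable functions to a set. -/
def restrictCLM (E : Type*) [NormedAddCommGroup E] [NormedSpace ℝ E] (μ : Measure α) (A : Set α) :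
    Lp E 2 μ →L[ℝ] Lp E 2 (μ.restrict A) := LpToLpRestrictCLM α E ℝ μ 2 A

theorem norm_restrictCLM (A : Set α) (f : Lp E 2 μ) :
    ‖restrictCLM E μ A f‖ = (eLpNorm f 2 (μ.restrict A)).toReal := by
  rw [Lp.norm_def]
  exact congrArg _ (eLpNorm_congr_ae (LpToLpRestrictCLM_coeFn ℝ A f))

variable [IsFiniteMeasure μ]

/-- Essential boundedness in terms of the `L²` norms over measurable sets. In this form it is
visibly preserved under limits and integrals in `L²`. -/
theorem essBdd_iff {K : ℝ} (hK : 0 ≤ K) (f : Lp E 2 μ) :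
    EssBdd K f ↔ ∀ A, MeasurableSet A → ‖restrictCLM E μ A f‖ ≤ K * √(μ.real A) := by
  have e : ∀ A, (μ.restrict A) univ ^ ((2 : ℝ≥0∞).toReal)⁻¹ * ENNReal.ofReal K =
      ENNReal.ofReal (K * √(μ.real A)) := by
    intro A
    rw [Measure.restrict_apply_univ, ENNReal.ofReal_mul hK, mul_comm, Real.sqrt_eq_rpow,
      ← ENNReal.ofReal_rpow_of_nonneg measureReal_nonneg (by norm_num), ofReal_measureReal]
    norm_num
  have hfin : ∀ A, eLpNorm f 2 (μ.restrict A) ≠ ⊤ := fun A =>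
    ((Lp.memLp f).restrict A).eLpNorm_ne_top
  have hiff : ∀ A, ‖restrictCLM E μ A f‖ ≤ K * √(μ.real A) ↔
      eLpNorm f 2 (μ.restrict A) ≤ (μ.restrict A) univ ^ ((2 : ℝ≥0∞).toReal)⁻¹ *
        ENNReal.ofReal K := by
    intro A
    rw [norm_restrictCLM, e, ENNReal.le_ofReal_iff_toReal_le (hfin A) (by positivity)]
  simp only [hiff]
  constructor
  · intro h A _
    exact eLpNorm_le_of_ae_bound (ae_restrict_of_ae h)
  · intro h
    -- compare the integrals of the squares over all measurable sets
    have key : (fun y => ‖f y‖ₑ ^ (2 : ℝ)) ≤ᵐ[μ] fun _ => ENNReal.ofReal K ^ (2 : ℝ) := by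
      refine ae_le_of_forall_setLIntegral_le_of_sigmaFinite₀ ?_ fun A hA _ => ?_
      · exact (Lp.aestronglyMeasurable f).enorm.pow_const _
      · have h1 := ENNReal.rpow_le_rpow (h A hA) (z := 2) (by norm_num)
        rw [eLpNorm_eq_lintegral_rpow_enorm_toReal (by norm_num) (by norm_num),
          ENNReal.mul_rpow_of_nonneg _ _ (by norm_num), ← ENNReal.rpow_mul, ← ENNReal.rpow_mul]
          at h1
        norm_num at h1
        rw [setLIntegral_const]
        norm_num
        rw [mul_comm]
        exact h1
    filter_upwards [key] with y hy
    have h1 := (ENNReal.rpow_le_rpow_iff (by norm_num : (0 : ℝ) < 2)).mp hy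
    rwa [← ofReal_norm, ENNReal.ofReal_le_ofReal_iff hK] at h1

theorem isClosed_essBdd {K : ℝ} (hK : 0 ≤ K) : IsClosed {f : Lp E 2 μ | EssBdd K f} := by
  have : {f : Lp E 2 μ | EssBdd K f} = ⋂ (A : Set α) (_ : MeasurableSet A),
      {f : Lp E 2 μ | ‖restrictCLM E μ A f‖ ≤ K * √(μ.real A)} := by
    ext f
    simp only [mem_iInter, mem_ofPred_eq]
    exact essBdd_iff hK f
  rw [this]
  exact isClosed_iInter fun A => isClosed_iInter fun _ =>
    isClosed_le (restrictCLM E μ A).continuous.norm continuous_const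

theorem EssBdd.intervalIntegral [CompleteSpace E] {F : ℝ → Lp E 2 μ} {m : ℝ → ℝ} {a b : ℝ}
    (hab : a ≤ b) (hF : Continuous F) (hm : Continuous m) (hm0 : ∀ s ∈ Icc a b, 0 ≤ m s)
    (h : ∀ s ∈ Icc a b, EssBdd (m s) (F s)) : EssBdd (∫ s in a..b, m s) (∫ s in a..b, F s) := by
  rw [essBdd_iff (intervalIntegral.integral_nonneg hab hm0)]
  intro A hA
  rw [← (restrictCLM E μ A).intervalIntegral_comp_comm (hF.intervalIntegrable _ _),
    ← intervalIntegral.integral_mul_const]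
  refine intervalIntegral.norm_integral_le_of_norm_le hab (ae_of_all _ fun s hs => ?_)
    ((hm.mul continuous_const).intervalIntegrable _ _)
  have hs' := Ioc_subset_Icc_self hs
  exact (essBdd_iff (hm0 s hs') _).mp (h s hs') A hA

end EssBdd

/-! ### Pairs and superposition operators -/

section Nemytskii

variable {α E F : Type*} [MeasurableSpace α] {μ : Measure α}
  [NormedAddCommGroup E] [NormedSpace ℝ E] [NormedAddCommGroup F] [NormedSpace ℝ F]

/-- The pair of two square integrable functions. -/
def pairLp (f : Lp E 2 μ) (g : Lp F 2 μ) : Lp (E × F) 2 μ :=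
  (ContinuousLinearMap.inl ℝ E F).compLpL 2 μ f + (ContinuousLinearMap.inr ℝ E F).compLpL 2 μ g

theorem coeFn_pairLp (f : Lp E 2 μ) (g : Lp F 2 μ) :
    ∀ᵐ y ∂μ, pairLp f g y = (f y, g y) := by
  filter_upwards [Lp.coeFn_add ((ContinuousLinearMap.inl ℝ E F).compLpL 2 μ f)
    ((ContinuousLinearMap.inr ℝ E F).compLpL 2 μ g),
    (ContinuousLinearMap.inl ℝ E F).coeFn_compLpL f,
    (ContinuousLinearMap.inr ℝ E F).coeFn_compLpL g] with y h1 h2 h3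
  rw [pairLp, h1, Pi.add_apply, h2, h3]
  simp

theorem continuous_pairLp {β : Type*} [TopologicalSpace β] {f : β → Lp E 2 μ} {g : β → Lp F 2 μ}
    (hf : Continuous f) (hg : Continuous g) : Continuous fun t => pairLp (f t) (g t) :=
  (((ContinuousLinearMap.inl ℝ E F).compLpL 2 μ).continuous.comp hf).add
    (((ContinuousLinearMap.inr ℝ E F).compLpL 2 μ).continuous.comp hg)

theorem HasDerivWithinAt.pairLp {f : ℝ → Lp E 2 μ} {g : ℝ → Lp F 2 μ} {f' : Lp E 2 μ}
    {g' : Lp F 2 μ} {s : Set ℝ} {t : ℝ} (hf : HasDerivWithinAt f f' s t)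
    (hg : HasDerivWithinAt g g' s t) :
    HasDerivWithinAt (fun t => pairLp (f t) (g t)) (pairLp f' g') s t :=
  (((ContinuousLinearMap.inl ℝ E F).compLpL 2 μ).hasFDerivAt.comp_hasDerivWithinAt t hf).add
    (((ContinuousLinearMap.inr ℝ E F).compLpL 2 μ).hasFDerivAt.comp_hasDerivWithinAt t hg)

theorem norm_pairLp_sub_le (f f' : Lp E 2 μ) (g g' : Lp F 2 μ) :
    ‖pairLp f g - pairLp f' g'‖ ≤ ‖f - f'‖ + ‖g - g'‖ := by
  have e : pairLp f g - pairLp f' g' = pairLp (f - f') (g - g') := by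
    simp only [pairLp, map_sub]; abel
  rw [e]
  refine (norm_add_le _ _).trans (add_le_add ?_ ?_)
  · refine ((ContinuousLinearMap.inl ℝ E F).norm_compLp_le _).trans ?_
    exact mul_le_of_le_one_left (norm_nonneg _) (ContinuousLinearMap.norm_inl_le_one ..)
  · refine ((ContinuousLinearMap.inr ℝ E F).norm_compLp_le _).trans ?_
    exact mul_le_of_le_one_left (norm_nonneg _) (ContinuousLinearMap.norm_inr_le_one ..)

theorem EssBdd.pairLp {K K' : ℝ} {f : Lp E 2 μ} {g : Lp F 2 μ} (hf : EssBdd K f)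
    (hg : EssBdd K' g) : EssBdd (max K K') (pairLp f g) := by
  filter_upwards [hf, hg, coeFn_pairLp f g] with y h1 h2 h3
  rw [h3]
  exact max_le_max h1 h2

/-- The radial truncation at `K`. -/
def trunc (K : ℝ) (r : E) : E := (K / max K ‖r‖) • r

theorem trunc_of_norm_le {K : ℝ} (hK : 0 < K) {r : E} (h : ‖r‖ ≤ K) : trunc K r = r := by
  rw [trunc, max_eq_left h, div_self hK.ne', one_smul]

theorem norm_trunc_le {K : ℝ} (hK : 0 < K) (r : E) : ‖trunc K r‖ ≤ K := by
  have hm : 0 < max K ‖r‖ := lt_max_of_lt_left hK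
  rw [trunc, norm_smul, Real.norm_of_nonneg (by positivity), div_mul_eq_mul_div, div_le_iff₀ hm]
  exact mul_le_mul_of_nonneg_left (le_max_right _ _) hK.le

theorem norm_trunc_le_norm {K : ℝ} (hK : 0 < K) (r : E) : ‖trunc K r‖ ≤ ‖r‖ := by
  have hm : 0 < max K ‖r‖ := lt_max_of_lt_left hK
  rw [trunc, norm_smul, Real.norm_of_nonneg (by positivity)]
  exact mul_le_of_le_one_left (norm_nonneg _) ((div_le_one hm).mpr (le_max_left _ _))

theorem norm_trunc_sub_le {K : ℝ} (hK : 0 < K) (r s : E) :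
    ‖trunc K r - trunc K s‖ ≤ 2 * ‖r - s‖ := by
  have hr : 0 < max K ‖r‖ := lt_max_of_lt_left hK
  have hs : 0 < max K ‖s‖ := lt_max_of_lt_left hK
  have e : trunc K r - trunc K s =
      (K / max K ‖r‖) • (r - s) + (K / max K ‖r‖ - K / max K ‖s‖) • s := by
    simp only [trunc]; module
  have h1 : ‖(K / max K ‖r‖) • (r - s)‖ ≤ ‖r - s‖ := by
    rw [norm_smul, Real.norm_of_nonneg (by positivity)]
    exact mul_le_of_le_one_left (norm_nonneg _) ((div_le_one hr).mpr (le_max_left _ _))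
  have h2 : ‖(K / max K ‖r‖ - K / max K ‖s‖) • s‖ ≤ ‖r - s‖ := by
    have h3 : |max K ‖s‖ - max K ‖r‖| ≤ ‖r - s‖ := by
      refine (abs_max_sub_max_le_max _ _ _ _).trans ?_
      rw [sub_self, abs_zero, max_eq_right (abs_nonneg _), abs_sub_comm]
      exact abs_norm_sub_norm_le r s
    have e2 : K / max K ‖r‖ - K / max K ‖s‖ =
        (K / max K ‖r‖) * ((max K ‖s‖ - max K ‖r‖) / max K ‖s‖) := by
      field_simp
    rw [norm_smul, e2, Real.norm_eq_abs, abs_mul, abs_of_pos (div_pos hK hr), abs_div,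
      abs_of_pos hs, mul_assoc]
    have h4 : |max K ‖s‖ - max K ‖r‖| / max K ‖s‖ * ‖s‖ ≤ |max K ‖s‖ - max K ‖r‖| := by
      rw [div_mul_eq_mul_div, div_le_iff₀ hs]
      exact mul_le_mul_of_nonneg_left (le_max_right _ _) (abs_nonneg _)
    refine (mul_le_of_le_one_left (by positivity) ((div_le_one hr).mpr (le_max_left _ _))).trans ?_
    exact h4.trans h3
  rw [e, two_mul]
  exact (norm_add_le _ _).trans (add_le_add h1 h2)

/-- The directional derivative `(q, r) ↦ ψ'(q) r`, truncated in the direction. -/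
def dirDeriv (K : ℝ) (ψ' : E → E →L[ℝ] F) (z : E × E) : F := ψ' z.1 (trunc K z.2)

theorem lipschitzWith_dirDeriv {K : ℝ} (hK : 0 < K) {ψ' : E → E →L[ℝ] F} {ℓ ℓ₂ : ℝ≥0}
    (hb : ∀ q, ‖ψ' q‖ ≤ ℓ) (hl : LipschitzWith ℓ₂ ψ') :
    LipschitzWith (ℓ₂ * K.toNNReal + ℓ * 2) (dirDeriv K ψ') := by
  refine LipschitzWith.of_dist_le_mul fun z w => ?_
  rw [dist_eq_norm]
  have e : dirDeriv K ψ' z - dirDeriv K ψ' w =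
      (ψ' z.1 - ψ' w.1) (trunc K z.2) + ψ' w.1 (trunc K z.2 - trunc K w.2) := by
    simp [dirDeriv]
  have h1 : ‖(ψ' z.1 - ψ' w.1) (trunc K z.2)‖ ≤ ℓ₂ * dist z w * K := by
    refine (ContinuousLinearMap.le_opNorm _ _).trans
      (mul_le_mul ?_ (norm_trunc_le hK _) (norm_nonneg _) (by positivity))
    rw [← dist_eq_norm]
    refine (hl.dist_le_mul _ _).trans ?_
    exact mul_le_mul_of_nonneg_left (le_max_left _ _) ℓ₂.2
  have h2 : ‖ψ' w.1 (trunc K z.2 - trunc K w.2)‖ ≤ ℓ * (2 * dist z w) := by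
    refine (ContinuousLinearMap.le_opNorm _ _).trans
      (mul_le_mul (hb _) ((norm_trunc_sub_le hK _ _).trans ?_) (norm_nonneg _) ℓ.2)
    rw [← dist_eq_norm]
    exact mul_le_mul_of_nonneg_left (le_max_right _ _) (by norm_num)
  rw [e]
  refine (norm_add_le _ _).trans ((add_le_add h1 h2).trans (le_of_eq ?_))
  push_cast
  rw [Real.coe_toNNReal _ hK.le]
  ring

theorem dirDeriv_zero (K : ℝ) (ψ' : E → E →L[ℝ] F) : dirDeriv K ψ' 0 = 0 := by
  simp [dirDeriv, trunc]

theorem norm_dirDeriv_le {K : ℝ} (hK : 0 < K) {ψ' : E → E →L[ℝ] F} {ℓ : ℝ≥0}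
    (hb : ∀ q, ‖ψ' q‖ ≤ ℓ) (z : E × E) : ‖dirDeriv K ψ' z‖ ≤ ℓ * ‖z.2‖ :=
  (ContinuousLinearMap.le_opNorm _ _).trans
    (mul_le_mul (hb _) (norm_trunc_le_norm hK _) (norm_nonneg _) ℓ.2)

end Nemytskii

/-! ### The chain rule for superposition operators -/

section ChainRule

variable {α E F : Type*} [MeasurableSpace α] {μ : Measure α}
  [NormedAddCommGroup E] [NormedAddCommGroup F]

/-- The pointwise norm of a square integrable function. -/
def normLp (f : Lp E 2 μ) : Lp ℝ 2 μ := (lipschitzWith_one_norm (E := E)).compLp norm_zero f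

theorem coeFn_normLp (f : Lp E 2 μ) : ∀ᵐ y ∂μ, normLp f y = ‖f y‖ :=
  (lipschitzWith_one_norm (E := E)).coeFn_compLp norm_zero f

theorem norm_normLp (f : Lp E 2 μ) : ‖normLp f‖ = ‖f‖ := by
  refine le_antisymm (Lp.norm_le_norm_of_ae_le ?_) (Lp.norm_le_norm_of_ae_le ?_) <;>
  · filter_upwards [coeFn_normLp f] with y hy
    rw [hy, norm_norm]

theorem norm_le_of_ae_le_add {f : Lp F 2 μ} {g g' : Lp E 2 μ} {c c' : ℝ} (hc : 0 ≤ c) (hc' : 0 ≤ c')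
    (h : ∀ᵐ y ∂μ, ‖f y‖ ≤ c * ‖g y‖ + c' * ‖g' y‖) : ‖f‖ ≤ c * ‖g‖ + c' * ‖g'‖ := by
  have h1 : ‖f‖ ≤ ‖c • normLp g + c' • normLp g'‖ := by
    refine Lp.norm_le_norm_of_ae_le ?_
    filter_upwards [h, coeFn_normLp g, coeFn_normLp g', Lp.coeFn_smul c (normLp g),
      Lp.coeFn_smul c' (normLp g'), Lp.coeFn_add (c • normLp g) (c' • normLp g')] with
      y h1 h2 h3 h4 h5 h6
    rw [h6, Pi.add_apply, h4, h5, Pi.smul_apply, Pi.smul_apply, h2, h3, smul_eq_mul, smul_eq_mul]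
    exact h1.trans (le_abs_self _)
  refine h1.trans ((norm_add_le _ _).trans ?_)
  rw [norm_smul, norm_smul, norm_normLp, norm_normLp, Real.norm_of_nonneg hc,
    Real.norm_of_nonneg hc']

variable [NormedSpace ℝ E] [NormedSpace ℝ F]

/-- The first-order Taylor estimate for a function with Lipschitz derivative. -/
theorem norm_taylor_le {ψ : E → F} {ψ' : E → E →L[ℝ] F} {ℓ₂ : ℝ≥0}
    (hψ : ∀ q, HasFDerivAt ψ (ψ' q) q) (hl : LipschitzWith ℓ₂ ψ') (a b : E) :
    ‖ψ b - ψ a - ψ' a (b - a)‖ ≤ ℓ₂ * ‖b - a‖ * ‖b - a‖ := by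
  refine (convex_closedBall a ‖b - a‖).norm_image_sub_le_of_norm_hasFDerivWithin_le'
    (f' := ψ') (fun x _ => (hψ x).hasFDerivWithinAt) (fun x hx => ?_)
    (Metric.mem_closedBall_self (norm_nonneg _)) (by simp [dist_eq_norm])
  rw [← dist_eq_norm]
  exact (hl.dist_le_mul _ _).trans (mul_le_mul_of_nonneg_left hx ℓ₂.2)

/-- The chain rule for superposition operators in `L²`, along curves that are Lipschitz in the
supremum norm. Without this restriction superposition is not differentiable in `L²`. -/
theorem hasDerivAt_superposition {ψ : E → F} {ψ' : E → E →L[ℝ] F} {ℓ ℓ₂ : ℝ≥0} {K : ℝ} (hK : 0 < K)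
    (hψ : ∀ q, HasFDerivAt ψ (ψ' q) q) (hb : ∀ q, ‖ψ' q‖ ≤ ℓ) (hl : LipschitzWith ℓ₂ ψ')
    (hL : LipschitzWith ℓ ψ) (h0 : ψ 0 = 0) {y : ℝ → Lp E 2 μ} {y' : Lp E 2 μ} {t : ℝ}
    (hy : HasDerivAt y y' t) (hy' : EssBdd K y')
    (hsup : ∀ s, EssBdd (K * |s - t|) (y s - y t)) :
    HasDerivAt (fun s => hL.compLp h0 (y s))
      ((lipschitzWith_dirDeriv hK hb hl).compLp (dirDeriv_zero K ψ') (pairLp (y t) y')) t := by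
  rw [hasDerivAt_iff_isLittleO] at hy ⊢
  have hcont : Tendsto (fun s => y s - y t) (𝓝 t) (𝓝 0) := by
    have : HasDerivAt y y' t := hasDerivAt_iff_isLittleO.mpr hy
    simpa using this.continuousAt.tendsto.sub_const (y t)
  have bound : ∀ s, ‖hL.compLp h0 (y s) - hL.compLp h0 (y t) - (s - t) •
      (lipschitzWith_dirDeriv hK hb hl).compLp (dirDeriv_zero K ψ') (pairLp (y t) y')‖ ≤
      ℓ₂ * K * |s - t| * ‖y s - y t‖ + ℓ * ‖y s - y t - (s - t) • y'‖ := by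
    intro s
    refine norm_le_of_ae_le_add (by positivity) ℓ.2 ?_
    filter_upwards [hsup s, hy', Lp.coeFn_sub (y s) (y t), hL.coeFn_compLp h0 (y s),
      hL.coeFn_compLp h0 (y t),
      (lipschitzWith_dirDeriv hK hb hl).coeFn_compLp (dirDeriv_zero K ψ') (pairLp (y t) y'),
      coeFn_pairLp (y t) y', Lp.coeFn_smul (s - t) y', Lp.coeFn_sub (y s - y t) ((s - t) • y'),
      Lp.coeFn_sub (hL.compLp h0 (y s)) (hL.compLp h0 (y t)),
      Lp.coeFn_sub (hL.compLp h0 (y s) - hL.compLp h0 (y t)) ((s - t) •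
        (lipschitzWith_dirDeriv hK hb hl).compLp (dirDeriv_zero K ψ') (pairLp (y t) y')),
      Lp.coeFn_smul (s - t)
        ((lipschitzWith_dirDeriv hK hb hl).compLp (dirDeriv_zero K ψ') (pairLp (y t) y'))] with
      x h1 h2 h3 h4 h5 h6 h7 h8 h9 h10 h11 h12
    rw [h3, Pi.sub_apply] at h1
    rw [h11, Pi.sub_apply, h10, Pi.sub_apply, h12, Pi.smul_apply, h4, h5, h6, h9, Pi.sub_apply, h3,
      Pi.sub_apply, h8, Pi.smul_apply, Function.comp_apply, Function.comp_apply,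
      Function.comp_apply, h7]
    set a := y t x
    set b := y s x
    set d := y' x
    have e : ψ b - ψ a - (s - t) • dirDeriv K ψ' (a, d) =
        (ψ b - ψ a - ψ' a (b - a)) + ψ' a (b - a - (s - t) • d) := by
      rw [dirDeriv, trunc_of_norm_le hK h2, map_sub (ψ' a) (b - a), map_smul]
      abel
    rw [e]
    refine (norm_add_le _ _).trans (add_le_add ?_ ?_)
    · refine (norm_taylor_le hψ hl a b).trans ?_
      rw [mul_assoc (ℓ₂ : ℝ) K]
      gcongr
    · exact (ContinuousLinearMap.le_opNorm _ _).trans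
        (mul_le_mul_of_nonneg_right (hb a) (norm_nonneg _))
  refine Asymptotics.IsLittleO.trans_isBigO (g := fun s => (s - t)) ?_ (Asymptotics.isBigO_refl _ _)
  refine Asymptotics.IsBigO.trans_isLittleO (g := fun s =>
    ℓ₂ * K * |s - t| * ‖y s - y t‖ + ℓ * ‖y s - y t - (s - t) • y'‖)
    (Asymptotics.IsBigO.of_norm_le fun s => bound s) ?_
  refine Asymptotics.IsLittleO.add ?_ (hy.norm_left.const_mul_left _)
  have h1 : (fun s => ‖y s - y t‖) =o[𝓝 t] fun _ => (1 : ℝ) :=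
    (Asymptotics.isLittleO_one_iff ℝ).mpr (by simpa using hcont.norm)
  have h2 : (fun s => ℓ₂ * K * |s - t|) =O[𝓝 t] fun s => s - t :=
    ((Asymptotics.isBigO_refl (fun s => s - t) (𝓝 t)).norm_left).const_mul_left _
  simpa using h2.mul_isLittleO h1

end ChainRule

/-! ### Square integrable functions on the circle of length two -/

instance fact_zero_lt_two : Fact ((0 : ℝ) < 2) := ⟨two_pos⟩

/-- Square integrable functions on the circle `ℝ / 2ℤ`. -/
abbrev LC (E : Type*) [NormedAddCommGroup E] : Type _ :=
  Lp E 2 (volume : Measure (AddCircle (2 : ℝ)))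

section Circle

variable {E : Type*} [NormedAddCommGroup E]

theorem ae_circle_iff {P : AddCircle (2 : ℝ) → Prop} (h : ∀ᵐ y, P y) :
    ∀ᵐ x : ℝ, P (x : AddCircle (2 : ℝ)) := by
  have h1 : ∀ n : ℤ, ∀ᵐ x : ℝ, x ∈ Ioc (n : ℝ) (n + 2) → P (x : AddCircle (2 : ℝ)) := fun n =>
    (ae_restrict_iff' measurableSet_Ioc).mp
      ((AddCircle.measurePreserving_mk 2 (n : ℝ)).quasiMeasurePreserving.ae h)
  filter_upwards [ae_all_iff.mpr h1] with x hx
  refine hx (⌈x⌉ - 1) ⟨?_, ?_⟩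
  · push_cast; linarith [Int.ceil_lt_add_one x]
  · push_cast; linarith [Int.le_ceil x]

theorem measurePreserving_circle_sub (t : ℝ) :
    MeasurePreserving (fun y : AddCircle (2 : ℝ) => y - (t : AddCircle (2 : ℝ))) volume volume :=
  measurePreserving_sub_right _ _

/-- Composition with the reflection of the circle. -/
def reflect [NormedSpace ℝ E] : LC E →ₗᵢ[ℝ] LC E :=
  Lp.compMeasurePreservingₗᵢ ℝ (fun y => -y) (Measure.measurePreserving_neg _)

theorem coeFn_reflect [NormedSpace ℝ E] (f : LC E) : ∀ᵐ y, reflect f y = f (-y) :=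
  Lp.coeFn_compMeasurePreserving f (Measure.measurePreserving_neg _)

/-- The translation group on the circle, `(S(t) f)(y) = f(y - t)`. -/
def transl (E : Type*) [NormedAddCommGroup E] [NormedSpace ℝ E] : IsometryGroup (LC E) where
  toFun t := Lp.compMeasurePreservingₗᵢ ℝ _ (measurePreserving_circle_sub t)
  zero_apply f := by
    refine Lp.ext ?_
    filter_upwards [Lp.coeFn_compMeasurePreserving f (measurePreserving_circle_sub 0)] with y hy
    refine hy.trans ?_
    simp
  add_apply s t f := by
    refine Lp.ext ?_
    filter_upwards [Lp.coeFn_compMeasurePreserving f (measurePreserving_circle_sub (s + t)),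
      Lp.coeFn_compMeasurePreserving
        (Lp.compMeasurePreserving _ (measurePreserving_circle_sub t) f)
        (measurePreserving_circle_sub s),
      (measurePreserving_circle_sub s).quasiMeasurePreserving.ae
        (Lp.coeFn_compMeasurePreserving f (measurePreserving_circle_sub t))] with y h1 h2 h3
    refine h1.trans (Eq.symm (h2.trans (h3.trans ?_)))
    simp only [Function.comp_apply, QuotientAddGroup.mk_add]
    congr 1
    abel
  continuous_apply f := by
    let g : C(ℝ, C(AddCircle (2 : ℝ), AddCircle (2 : ℝ))) := ContinuousMap.curry
      ⟨fun z => z.2 - (z.1 : AddCircle (2 : ℝ)),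
        continuous_snd.sub ((AddCircle.continuous_mk' 2).comp continuous_fst)⟩
    exact (continuous_const (y := f)).compMeasurePreservingLp g.continuous
      (fun t => measurePreserving_circle_sub t) (by norm_num)

theorem coeFn_transl [NormedSpace ℝ E] (t : ℝ) (f : LC E) :
    ∀ᵐ y : AddCircle (2 : ℝ), transl E t f y = f (y - (t : AddCircle (2 : ℝ))) :=
  Lp.coeFn_compMeasurePreserving f (measurePreserving_circle_sub t)

theorem EssBdd.transl [NormedSpace ℝ E] {K : ℝ} {f : LC E} (h : EssBdd K f) (t : ℝ) :
    EssBdd K (transl E t f) := by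
  filter_upwards [coeFn_transl t f,
    (measurePreserving_circle_sub t).quasiMeasurePreserving.ae h] with y h1 h2
  rw [h1]
  exact h2

theorem EssBdd.reflect [NormedSpace ℝ E] {K : ℝ} {f : LC E} (h : EssBdd K f) :
    EssBdd K (reflect f) := by
  filter_upwards [coeFn_reflect f,
    (Measure.measurePreserving_neg volume).quasiMeasurePreserving.ae h] with y h1 h2
  rw [h1]
  exact h2

/-- The representative in `(-1,1]` of a point of the circle. -/
def rep (y : AddCircle (2 : ℝ)) : ℝ := AddCircle.equivIoc 2 (-1) y

theorem measurable_rep : Measurable rep :=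
  measurable_subtype_coe.comp (AddCircle.measurableEquivIoc 2 (-1)).measurable

theorem rep_coe {x : ℝ} (hx : x ∈ Ioc (-1 : ℝ) 1) : rep (x : AddCircle (2 : ℝ)) = x :=
  AddCircle.equivIoc_coe_of_mem (by norm_num; exact hx)

theorem abs_rep_le (y : AddCircle (2 : ℝ)) : |rep y| ≤ 1 := by
  have h := (AddCircle.equivIoc 2 (-1) y).2
  rw [abs_le]
  have h1 := h.1
  have h2 := h.2
  exact ⟨h1.le, by unfold rep; linarith⟩

/-- The odd sign function of the circle. -/
def sgn (y : AddCircle (2 : ℝ)) : ℝ := if 0 < rep y then 1 else -1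

theorem measurable_sgn : Measurable sgn :=
  Measurable.ite (measurableSet_lt measurable_const measurable_rep) measurable_const
    measurable_const

theorem abs_sgn (y : AddCircle (2 : ℝ)) : |sgn y| = 1 := by
  unfold sgn; split_ifs <;> simp

theorem memLp_sgn_smul [NormedSpace ℝ E] (f : LC E) : MemLp (fun y => sgn y • f y) 2 volume :=
  (Lp.memLp f).of_le (measurable_sgn.aestronglyMeasurable.smul (Lp.aestronglyMeasurable f))
    (ae_of_all _ fun y => by rw [norm_smul, Real.norm_eq_abs, abs_sgn, one_mul])

/-- Multiplication by the odd sign function. -/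
def sgnMul [NormedSpace ℝ E] : LC E →L[ℝ] LC E :=
  LinearMap.mkContinuous
    { toFun := fun f => (memLp_sgn_smul f).toLp
      map_add' := fun f g => by
        refine Lp.ext ?_
        filter_upwards [(memLp_sgn_smul (f + g)).coeFn_toLp, (memLp_sgn_smul f).coeFn_toLp,
          (memLp_sgn_smul g).coeFn_toLp, Lp.coeFn_add f g,
          Lp.coeFn_add (memLp_sgn_smul f).toLp (memLp_sgn_smul g).toLp] with y h1 h2 h3 h4 h5
        rw [h1, h5, Pi.add_apply, h2, h3, h4, Pi.add_apply, smul_add]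
      map_smul' := fun r f => by
        refine Lp.ext ?_
        filter_upwards [(memLp_sgn_smul (r • f)).coeFn_toLp, (memLp_sgn_smul f).coeFn_toLp,
          Lp.coeFn_smul r f, Lp.coeFn_smul r (memLp_sgn_smul f).toLp] with y h1 h2 h3 h4
        rw [RingHom.id_apply, h1, h4, Pi.smul_apply, h2, h3, Pi.smul_apply, smul_comm] }
    1 fun f => by
      rw [one_mul]
      refine Lp.norm_le_norm_of_ae_le ?_
      filter_upwards [(memLp_sgn_smul f).coeFn_toLp] with y h
      refine le_of_eq ((congrArg norm h).trans ?_)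
      rw [norm_smul, Real.norm_eq_abs, abs_sgn, one_mul]

theorem coeFn_sgnMul [NormedSpace ℝ E] (f : LC E) : ∀ᵐ y, sgnMul f y = sgn y • f y :=
  (memLp_sgn_smul f).coeFn_toLp

theorem norm_sgnMul_le [NormedSpace ℝ E] (f : LC E) : ‖sgnMul f‖ ≤ ‖f‖ := by
  refine Lp.norm_le_norm_of_ae_le ?_
  filter_upwards [coeFn_sgnMul f] with y h
  rw [h, norm_smul, Real.norm_eq_abs, abs_sgn, one_mul]

theorem EssBdd.sgnMul [NormedSpace ℝ E] {K : ℝ} {f : LC E} (h : EssBdd K f) :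
    EssBdd K (sgnMul f) := by
  filter_upwards [coeFn_sgnMul f, h] with y h1 h2
  rwa [h1, norm_smul, Real.norm_eq_abs, abs_sgn, one_mul]

/-- The even extension of the velocity encoded in a function on the circle: the odd part, multiplied
by the sign. -/
def vel [NormedSpace ℝ E] : LC E →L[ℝ] LC E :=
  (1 / 2 : ℝ) • sgnMul.comp (ContinuousLinearMap.id ℝ _ - reflect.toContinuousLinearMap)

theorem vel_apply [NormedSpace ℝ E] (f : LC E) : vel f = (1 / 2 : ℝ) • sgnMul (f - reflect f) := rfl

theorem coeFn_vel [NormedSpace ℝ E] (f : LC E) :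
    ∀ᵐ y, vel f y = (1 / 2 : ℝ) • sgn y • (f y - f (-y)) := by
  filter_upwards [Lp.coeFn_smul (1 / 2 : ℝ) (sgnMul (f - reflect f)), coeFn_sgnMul (f - reflect f),
    Lp.coeFn_sub f (reflect f), coeFn_reflect f] with y h1 h2 h3 h4
  rw [vel_apply, h1, Pi.smul_apply, h2, h3, Pi.sub_apply, h4]

theorem norm_vel_le [NormedSpace ℝ E] (f : LC E) : ‖vel f‖ ≤ ‖f‖ := by
  rw [vel_apply, norm_smul]
  have h1 := norm_sgnMul_le (f - reflect f)
  have h2 := norm_sub_le f (reflect f)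
  rw [LinearIsometry.norm_map] at h2
  rw [Real.norm_of_nonneg (by norm_num)]
  linarith

theorem EssBdd.vel [NormedSpace ℝ E] {K : ℝ} {f : LC E} (h : EssBdd K f) : EssBdd K (vel f) := by
  have := ((h.sub h.reflect).sgnMul).smul (1 / 2)
  refine this.mono ?_
  rw [abs_of_pos (by norm_num)]
  linarith

section CompLp

variable {F : Type*} [NormedAddCommGroup F] [NormedSpace ℝ E] [NormedSpace ℝ F]

theorem transl_compLpL (A : E →L[ℝ] F) (t : ℝ) (f : LC E) :
    transl F t (A.compLpL 2 volume f) = A.compLpL 2 volume (transl E t f) := by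
  refine Lp.ext ?_
  filter_upwards [coeFn_transl t (A.compLpL 2 volume f), coeFn_transl t f,
    A.coeFn_compLpL (transl E t f),
    (measurePreserving_circle_sub t).quasiMeasurePreserving.ae (A.coeFn_compLpL f)] with
    y h1 h2 h3 h4
  rw [h1, h3, h2, h4]

theorem reflect_compLpL (A : E →L[ℝ] F) (f : LC E) :
    reflect (A.compLpL 2 volume f) = A.compLpL 2 volume (reflect f) := by
  refine Lp.ext ?_
  filter_upwards [coeFn_reflect (A.compLpL 2 volume f), coeFn_reflect f,
    A.coeFn_compLpL (reflect f), (Measure.measurePreserving_neg volume).quasiMeasurePreserving.ae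
      (A.coeFn_compLpL (p := 2) f)] with y h1 h2 h3 h4
  rw [h1, h3, h2]
  exact h4

theorem sgnMul_compLpL (A : E →L[ℝ] F) (f : LC E) :
    sgnMul (A.compLpL 2 volume f) = A.compLpL 2 volume (sgnMul f) := by
  refine Lp.ext ?_
  filter_upwards [coeFn_sgnMul (A.compLpL 2 volume f), coeFn_sgnMul f,
    A.coeFn_compLpL (sgnMul f), A.coeFn_compLpL (p := 2) f] with y h1 h2 h3 h4
  rw [h1, h3, h2, h4, map_smul]

theorem vel_compLpL (A : E →L[ℝ] F) (f : LC E) :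
    vel (A.compLpL 2 volume f) = A.compLpL 2 volume (vel f) := by
  rw [vel_apply, vel_apply, reflect_compLpL, ← map_sub, sgnMul_compLpL, map_smul]

theorem transl_pairLp (t : ℝ) (f : LC E) (g : LC F) :
    transl (E × F) t (pairLp f g) = pairLp (transl E t f) (transl F t g) := by
  rw [pairLp, map_add, transl_compLpL, transl_compLpL, pairLp]

theorem vel_pairLp (f : LC E) (g : LC F) : vel (pairLp f g) = pairLp (vel f) (vel g) := by
  rw [pairLp, map_add, vel_compLpL, vel_compLpL, pairLp]

theorem sgnMul_pairLp (f : LC E) (g : LC F) :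
    sgnMul (pairLp f g) = pairLp (sgnMul f) (sgnMul g) := by
  rw [pairLp, map_add, sgnMul_compLpL, sgnMul_compLpL, pairLp]

theorem mild_pairLp [CompleteSpace E] [CompleteSpace F] {f : ℝ → LC E} {g : ℝ → LC F}
    (hf : Continuous f) (hg : Continuous g) (t : ℝ) :
    (transl (E × F)).mild (fun s => pairLp (f s) (g s)) t =
      pairLp ((transl E).mild f t) ((transl F).mild g t) := by
  have cf : Continuous fun s => transl E (t - s) (f s) :=
    (transl E).continuous_comp (by fun_prop) hf
  have cg : Continuous fun s => transl F (t - s) (g s) :=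
    (transl F).continuous_comp (by fun_prop) hg
  simp only [IsometryGroup.mild, transl_pairLp]
  simp only [pairLp]
  rw [intervalIntegral.integral_add, ContinuousLinearMap.intervalIntegral_comp_comm,
    ContinuousLinearMap.intervalIntegral_comp_comm]
  · exact cg.intervalIntegrable _ _
  · exact cf.intervalIntegrable _ _
  · exact (((ContinuousLinearMap.inl ℝ E F).compLpL 2 volume).continuous.comp cf
      ).intervalIntegrable _ _
  · exact (((ContinuousLinearMap.inr ℝ E F).compLpL 2 volume).continuous.comp cg
      ).intervalIntegrable _ _

end CompLp

end Circle

/-! ### Regular mild solutions of semilinear equations -/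

section Extension

variable {X : Type*}

/-- The extension of a curve on `[0,T]` to all times that is constant outside `[0,T]`. -/
def clampExt {T : ℝ} (hT : 0 ≤ T) (f : ℝ → X) (t : ℝ) : X := f (projIcc 0 T hT t)

theorem clampExt_of_mem {T : ℝ} (hT : 0 ≤ T) (f : ℝ → X) {t : ℝ} (ht : t ∈ Icc 0 T) :
    clampExt hT f t = f t := by
  rw [clampExt, projIcc_of_mem hT ht]

variable [NormedAddCommGroup X]

theorem continuous_clampExt {T : ℝ} (hT : 0 ≤ T) {f : ℝ → X} (hf : ContinuousOn f (Icc 0 T)) :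
    Continuous (clampExt hT f) :=
  (continuousOn_iff_continuous_domRestrict.mp hf).comp continuous_projIcc

variable [NormedSpace ℝ X]

theorem hasDerivWithinAt_Ici_of_Icc {f : ℝ → X} {f' : X} {T t : ℝ} (ht : t ∈ Ico 0 T)
    (h : HasDerivWithinAt f f' (Icc 0 T) t) : HasDerivWithinAt f f' (Ici t) t :=
  h.mono_of_mem_nhdsWithin (mem_of_superset (Icc_mem_nhdsGE ht.2) (Icc_subset_Icc_left ht.1))

theorem eqOn_Icc_of_hasDerivWithinAt {f g f' : ℝ → X} {T : ℝ}
    (hf : ∀ t ∈ Icc 0 T, HasDerivWithinAt f (f' t) (Icc 0 T) t)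
    (hg : ∀ t ∈ Icc 0 T, HasDerivWithinAt g (f' t) (Icc 0 T) t) (h0 : f 0 = g 0) :
    ∀ t ∈ Icc 0 T, f t = g t :=
  eq_of_has_deriv_right_eq
    (fun t ht => hasDerivWithinAt_Ici_of_Icc ht (hf t (Ico_subset_Icc_self ht)))
    (fun t ht => hasDerivWithinAt_Ici_of_Icc ht (hg t (Ico_subset_Icc_self ht)))
    (fun t ht => (hf t ht).continuousWithinAt) (fun t ht => (hg t ht).continuousWithinAt) h0

variable [CompleteSpace X]

/-- A `C¹` curve on `[0,T]` extends to all times with a derivative that is constant outside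
`[0,T]`. -/
theorem exists_extension {T : ℝ} (hT : 0 ≤ T) {f f' : ℝ → X}
    (hf : ∀ t ∈ Icc 0 T, HasDerivWithinAt f (f' t) (Icc 0 T) t) (hf' : ContinuousOn f' (Icc 0 T)) :
    ∃ F : ℝ → X, (∀ t, HasDerivAt F (clampExt hT f' t) t) ∧ ∀ t ∈ Icc 0 T, F t = f t := by
  have hd : ∀ t, HasDerivAt (fun t => f 0 + ∫ s in (0 : ℝ)..t, clampExt hT f' s)
      (clampExt hT f' t) t := fun t =>
    (((continuous_clampExt hT hf').integral_hasStrictDerivAt 0 t).hasDerivAt).const_add _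
  refine ⟨_, hd, eqOn_Icc_of_hasDerivWithinAt (f' := f') (fun t ht => ?_) hf (by simp)⟩
  have := (hd t).hasDerivWithinAt (s := Icc 0 T)
  rwa [clampExt_of_mem hT f' ht] at this

end Extension

/-- The bound at time `t` for the time derivative of a mild solution whose data are bounded by `b`
and whose nonlinearity has Lipschitz constant `ℓ`. -/
def regBound (b ℓ t : ℝ) : ℝ := b * (1 + ℓ) * Real.exp ((1 + ℓ) * t)

theorem regBound_pos {b ℓ : ℝ} (hb : 0 < b) (hℓ : 0 ≤ ℓ) (t : ℝ) : 0 < regBound b ℓ t := by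
  unfold regBound; positivity

theorem regBound_mono {b ℓ s t : ℝ} (hb : 0 < b) (hℓ : 0 ≤ ℓ) (h : s ≤ t) :
    regBound b ℓ s ≤ regBound b ℓ t := by
  unfold regBound; gcongr

theorem continuous_regBound (b ℓ : ℝ) : Continuous (regBound b ℓ) := by
  unfold regBound; fun_prop

/-- The bound is a supersolution of the integral inequality for the derivative. -/
theorem regBound_integral {b ℓ t : ℝ} (hb : 0 < b) (hℓ : 0 ≤ ℓ) (ht : 0 ≤ t) :
    b + ∫ s in (0 : ℝ)..t, (b + ℓ * (regBound b ℓ s + b)) ≤ regBound b ℓ t := by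
  have hder : ∀ s, HasDerivAt (regBound b ℓ) ((1 + ℓ) * regBound b ℓ s) s := by
    intro s
    have h1 : HasDerivAt (fun s => (1 + ℓ) * s) (1 + ℓ) s := by
      simpa using (hasDerivAt_id s).const_mul (1 + ℓ)
    have := (h1.exp).const_mul (b * (1 + ℓ))
    refine this.congr_deriv ?_
    unfold regBound; ring
  have c := continuous_regBound b ℓ
  have h1 : ∫ s in (0 : ℝ)..t, (1 + ℓ) * regBound b ℓ s = regBound b ℓ t - regBound b ℓ 0 :=
    intervalIntegral.integral_eq_sub_of_hasDerivAt (fun s _ => hder s)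
      ((continuous_const.mul c).intervalIntegrable _ _)
  have h0 : regBound b ℓ 0 = b * (1 + ℓ) := by simp [regBound]
  have h2 : ∫ s in (0 : ℝ)..t, (b + ℓ * (regBound b ℓ s + b)) ≤
      ∫ s in (0 : ℝ)..t, (1 + ℓ) * regBound b ℓ s := by
    refine intervalIntegral.integral_mono_on ht
      (Continuous.intervalIntegrable (by fun_prop) _ _)
      (Continuous.intervalIntegrable (by fun_prop) _ _) fun s hs => ?_
    have := regBound_mono hb hℓ hs.1
    rw [h0] at this
    nlinarith
  rw [h1, h0] at h2
  nlinarith [mul_nonneg hb.le hℓ]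

variable {E : Type*} [NormedAddCommGroup E] [NormedSpace ℝ E] [CompleteSpace E]

/-- Existence of a continuously differentiable mild solution. The equation is solved for the time
derivative `V`, the solution itself being `W₀ + ∫ V`. The truncation of the differentiated
nonlinearity makes the equation for `V` globally Lipschitz in `L²`, and it is removed by the bound
for `V` in the supremum norm. -/
theorem exists_regular_mild {T b : ℝ} {ℓ ℓ₂ : ℝ≥0} (hT : 0 ≤ T) (hb : 0 < b) {ψ : E → E}
    {ψ' : E → E →L[ℝ] E} (hψ : ∀ q, HasFDerivAt ψ (ψ' q) q) (hbψ : ∀ q, ‖ψ' q‖ ≤ ℓ)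
    (hl : LipschitzWith ℓ₂ ψ') (hL : LipschitzWith ℓ ψ) (h0 : ψ 0 = 0) {B B' G G' : ℝ → LC E}
    (hB : ∀ t ∈ Icc 0 T, HasDerivWithinAt B (B' t) (Icc 0 T) t) (hB' : ContinuousOn B' (Icc 0 T))
    (bB : ∀ t ∈ Icc 0 T, EssBdd b (B' t))
    (hG : ∀ t ∈ Icc 0 T, HasDerivWithinAt G (G' t) (Icc 0 T) t) (hG' : ContinuousOn G' (Icc 0 T))
    (bG : ∀ t ∈ Icc 0 T, EssBdd b (G' t))
    {W₀ : LC E}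
    (hN₀ : EssBdd b (B 0 - sgnMul (hL.compLp h0 (vel W₀ + G 0)))) :
    ∃ W V f k : ℝ → LC E, Continuous k ∧ (∀ t, HasDerivAt W (V t) t) ∧
      (∀ t, HasDerivAt f (k t) t) ∧ (∀ t, W t = W₀ + (transl E).mild f t) ∧
      (∀ t, V t = transl E t (f 0) + (transl E).mild k t) ∧
      (∀ t ∈ Icc 0 T, f t = B t - sgnMul (hL.compLp h0 (vel (W t) + G t))) ∧
      (∀ t ∈ Icc 0 T, EssBdd (regBound b ℓ T) (V t)) ∧
      (∀ t ∈ Icc 0 T, ∃ κ : LC E, k t = B' t - sgnMul κ ∧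
        ∀ᵐ y, κ y = ψ' ((vel (W t) + G t) y) ((vel (V t) + G' t) y)) := by
  have hℓ : (0 : ℝ) ≤ ℓ := ℓ.2
  have h0T : (0 : ℝ) ∈ Icc 0 T := ⟨le_rfl, hT⟩
  obtain ⟨Be, hBe, eB⟩ := exists_extension hT hB hB'
  obtain ⟨Ge, hGe, eG⟩ := exists_extension hT hG hG'
  have cB' := continuous_clampExt hT hB'
  have cG' := continuous_clampExt hT hG'
  have cG : Continuous Ge := continuous_iff_continuousAt.mpr fun t => (hGe t).continuousAt
  have bB' : ∀ t, EssBdd b (clampExt hT B' t) := fun t => bB _ (projIcc 0 T hT t).2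
  have bG' : ∀ t, EssBdd b (clampExt hT G' t) := fun t => bG _ (projIcc 0 T hT t).2
  set K : ℝ := regBound b ℓ T + b with hKdef
  have hK : 0 < K := add_pos (regBound_pos hb hℓ T) hb
  let hφ := lipschitzWith_dirDeriv hK hbψ hl
  set Lφ : ℝ≥0 := ℓ₂ * K.toNNReal + ℓ * 2 with hLφ
  let φ0 := dirDeriv_zero K ψ'
  -- the curves determined by a candidate `V` for the time derivative, extended to all times
  let Vx : C(Icc (0 : ℝ) T, LC E) → ℝ → LC E := fun V t => V (projIcc 0 T hT t)
  have cVx : ∀ V, Continuous (Vx V) := fun V => V.continuous.comp continuous_projIcc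
  let Wx : C(Icc (0 : ℝ) T, LC E) → ℝ → LC E := fun V t => W₀ + ∫ s in (0 : ℝ)..t, Vx V s
  have hWx : ∀ V t, HasDerivAt (Wx V) (Vx V t) t := fun V t =>
    (((cVx V).integral_hasStrictDerivAt 0 t).hasDerivAt).const_add _
  let yx : C(Icc (0 : ℝ) T, LC E) → ℝ → LC E := fun V t => vel (Wx V t) + Ge t
  let dx : C(Icc (0 : ℝ) T, LC E) → ℝ → LC E := fun V t => vel (Vx V t) + clampExt hT G' t
  have hyx : ∀ V t, HasDerivAt (yx V) (dx V t) t := fun V t =>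
    ((vel (E := E)).hasFDerivAt.comp_hasDerivAt t (hWx V t)).add (hGe t)
  have cyx : ∀ V, Continuous (yx V) := fun V =>
    continuous_iff_continuousAt.mpr fun t => (hyx V t).continuousAt
  have cdx : ∀ V, Continuous (dx V) := fun V => (vel.continuous.comp (cVx V)).add cG'
  let kx : C(Icc (0 : ℝ) T, LC E) → ℝ → LC E := fun V t =>
    clampExt hT B' t - sgnMul (hφ.compLp φ0 (pairLp (yx V t) (dx V t)))
  have ckx : ∀ V, Continuous (kx V) := fun V =>
    cB'.sub (sgnMul.continuous.comp ((hφ.continuous_compLp φ0).comp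
      (continuous_pairLp (cyx V) (cdx V))))
  set N₀ : LC E := B 0 - sgnMul (hL.compLp h0 (vel W₀ + G 0)) with hN₀def
  have hlip : ∀ V₁ V₂ : C(Icc (0 : ℝ) T, LC E), ∀ t : Icc (0 : ℝ) T, ∀ m : ℝ,
      (∀ s ≤ t, ‖V₁ s - V₂ s‖ ≤ m) → ‖kx V₁ t - kx V₂ t‖ ≤ Lφ * (T + 1) * m := by
    intro V₁ V₂ t m hm
    have hm0 : 0 ≤ m := (norm_nonneg _).trans (hm t le_rfl)
    have hVx : ∀ s ∈ Icc (0 : ℝ) t, ‖Vx V₁ s - Vx V₂ s‖ ≤ m := by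
      intro s hs
      have hs' : s ∈ Icc 0 T := ⟨hs.1, hs.2.trans t.2.2⟩
      have := hm ⟨s, hs'⟩ hs.2
      simpa only [Vx, projIcc_of_mem hT hs'] using this
    have hy : ‖yx V₁ t - yx V₂ t‖ ≤ T * m := by
      have e : yx V₁ t - yx V₂ t = vel (∫ s in (0 : ℝ)..t, (Vx V₁ s - Vx V₂ s)) := by
        rw [intervalIntegral.integral_sub ((cVx V₁).intervalIntegrable _ _)
          ((cVx V₂).intervalIntegrable _ _)]
        simp only [yx, Wx, map_add, map_sub]
        abel
      rw [e]
      refine (norm_vel_le _).trans ?_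
      have := intervalIntegral.norm_integral_le_of_norm_le_const (a := 0) (b := (t : ℝ)) (C := m)
        (f := fun s => Vx V₁ s - Vx V₂ s) (fun s hs => by
          rw [uIoc_of_le t.2.1] at hs
          exact hVx s (Ioc_subset_Icc_self hs))
      refine this.trans ?_
      rw [sub_zero, abs_of_nonneg t.2.1, mul_comm]
      exact mul_le_mul_of_nonneg_right t.2.2 hm0
    have hd : ‖dx V₁ t - dx V₂ t‖ ≤ m := by
      have e : dx V₁ t - dx V₂ t = vel (Vx V₁ t - Vx V₂ t) := by
        simp only [dx, map_sub]; abel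
      rw [e]
      exact (norm_vel_le _).trans (hVx t ⟨t.2.1, le_rfl⟩)
    have e : kx V₁ t - kx V₂ t = sgnMul (hφ.compLp φ0 (pairLp (yx V₂ t) (dx V₂ t)) -
        hφ.compLp φ0 (pairLp (yx V₁ t) (dx V₁ t))) := by
      simp only [kx, map_sub]; abel
    rw [e, mul_assoc]
    refine (norm_sgnMul_le _).trans ((hφ.norm_compLp_sub_le φ0 _ _).trans
      (mul_le_mul_of_nonneg_left ?_ Lφ.2))
    rw [norm_sub_rev]
    refine (norm_pairLp_sub_le _ _ _ _).trans ?_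
    linarith
  -- the bound `regBound b ℓ` in the supremum norm is preserved by the equation for `V`
  have hinv : ∀ V : C(Icc (0 : ℝ) T, LC E), (∀ t : Icc (0 : ℝ) T, EssBdd (regBound b ℓ t) (V t)) →
      ∀ t : Icc (0 : ℝ) T, EssBdd (regBound b ℓ t) (transl E t N₀ + (transl E).mild (kx V) t) := by
    intro V hV t
    have hk : ∀ s ∈ Icc (0 : ℝ) t, EssBdd (b + ℓ * (regBound b ℓ s + b)) (kx V s) := by
      intro s hs
      have hs' : s ∈ Icc 0 T := ⟨hs.1, hs.2.trans t.2.2⟩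
      have hVs : EssBdd (regBound b ℓ s) (Vx V s) := by
        have := hV ⟨s, hs'⟩
        simpa only [Vx, projIcc_of_mem hT hs'] using this
      refine (bB' s).sub (EssBdd.sgnMul ?_)
      filter_upwards [hφ.coeFn_compLp φ0 (pairLp (yx V s) (dx V s)),
        coeFn_pairLp (yx V s) (dx V s), hVs.vel.add (bG' s)] with y h1 h2 h3
      rw [h1, Function.comp_apply, h2]
      exact (norm_dirDeriv_le hK hbψ _).trans (mul_le_mul_of_nonneg_left h3 hℓ)
    have h1 := EssBdd.intervalIntegral (F := fun s => transl E (t - s) (kx V s))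
      (m := fun s => b + ℓ * (regBound b ℓ s + b)) t.2.1
      ((transl E).continuous_comp (by fun_prop) (ckx V))
      (by have := continuous_regBound b ℓ; fun_prop)
      (fun s _ => by have := regBound_pos hb hℓ s; positivity) (fun s hs => (hk s hs).transl _)
    exact (((hN₀.transl t).add h1).mono (regBound_integral hb hℓ t.2.1))
  obtain ⟨V, hVP, hV⟩ := (transl E).exists_volterra (T := T) (ℓ := Lφ * (T + 1)) (by positivity)
    (fun t => transl E t N₀) ((transl E).continuous_apply N₀) kx ckx hlip
    (fun t => {f | EssBdd (regBound b ℓ t) f})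
    (fun t => isClosed_essBdd (regBound_pos hb hℓ t).le)
    ⟨0, fun t => essBdd_zero (regBound_pos hb hℓ t).le⟩ hinv
  have bV : ∀ t, EssBdd (regBound b ℓ T) (Vx V t) := fun t =>
    (hVP (projIcc 0 T hT t)).mono (regBound_mono hb hℓ (projIcc 0 T hT t).2.2)
  have bd : ∀ t, EssBdd K (dx V t) := fun t => (bV t).vel.add (bG' t)
  -- the argument of the nonlinearity is Lipschitz in the supremum norm, as the chain rule requires
  have hle : ∀ s t, s ≤ t → EssBdd (K * |t - s|) (yx V t - yx V s) := by
    intro s t hst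
    have e : ∫ r in s..t, dx V r = yx V t - yx V s :=
      intervalIntegral.integral_eq_sub_of_hasDerivAt (fun r _ => hyx V r)
        ((cdx V).intervalIntegrable _ _)
    have := EssBdd.intervalIntegral (m := fun _ => K) hst (cdx V) continuous_const
      (fun _ _ => hK.le) (fun r _ => bd r)
    rw [e, intervalIntegral.integral_const, smul_eq_mul, mul_comm] at this
    exact this.mono (mul_le_mul_of_nonneg_left (le_abs_self _) hK.le)
  have hsup : ∀ t s, EssBdd (K * |s - t|) (yx V s - yx V t) := by
    intro t s
    rcases le_total t s with h | h
    · exact hle t s h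
    · have h1 := hle s t h
      filter_upwards [h1, Lp.coeFn_sub (yx V t) (yx V s), Lp.coeFn_sub (yx V s) (yx V t)] with
        y a1 a2 a3
      rw [a3, Pi.sub_apply, norm_sub_rev, abs_sub_comm]
      rwa [a2] at a1
  let f : ℝ → LC E := fun t => Be t - sgnMul (hL.compLp h0 (yx V t))
  have hf : ∀ t, HasDerivAt f (kx V t) t := fun t =>
    (hBe t).sub ((sgnMul (E := E)).hasFDerivAt.comp_hasDerivAt t
      (hasDerivAt_superposition hK hψ hbψ hl hL h0 (hyx V t) (bd t) (hsup t)))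
  have hf0 : f 0 = N₀ := by
    simp only [f, yx, Wx, intervalIntegral.integral_same, add_zero, eB 0 h0T, eG 0 h0T, hN₀def]
  have hWd : ∀ t, HasDerivAt (fun t => W₀ + (transl E).mild f t)
      (transl E t (f 0) + (transl E).mild (kx V) t) t := fun t =>
    ((transl E).hasDerivAt_mild hf (ckx V) t).const_add W₀
  have hVeq : ∀ t ∈ Icc 0 T, transl E t (f 0) + (transl E).mild (kx V) t = Vx V t := by
    intro t ht
    have := hV ⟨t, ht⟩
    simp only [Vx, projIcc_of_mem hT ht]
    rw [this, hf0]
  -- the mild solution and `W₀ + ∫ V` have the same derivative on `[0,T]`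
  have hWeq : ∀ t ∈ Icc 0 T, W₀ + (transl E).mild f t = Wx V t := by
    refine eqOn_Icc_of_hasDerivWithinAt (fun t _ => (hWd t).hasDerivWithinAt) (fun t ht => ?_) ?_
    · rw [hVeq t ht]
      exact (hWx V t).hasDerivWithinAt
    · simp [Wx, IsometryGroup.mild]
  refine ⟨_, _, f, kx V, ckx V, hWd, hf, fun t => rfl, fun t => rfl, fun t ht => ?_,
    fun t ht => ?_, fun t ht => ⟨hφ.compLp φ0 (pairLp (yx V t) (dx V t)), ?_, ?_⟩⟩
  · simp only [hWeq t ht]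
    simp only [f, yx, eB t ht, eG t ht]
  · rw [hVeq t ht]
    exact bV t
  · simp only [kx, clampExt_of_mem hT B' ht]
  · simp only [hWeq t ht, hVeq t ht]
    filter_upwards [hφ.coeFn_compLp φ0 (pairLp (yx V t) (dx V t)),
      coeFn_pairLp (yx V t) (dx V t), bd t] with y h1 h2 h3
    rw [h1, Function.comp_apply, h2, dirDeriv, trunc_of_norm_le hK h3]
    simp only [yx, dx, eG t ht, clampExt_of_mem hT G' ht]

/-! ### Second-order regularity -/

/-- A smooth bounded function that is the identity on `[-K,K]`. -/
theorem exists_cutoff {K : ℝ} (hK : 0 < K) : ∃ (τ τ' : ℝ → ℝ) (c : ℝ≥0),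
    (∀ r, HasDerivAt τ (τ' r) r) ∧ (∀ r, |r| ≤ K → τ r = r) ∧ (∀ r, |τ r| ≤ c) ∧
      (∀ r, |τ' r| ≤ c) ∧ LipschitzWith c τ' := by
  let β : ContDiffBump (0 : ℝ) := ⟨K, K + 1, hK, by linarith⟩
  let τ : ℝ → ℝ := fun r => r * β r
  have hτ : ContDiff ℝ 2 τ := contDiff_id.mul β.contDiff
  have hc : HasCompactSupport τ := β.hasCompactSupport.mul_left
  have hτ' : ContDiff ℝ 1 (deriv τ) := ((contDiff_succ_iff_deriv (n := 1)).mp hτ).2.2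
  obtain ⟨c₁, h1⟩ := hτ.continuous.bounded_above_of_compact_support hc
  obtain ⟨c₂, h2⟩ := hτ'.continuous.bounded_above_of_compact_support hc.deriv
  obtain ⟨c₃, h3⟩ := hτ'.lipschitzWith_of_hasCompactSupport hc.deriv (by norm_num)
  refine ⟨τ, deriv τ, max c₁.toNNReal (max c₂.toNNReal c₃), fun r =>
    (hτ.differentiable (by norm_num) r).hasDerivAt, fun r hr => ?_, fun r => ?_, fun r => ?_, ?_⟩
  · have : β r = 1 := β.one_of_mem_closedBall (by simpa [β] using hr)
    simp only [τ, this, mul_one]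
  · refine (h1 r).trans ((Real.le_coe_toNNReal c₁).trans ?_)
    exact_mod_cast le_max_left _ _
  · refine (h2 r).trans ((Real.le_coe_toNNReal c₂).trans ?_)
    exact_mod_cast (le_max_left _ _).trans (le_max_right _ _)
  · exact h3.weaken ((le_max_right _ _).trans (le_max_right _ _))

theorem LipschitzWith.mul_of_bdd {α : Type*} [PseudoMetricSpace α] {f g : α → ℝ}
    {Lf Lg A B : ℝ≥0} (hf : LipschitzWith Lf f) (hg : LipschitzWith Lg g) (bf : ∀ x, |f x| ≤ A)
    (bg : ∀ x, |g x| ≤ B) : LipschitzWith (A * Lg + B * Lf) fun x => f x * g x := by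
  refine LipschitzWith.of_dist_le_mul fun x y => ?_
  have e : f x * g x - f y * g y = f x * (g x - g y) + g y * (f x - f y) := by ring
  rw [Real.dist_eq, e]
  refine (abs_add_le _ _).trans ?_
  rw [abs_mul, abs_mul]
  have h1 := hf.dist_le_mul x y
  have h2 := hg.dist_le_mul x y
  rw [Real.dist_eq] at h1 h2
  have h3 := mul_le_mul (bf x) h2 (abs_nonneg _) A.2
  have h4 := mul_le_mul (bg y) h1 (abs_nonneg _) B.2
  refine (add_le_add h3 h4).trans (le_of_eq ?_)
  push_cast
  ring

theorem lipschitzWith_smul_const {α V : Type*} [PseudoMetricSpace α] [NormedAddCommGroup V]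
    [NormedSpace ℝ V] {f : α → ℝ} {L : ℝ≥0} (hf : LipschitzWith L f) {v : V} (hv : ‖v‖ ≤ 1) :
    LipschitzWith L fun x => f x • v := by
  refine LipschitzWith.of_dist_le_mul fun x y => ?_
  rw [dist_eq_norm, ← sub_smul, norm_smul, ← dist_eq_norm]
  exact (mul_le_of_le_one_right dist_nonneg hv).trans (hf.dist_le_mul x y)

theorem lipschitzWith_of_hasFDerivAt {E F : Type*} [NormedAddCommGroup E] [NormedSpace ℝ E]
    [NormedAddCommGroup F] [NormedSpace ℝ F] {ψ : E → F} {ψ' : E → E →L[ℝ] F} {ℓ : ℝ≥0}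
    (hψ : ∀ q, HasFDerivAt ψ (ψ' q) q) (hb : ∀ q, ‖ψ' q‖ ≤ ℓ) : LipschitzWith ℓ ψ := by
  rw [← lipschitzOnWith_univ]
  exact convex_univ.lipschitzOnWith_of_nnnorm_hasFDerivWithin_le
    (fun x _ => (hψ x).hasFDerivWithinAt) fun x _ => hb x

/-- The nonlinearity of the system formed by the equation and its time derivative; the cutoff `τ`
makes it globally Lipschitz. -/
def doubled (a a' τ : ℝ → ℝ) (z : ℝ × ℝ) : ℝ × ℝ := (a z.1, a' z.1 * τ z.2)

/-- The derivative of `doubled`. -/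
def doubled' (a' a'' τ τ' : ℝ → ℝ) (z : ℝ × ℝ) : ℝ × ℝ →L[ℝ] ℝ × ℝ :=
  a' z.1 • (ContinuousLinearMap.fst ℝ ℝ ℝ).prod 0 +
    (a'' z.1 * τ z.2) • (0 : ℝ × ℝ →L[ℝ] ℝ).prod (ContinuousLinearMap.fst ℝ ℝ ℝ) +
    (a' z.1 * τ' z.2) • (0 : ℝ × ℝ →L[ℝ] ℝ).prod (ContinuousLinearMap.snd ℝ ℝ ℝ)

theorem norm_prod_zero_le {A : ℝ × ℝ →L[ℝ] ℝ} (hA : ∀ z, |A z| ≤ ‖z‖) :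
    ‖A.prod (0 : ℝ × ℝ →L[ℝ] ℝ)‖ ≤ 1 ∧ ‖(0 : ℝ × ℝ →L[ℝ] ℝ).prod A‖ ≤ 1 := by
  constructor <;>
  · refine ContinuousLinearMap.opNorm_le_bound _ zero_le_one fun z => ?_
    simpa [Prod.norm_def] using hA z

theorem norm_coord_le :
    ‖(ContinuousLinearMap.fst ℝ ℝ ℝ).prod (0 : ℝ × ℝ →L[ℝ] ℝ)‖ ≤ 1 ∧
      ‖(0 : ℝ × ℝ →L[ℝ] ℝ).prod (ContinuousLinearMap.fst ℝ ℝ ℝ)‖ ≤ 1 ∧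
      ‖(0 : ℝ × ℝ →L[ℝ] ℝ).prod (ContinuousLinearMap.snd ℝ ℝ ℝ)‖ ≤ 1 :=
  ⟨(norm_prod_zero_le fun z => norm_fst_le z).1, (norm_prod_zero_le fun z => norm_fst_le z).2,
    (norm_prod_zero_le fun z => norm_snd_le z).2⟩

theorem hasFDerivAt_doubled {a a' a'' τ τ' : ℝ → ℝ} (ha : ∀ x, HasDerivAt a (a' x) x)
    (ha' : ∀ x, HasDerivAt a' (a'' x) x) (hτ : ∀ x, HasDerivAt τ (τ' x) x) (z : ℝ × ℝ) :
    HasFDerivAt (doubled a a' τ) (doubled' a' a'' τ τ' z) z := by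
  have h1 := (ha z.1).hasFDerivAt.comp z (ContinuousLinearMap.fst ℝ ℝ ℝ).hasFDerivAt
  have h2 := (ha' z.1).hasFDerivAt.comp z (ContinuousLinearMap.fst ℝ ℝ ℝ).hasFDerivAt
  have h3 := (hτ z.2).hasFDerivAt.comp z (ContinuousLinearMap.snd ℝ ℝ ℝ).hasFDerivAt
  refine (h1.prodMk (h2.mul h3)).congr_fderiv ?_
  ext <;> simp [doubled', mul_comm]

/-- The bound for the derivative of `doubled`. -/
def doubledBound (a₁ a₂ c : ℝ≥0) : ℝ≥0 := a₁ + a₂ * c + a₁ * c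

theorem norm_doubled'_le {a' a'' τ τ' : ℝ → ℝ} {a₁ a₂ c : ℝ≥0} (b1 : ∀ x, |a' x| ≤ a₁)
    (b2 : ∀ x, |a'' x| ≤ a₂) (bτ : ∀ x, |τ x| ≤ c) (bτ' : ∀ x, |τ' x| ≤ c) (z : ℝ × ℝ) :
    ‖doubled' a' a'' τ τ' z‖ ≤ doubledBound a₁ a₂ c := by
  obtain ⟨n1, n2, n3⟩ := norm_coord_le
  have h : ∀ {r R : ℝ} {A : ℝ × ℝ →L[ℝ] ℝ × ℝ}, |r| ≤ R → ‖A‖ ≤ 1 → ‖r • A‖ ≤ R := by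
    intro r R A hr hA
    rw [norm_smul, Real.norm_eq_abs]
    exact (mul_le_of_le_one_right (abs_nonneg _) hA).trans hr
  unfold doubled' doubledBound
  push_cast
  refine (norm_add₃_le).trans (add_le_add (add_le_add (h (b1 _) n1) (h ?_ n2)) (h ?_ n3))
  · rw [abs_mul]; exact mul_le_mul (b2 _) (bτ _) (abs_nonneg _) a₂.2
  · rw [abs_mul]; exact mul_le_mul (b1 _) (bτ' _) (abs_nonneg _) a₁.2

theorem exists_lipschitzWith_doubled' {a' a'' τ τ' : ℝ → ℝ} {a₁ a₂ a₃ c : ℝ≥0}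
    (b1 : ∀ x, |a' x| ≤ a₁) (b2 : ∀ x, |a'' x| ≤ a₂) (bτ : ∀ x, |τ x| ≤ c)
    (bτ' : ∀ x, |τ' x| ≤ c) (l1 : LipschitzWith a₂ a') (l2 : LipschitzWith a₃ a'')
    (lτ : LipschitzWith c τ) (lτ' : LipschitzWith c τ') :
    ∃ L, LipschitzWith L (doubled' a' a'' τ τ') := by
  obtain ⟨n1, n2, n3⟩ := norm_coord_le
  have f : LipschitzWith 1 (Prod.fst : ℝ × ℝ → ℝ) := LipschitzWith.prod_fst
  have s : LipschitzWith 1 (Prod.snd : ℝ × ℝ → ℝ) := LipschitzWith.prod_snd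
  exact ⟨_, ((lipschitzWith_smul_const (l1.comp f) n1).add
    (lipschitzWith_smul_const (LipschitzWith.mul_of_bdd (l2.comp f) (lτ.comp s) (fun z => b2 z.1)
      fun z => bτ z.2) n2)).add
    (lipschitzWith_smul_const (LipschitzWith.mul_of_bdd (l1.comp f) (lτ'.comp s) (fun z => b1 z.1)
      fun z => bτ' z.2) n3)⟩

/-- Existence of a twice continuously differentiable mild solution. The pair formed by the solution
and its time derivative is a mild solution of the doubled system, hence coincides with the regular
one. The cutoff is inactive on the solution because `K` bounds the derivative in the supremum norm;
the conditions on the data at time `0` make the derivative start from `0`. -/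
theorem exists_C2_mild {T b K : ℝ} {a₁ a₂ a₃ c : ℝ≥0} (hT : 0 ≤ T) (hb : 0 < b)
    {a a' a'' τ τ' : ℝ → ℝ} (ha0 : a 0 = 0) (ha : ∀ x, HasDerivAt a (a' x) x)
    (ha' : ∀ x, HasDerivAt a' (a'' x) x) (b1 : ∀ x, |a' x| ≤ a₁) (b2 : ∀ x, |a'' x| ≤ a₂)
    (l2 : LipschitzWith a₃ a'') (hL : LipschitzWith a₁ a)
    (hK : K = regBound b a₁ T + b)
    (hτ : ∀ r, HasDerivAt τ (τ' r) r) (hτK : ∀ r, |r| ≤ K → τ r = r) (bτ : ∀ r, |τ r| ≤ c)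
    (bτ' : ∀ r, |τ' r| ≤ c) (lτ' : LipschitzWith c τ')
    {B B' B'' G G' G'' : ℝ → LC ℝ}
    (hB : ∀ t ∈ Icc 0 T, HasDerivWithinAt B (B' t) (Icc 0 T) t)
    (hB' : ∀ t ∈ Icc 0 T, HasDerivWithinAt B' (B'' t) (Icc 0 T) t)
    (hB'' : ContinuousOn B'' (Icc 0 T))
    (bB' : ∀ t ∈ Icc 0 T, EssBdd b (B' t)) (bB'' : ∀ t ∈ Icc 0 T, EssBdd b (B'' t))
    (hG : ∀ t ∈ Icc 0 T, HasDerivWithinAt G (G' t) (Icc 0 T) t)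
    (hG' : ∀ t ∈ Icc 0 T, HasDerivWithinAt G' (G'' t) (Icc 0 T) t)
    (hG'' : ContinuousOn G'' (Icc 0 T))
    (bG' : ∀ t ∈ Icc 0 T, EssBdd b (G' t)) (bG'' : ∀ t ∈ Icc 0 T, EssBdd b (G'' t))
    {W₀ : LC ℝ} (hW₀ : vel W₀ = 0) (hB0 : B 0 = 0) (hG0 : G 0 = 0) (hG'0 : G' 0 = 0) :
    ∃ W V Z f k : ℝ → LC ℝ, Continuous k ∧ (∀ t, HasDerivAt W (V t) t) ∧
      (∀ t, HasDerivAt f (k t) t) ∧ (∀ t, W t = W₀ + (transl ℝ).mild f t) ∧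
      (∀ t ∈ Icc 0 T, f t = B t - sgnMul (hL.compLp ha0 (vel (W t) + G t))) ∧
      (∀ t ∈ Icc 0 T, EssBdd (regBound b a₁ T) (V t)) ∧
      (∀ t ∈ Icc 0 T, EssBdd (b + a₁ * K) (k t)) ∧
      (∀ t ∈ Icc 0 T, HasDerivWithinAt V (Z t) (Icc 0 T) t) ∧ ContinuousOn Z (Icc 0 T) ∧
      (∀ t ∈ Icc 0 T, EssBdd (regBound b (doubledBound a₁ a₂ c) T) (Z t)) := by
  have cB' : ContinuousOn B' (Icc 0 T) := fun t ht => (hB' t ht).continuousWithinAt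
  have cG' : ContinuousOn G' (Icc 0 T) := fun t ht => (hG' t ht).continuousWithinAt
  have h0T : (0 : ℝ) ∈ Icc 0 T := ⟨le_rfl, hT⟩
  have l1 : LipschitzWith a₂ a' := lipschitzWith_of_hasFDerivAt
    (fun q => (ha' q).hasFDerivAt) (fun q => by simpa using b2 q)
  have lτ : LipschitzWith c τ := lipschitzWith_of_hasFDerivAt
    (fun q => (hτ q).hasFDerivAt) (fun q => by simpa using bτ' q)
  obtain ⟨W, V, f, k, ck, hW, hf, eW, eV, ef, bV, hκ⟩ := exists_regular_mild (E := ℝ) hT hb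
    (ψ' := fun q => a' q • ContinuousLinearMap.id ℝ ℝ) (ℓ₂ := a₂) (W₀ := W₀)
    (fun q => (ha q).hasFDerivAt.congr_fderiv (by ext; simp))
    (fun q => by simpa [norm_smul] using b1 q)
    (lipschitzWith_smul_const (v := ContinuousLinearMap.id ℝ ℝ) l1
      ContinuousLinearMap.norm_id_le) hL ha0 hB cB' bB' hG cG' bG'
    (by rw [hB0, hG0, hW₀, add_zero, LipschitzWith.compLp_zero, map_zero, sub_zero]
        exact essBdd_zero hb.le)
  have hf0 : f 0 = 0 := by
    have hW0 : W 0 = W₀ := by rw [eW]; simp [IsometryGroup.mild]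
    rw [ef 0 h0T, hW0, hB0, hG0, hW₀, add_zero, LipschitzWith.compLp_zero, map_zero, sub_zero]
  obtain ⟨L, hL2'⟩ := exists_lipschitzWith_doubled' b1 b2 bτ bτ' l1 l2 lτ lτ'
  have hbψ := norm_doubled'_le b1 b2 bτ bτ'
  have hψ := hasFDerivAt_doubled ha ha' hτ
  have hL2 : LipschitzWith (doubledBound a₁ a₂ c) (doubled a a' τ) :=
    lipschitzWith_of_hasFDerivAt hψ hbψ
  have hKpos : 0 < K := hK ▸ add_pos (regBound_pos hb a₁.2 T) hb
  have hd0 : doubled a a' τ 0 = 0 := by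
    simp [doubled, ha0, hτK 0 (by simpa using hKpos.le)]
  have by' : ∀ t ∈ Icc 0 T, EssBdd K (vel (V t) + G' t) := fun t ht =>
    hK ▸ (bV t ht).vel.add (bG' t ht)
  have hp0 : pairLp (0 : LC ℝ) (0 : LC ℝ) = 0 := by
    simp only [pairLp, map_zero, add_zero]
  obtain ⟨W2, V2, f2, k2, ck2, hW2, hf2, eW2, eV2, ef2, bV2, -⟩ :=
    exists_regular_mild (E := ℝ × ℝ) (ℓ₂ := L) (W₀ := pairLp W₀ (0 : LC ℝ)) hT hb hψ hbψ hL2' hL2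
      hd0 (B := fun t => pairLp (B t) (B' t)) (B' := fun t => pairLp (B' t) (B'' t))
      (G := fun t => pairLp (G t) (G' t)) (G' := fun t => pairLp (G' t) (G'' t))
      (fun t ht => HasDerivWithinAt.pairLp (hB t ht) (hB' t ht))
      (((ContinuousLinearMap.inl ℝ ℝ ℝ).compLpL 2 _).continuous.comp_continuousOn cB' |>.add
        (((ContinuousLinearMap.inr ℝ ℝ ℝ).compLpL 2 _).continuous.comp_continuousOn hB''))
      (fun t ht => by simpa using (bB' t ht).pairLp (bB'' t ht))
      (fun t ht => HasDerivWithinAt.pairLp (hG t ht) (hG' t ht))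
      (((ContinuousLinearMap.inl ℝ ℝ ℝ).compLpL 2 _).continuous.comp_continuousOn cG' |>.add
        (((ContinuousLinearMap.inr ℝ ℝ ℝ).compLpL 2 _).continuous.comp_continuousOn hG''))
      (fun t ht => by simpa using (bG' t ht).pairLp (bG'' t ht))
      (by
        rw [vel_pairLp, hW₀, map_zero, hG0, hG'0, hp0, add_zero, LipschitzWith.compLp_zero,
          map_zero, sub_zero, hB0]
        simpa [hb.le] using (essBdd_zero hb.le).pairLp (bB' 0 h0T))
  have cW : Continuous W := continuous_iff_continuousAt.mpr fun t => (hW t).continuousAt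
  have cf : Continuous f := continuous_iff_continuousAt.mpr fun t => (hf t).continuousAt
  have cW2 : Continuous W2 := continuous_iff_continuousAt.mpr fun t => (hW2 t).continuousAt
  have cf2 : Continuous f2 := continuous_iff_continuousAt.mpr fun t => (hf2 t).continuousAt
  have eV' : ∀ t, V t = (transl ℝ).mild k t := fun t => by rw [eV, hf0, map_zero, zero_add]
  have cV : Continuous V := by
    rw [show V = (transl ℝ).mild k from funext eV']
    exact (transl ℝ).continuous_mild ck
  -- the pair `(W, V)` is a mild solution of the doubled system
  have hforce : ∀ t ∈ Icc 0 T, pairLp (f t) (k t) = pairLp (B t) (B' t) -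
      sgnMul (hL2.compLp hd0 (vel (pairLp (W t) (V t)) + pairLp (G t) (G' t))) := by
    intro t ht
    obtain ⟨κ, hk, hκ'⟩ := hκ t ht
    have e1 : hL2.compLp hd0 (vel (pairLp (W t) (V t)) + pairLp (G t) (G' t)) =
        pairLp (hL.compLp ha0 (vel (W t) + G t)) κ := by
      have e2 : vel (pairLp (W t) (V t)) + pairLp (G t) (G' t) =
          pairLp (vel (W t) + G t) (vel (V t) + G' t) := by
        rw [vel_pairLp]; simp only [pairLp, map_add]; abel
      rw [e2]
      refine Lp.ext ?_
      filter_upwards [hL2.coeFn_compLp hd0 (pairLp (vel (W t) + G t) (vel (V t) + G' t)),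
        coeFn_pairLp (vel (W t) + G t) (vel (V t) + G' t),
        coeFn_pairLp (hL.compLp ha0 (vel (W t) + G t)) κ,
        hL.coeFn_compLp ha0 (vel (W t) + G t), hκ', by' t ht] with y h1 h2 h3 h4 h5 h6
      rw [h1, Function.comp_apply, h2, h3, h4, h5, doubled, hτK _ h6]
      simp
    rw [e1, sgnMul_pairLp, ef t ht, hk]
    simp only [pairLp, map_sub]
    abel
  have hpair : ∀ t ∈ Icc 0 T, pairLp (W t) (V t) = W2 t := by
    refine (transl (ℝ × ℝ)).eq_of_mild (x₀ := pairLp W₀ (0 : LC ℝ)) (ℓ := doubledBound a₁ a₂ c)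
      (continuous_pairLp cW cV) cW2 (continuous_pairLp cf ck) cf2 (fun t ht => ?_)
      (fun t ht => eW2 t) (fun t ht => ?_)
    · rw [mild_pairLp cf ck, eW, eV']
      simp only [pairLp, map_add, map_zero]
      abel
    · rw [hforce t ht, ef2 t ht]
      have e : ∀ x y z : LC (ℝ × ℝ), (x - sgnMul y) - (x - sgnMul z) = sgnMul (z - y) := by
        intro x y z; rw [map_sub]; abel
      rw [e]
      refine (norm_sgnMul_le _).trans ((hL2.norm_compLp_sub_le hd0 _ _).trans ?_)
      rw [add_sub_add_right_eq_sub, ← map_sub, norm_sub_rev (pairLp _ _)]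
      exact mul_le_mul_of_nonneg_left (norm_vel_le _) (NNReal.coe_nonneg _)
  let pr : LC (ℝ × ℝ) →L[ℝ] LC ℝ := (ContinuousLinearMap.snd ℝ ℝ ℝ).compLpL 2 volume
  have hpr : ∀ g h : LC ℝ, pr (pairLp g h) = h := by
    intro g h
    refine Lp.ext ?_
    filter_upwards [(ContinuousLinearMap.snd ℝ ℝ ℝ).coeFn_compLpL (pairLp g h), coeFn_pairLp g h]
      with y h1 h2
    rw [h1, h2]
    rfl
  have hVpr : ∀ t ∈ Icc 0 T, V t = pr (W2 t) := fun t ht => by rw [← hpair t ht, hpr]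
  have cV2 : Continuous V2 := by
    rw [show V2 = _ from funext eV2]
    exact ((transl _).continuous_apply _).add ((transl _).continuous_mild ck2)
  refine ⟨W, V, fun t => pr (V2 t), f, k, ck, hW, hf, eW, ef, bV, fun t ht => ?_, fun t ht => ?_,
    (pr.continuous.comp cV2).continuousOn, fun t ht => ?_⟩
  · obtain ⟨κ, hk, hκ'⟩ := hκ t ht
    rw [hk]
    refine (bB' t ht).sub (EssBdd.sgnMul ?_)
    filter_upwards [hκ', by' t ht] with y h1 h2
    rw [h1]
    simp only [smul_apply, ContinuousLinearMap.id_apply, norm_smul]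
    exact mul_le_mul (b1 _) h2 (norm_nonneg _) a₁.2
  · have h1 := (pr.hasFDerivAt.comp_hasDerivAt t (hW2 t)).hasDerivWithinAt (s := Icc 0 T)
    exact h1.congr (fun s hs => hVpr s hs) (hVpr t ht)
  · filter_upwards [bV2 t ht, (ContinuousLinearMap.snd ℝ ℝ ℝ).coeFn_compLpL (V2 t)] with y h1 h2
    rw [h2]
    exact (norm_snd_le _).trans h1

/-! ### The generator of translations and restriction to the interval -/

theorem measurePreserving_circle_mk :
    MeasurePreserving (fun x : ℝ => (x : AddCircle (2 : ℝ)))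
      (volume.restrict (Ioc (-1 : ℝ) 1)) volume := by
  have := AddCircle.measurePreserving_mk 2 (-1)
  rwa [show (-1 : ℝ) + 2 = 1 by norm_num] at this

theorem locallyIntegrable_lift (g : LC ℝ) :
    LocallyIntegrable (fun x : ℝ => g (x : AddCircle (2 : ℝ))) := by
  have hper : Function.Periodic (fun x : ℝ => g (x : AddCircle (2 : ℝ))) 2 := fun x => by
    simp only [AddCircle.coe_add_period]
  have h1 : IntegrableOn (fun x : ℝ => g (x : AddCircle (2 : ℝ))) (Ioc (-1 : ℝ) 1) :=
    measurePreserving_circle_mk.integrable_comp_of_integrable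
      ((Lp.memLp g).integrable (by norm_num))
  have h2 : ∀ a b, IntervalIntegrable (fun x : ℝ => g (x : AddCircle (2 : ℝ))) volume a b :=
    hper.intervalIntegrable two_ne_zero (t := -1) (by
      rw [intervalIntegrable_iff_integrableOn_Ioc_of_le (by norm_num)]
      norm_num
      exact h1)
  rw [locallyIntegrable_iff]
  intro K hK
  obtain ⟨R, hR⟩ := hK.isBounded.subset_closedBall 0
  rcases K.eq_empty_or_nonempty with rfl | ⟨x, hx⟩
  · exact integrableOn_empty
  · have hR0 : 0 ≤ R := dist_nonneg.trans (hR hx)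
    rw [Real.closedBall_eq_Icc] at hR
    have := (intervalIntegrable_iff_integrableOn_Icc_of_le (by linarith)).mp (h2 (0 - R) (0 + R))
    exact this.mono_set hR

theorem setIntegral_arc (g : LC ℝ) {α β : ℝ} (hα : -1 ≤ α) (hαβ : α ≤ β) (hβ : β ≤ 1) :
    ∫ y in rep ⁻¹' Ioc α β, g y = ∫ x in α..β, g (x : AddCircle (2 : ℝ)) := by
  have hs : MeasurableSet (rep ⁻¹' Ioc α β) := measurable_rep measurableSet_Ioc
  have hg : AEStronglyMeasurable g
      (Measure.map (fun x : ℝ => (x : AddCircle (2 : ℝ))) (volume.restrict (Ioc (-1 : ℝ) 1))) := by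
    rw [measurePreserving_circle_mk.map_eq]
    exact Lp.aestronglyMeasurable g
  have key := setIntegral_map hs hg measurePreserving_circle_mk.aemeasurable
  generalize (g : AddCircle (2 : ℝ) → ℝ) = F at key ⊢
  rw [measurePreserving_circle_mk.map_eq] at key
  rw [key, Measure.restrict_restrict (measurePreserving_circle_mk.measurable hs),
    intervalIntegral.integral_of_le hαβ]
  congr 2
  ext x
  simp only [mem_inter_iff, mem_preimage]
  constructor
  · rintro ⟨h1, h2⟩
    rwa [rep_coe h2] at h1
  · intro h
    have hx : x ∈ Ioc (-1 : ℝ) 1 := ⟨hα.trans_lt h.1, h.2.trans hβ⟩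
    exact ⟨by rwa [rep_coe hx], hx⟩

/-- Integration over an arc is a continuous functional on `L²`. -/
theorem hasDerivAt_integral_arc {F : ℝ → LC ℝ} {F' : LC ℝ} {t : ℝ} (hF : HasDerivAt F F' t)
    {α β : ℝ} (hα : -1 ≤ α) (hαβ : α ≤ β) (hβ : β ≤ 1) :
    HasDerivAt (fun h => ∫ x in α..β, F h (x : AddCircle (2 : ℝ)))
      (∫ x in α..β, F' (x : AddCircle (2 : ℝ))) t := by
  have hs : MeasurableSet (rep ⁻¹' Ioc α β) := measurable_rep measurableSet_Ioc
  have key : ∀ g : LC ℝ, ∫ x in α..β, g (x : AddCircle (2 : ℝ)) =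
      innerSL ℝ (indicatorConstLp 2 hs (measure_ne_top _ _) (1 : ℝ)) g := by
    intro g
    rw [innerSL_apply_apply, L2.inner_indicatorConstLp_one, setIntegral_arc g hα hαβ hβ]
  simp only [key]
  exact (innerSL ℝ _).hasFDerivAt.comp_hasDerivAt t hF

theorem integral_transl_lift (f : LC ℝ) (h α β : ℝ) :
    ∫ x in α..β, transl ℝ h f (x : AddCircle (2 : ℝ)) =
      ∫ x in (α - h)..(β - h), f (x : AddCircle (2 : ℝ)) := by
  rw [← intervalIntegral.integral_comp_sub_right (fun x => f (x : AddCircle (2 : ℝ)))]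
  refine intervalIntegral.integral_congr_ae ?_
  filter_upwards [ae_circle_iff (coeFn_transl h f)] with x hx _
  rw [hx, AddCircle.coe_sub]

theorem integral_circle_lift (f : LC ℝ) (t : ℝ) :
    ∫ x in (-1 - t)..(1 - t), f (x : AddCircle (2 : ℝ)) =
      ∫ x in (-1)..1, f (x : AddCircle (2 : ℝ)) := by
  have hper : Function.Periodic (fun x : ℝ => f (x : AddCircle (2 : ℝ))) 2 := fun x => by
    simp only [AddCircle.coe_add_period]
  have := hper.intervalIntegral_add_eq (-1 - t) (-1)
  rw [show -1 - t + 2 = 1 - t by ring, show (-1 : ℝ) + 2 = 1 by norm_num] at this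
  exact this

/-- An element of the domain of the generator of translations is a primitive of a function with
vanishing mean. -/
theorem ae_eq_primitive_of_generator {f D : LC ℝ}
    (h : HasDerivAt (fun h => transl ℝ h f) (-D) 0) :
    (∃ κ : ℝ, ∀ᵐ x : ℝ, x ∈ Ioo (-1 : ℝ) 1 → f (x : AddCircle (2 : ℝ)) =
      κ + ∫ s in (0 : ℝ)..x, D (s : AddCircle (2 : ℝ))) ∧
      ∫ s in (-1 : ℝ)..1, D (s : AddCircle (2 : ℝ)) = 0 := by
  have hneg : ∀ α β : ℝ, ∫ x in α..β, (-D : LC ℝ) (x : AddCircle (2 : ℝ)) =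
      -∫ x in α..β, D (x : AddCircle (2 : ℝ)) := by
    intro α β
    rw [← intervalIntegral.integral_neg]
    refine intervalIntegral.integral_congr_ae ?_
    filter_upwards [ae_circle_iff (Lp.coeFn_neg D)] with x hx _
    exact hx
  have hf := locallyIntegrable_lift f
  have hD := locallyIntegrable_lift D
  have iD := fun a b => intervalIntegrable_of_locallyIntegrable hD a b
  have iF := fun a b => intervalIntegrable_of_locallyIntegrable hf a b
  constructor
  · have hLD := LocallyIntegrable.ae_hasDerivAt_integral hf
    -- the two ways to differentiate `∫ f(x - h)` over `[α, β]` at `h = 0`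
    have step : ∀ α β : ℝ, -1 ≤ α → α ≤ β → β ≤ 1 →
        HasDerivAt (fun x => ∫ s in (0 : ℝ)..x, f (s : AddCircle (2 : ℝ)))
          (f (α : AddCircle (2 : ℝ))) α →
        HasDerivAt (fun x => ∫ s in (0 : ℝ)..x, f (s : AddCircle (2 : ℝ)))
          (f (β : AddCircle (2 : ℝ))) β →
        f (β : AddCircle (2 : ℝ)) = f (α : AddCircle (2 : ℝ)) +
          ∫ s in α..β, D (s : AddCircle (2 : ℝ)) := by
      intro α β hα hαβ hβ dα dβ
      have d1 := hasDerivAt_integral_arc h hα hαβ hβ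
      have dsub : ∀ γ : ℝ, HasDerivAt (fun h : ℝ => γ - h) (-1) 0 := fun γ => by
        simpa using (hasDerivAt_id (0 : ℝ)).const_sub γ
      have d2 := (HasDerivAt.comp (h := fun h : ℝ => β - h) 0 (by simpa using dβ) (dsub β)).sub
        (HasDerivAt.comp (h := fun h : ℝ => α - h) 0 (by simpa using dα) (dsub α))
      have e : (fun h => ∫ x in α..β, transl ℝ h f (x : AddCircle (2 : ℝ))) =
          fun h => (∫ s in (0 : ℝ)..(β - h), f (s : AddCircle (2 : ℝ))) -
            ∫ s in (0 : ℝ)..(α - h), f (s : AddCircle (2 : ℝ)) := by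
        funext h
        rw [integral_transl_lift, intervalIntegral.integral_interval_sub_left (iF _ _) (iF _ _)]
      rw [e] at d1
      have := d1.unique d2
      rw [hneg] at this
      linarith
    -- a Lebesgue point to start from
    have hex : ∃ α ∈ Ioo (-1 : ℝ) 1, ∀ c, HasDerivAt
        (fun x => ∫ s in c..x, f (s : AddCircle (2 : ℝ))) (f (α : AddCircle (2 : ℝ))) α := by
      have hd := Measure.dense_of_ae hLD
      obtain ⟨α, h1, h2⟩ := hd.inter_open_nonempty (Ioo (-1 : ℝ) 1) isOpen_Ioo
        (nonempty_Ioo.mpr (by norm_num))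
      exact ⟨α, h1, h2⟩
    obtain ⟨α, hα, dα⟩ := hex
    refine ⟨f (α : AddCircle (2 : ℝ)) + ∫ s in α..0, D (s : AddCircle (2 : ℝ)), ?_⟩
    filter_upwards [hLD] with β dβ hβ
    rw [add_assoc, intervalIntegral.integral_add_adjacent_intervals (iD _ _) (iD _ _)]
    rcases le_total α β with hle | hle
    · exact step α β hα.1.le hle hβ.2.le (dα 0) (dβ 0)
    · have := step β α hβ.1.le hle hα.2.le (dβ 0) (dα 0)
      rw [intervalIntegral.integral_symm]
      linarith
  · have d1 := hasDerivAt_integral_arc h (α := -1) (β := 1) le_rfl (by norm_num) le_rfl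
    simp only [integral_transl_lift, integral_circle_lift] at d1
    have := d1.unique (hasDerivAt_const _ _)
    rw [hneg] at this
    linarith

theorem memLp_lift (g : LC ℝ) :
    MemLp (fun x : ℝ => g (x : AddCircle (2 : ℝ))) 2 (volume.restrict (Ioc (-1 : ℝ) 1)) :=
  (Lp.memLp g).comp_measurePreserving measurePreserving_circle_mk

theorem restrict_half_le :
    (volume : Measure ℝ).restrict (Ioo (0 : ℝ) 1) ≤ volume.restrict (Ioc (-1 : ℝ) 1) :=
  Measure.restrict_mono (fun x (hx : x ∈ Ioo (0 : ℝ) 1) =>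
    show x ∈ Ioc (-1 : ℝ) 1 from ⟨by linarith [hx.1], hx.2.le⟩) le_rfl

theorem memLp_half (g : LC ℝ) :
    MemLp (fun x : ℝ => g (x : AddCircle (2 : ℝ))) 2 (volume.restrict (Ioo (0 : ℝ) 1)) :=
  (memLp_lift g).mono_measure restrict_half_le

theorem ae_half {P : AddCircle (2 : ℝ) → Prop} (h : ∀ᵐ y, P y) :
    ∀ᵐ x : ℝ ∂(volume.restrict (Ioo (0 : ℝ) 1)), P (x : AddCircle (2 : ℝ)) :=
  ae_restrict_of_ae (ae_circle_iff h)

theorem ae_half_neg {P : AddCircle (2 : ℝ) → Prop} (h : ∀ᵐ y, P y) :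
    ∀ᵐ x : ℝ ∂(volume.restrict (Ioo (0 : ℝ) 1)), P (-(x : AddCircle (2 : ℝ))) :=
  ae_half ((Measure.measurePreserving_neg volume).quasiMeasurePreserving.ae h)

/-- Restriction of functions on the circle to `(0,1)`. -/
def half : LC ℝ →L[ℝ] L2 :=
  LinearMap.mkContinuous
    { toFun := fun g => (memLp_half g).toLp
      map_add' := fun f g => by
        refine Lp.ext ?_
        filter_upwards [(memLp_half (f + g)).coeFn_toLp, (memLp_half f).coeFn_toLp,
          (memLp_half g).coeFn_toLp, ae_half (Lp.coeFn_add f g),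
          Lp.coeFn_add (memLp_half f).toLp (memLp_half g).toLp] with x h1 h2 h3 h4 h5
        rw [h1, h5, Pi.add_apply, h2, h3, h4, Pi.add_apply]
      map_smul' := fun r f => by
        refine Lp.ext ?_
        filter_upwards [(memLp_half (r • f)).coeFn_toLp, (memLp_half f).coeFn_toLp,
          ae_half (Lp.coeFn_smul r f), Lp.coeFn_smul r (memLp_half f).toLp] with x h1 h2 h3 h4
        rw [RingHom.id_apply, h1, h4, Pi.smul_apply, h2, h3, Pi.smul_apply] }
    1 fun f => by
      rw [one_mul]
      refine (Lp.norm_toLp _ (memLp_half f)).le.trans ?_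
      rw [Lp.norm_def]
      refine ENNReal.toReal_mono (Lp.memLp f).eLpNorm_ne_top ?_
      refine (eLpNorm_mono_measure _ restrict_half_le).trans (le_of_eq ?_)
      exact eLpNorm_comp_measurePreserving (Lp.aestronglyMeasurable f) measurePreserving_circle_mk

theorem coeFn_half (g : LC ℝ) :
    ∀ᵐ x : ℝ ∂(volume.restrict (Ioo (0 : ℝ) 1)), half g x = g (x : AddCircle (2 : ℝ)) :=
  (memLp_half g).coeFn_toLp

theorem norm_half_le (g : LC ℝ) : ‖half g‖ ≤ ‖g‖ := by
  have := (LinearMap.mkContinuous_norm_le _ zero_le_one _ : ‖half‖ ≤ 1)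
  exact (half.le_opNorm g).trans (mul_le_of_le_one_left (norm_nonneg _) this)

/-- The even part of a function on the circle. -/
def evenPart : LC ℝ →L[ℝ] LC ℝ :=
  (1 / 2 : ℝ) • (ContinuousLinearMap.id ℝ _ + reflect.toContinuousLinearMap)

/-- The odd part of a function on the circle. -/
def oddPart : LC ℝ →L[ℝ] LC ℝ :=
  (1 / 2 : ℝ) • (ContinuousLinearMap.id ℝ _ - reflect.toContinuousLinearMap)

theorem coeFn_evenPart (g : LC ℝ) : ∀ᵐ y, evenPart g y = (g y + g (-y)) / 2 := by
  filter_upwards [Lp.coeFn_smul (1 / 2 : ℝ) (g + reflect g), Lp.coeFn_add g (reflect g),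
    coeFn_reflect g] with y h1 h2 h3
  refine h1.trans ?_
  rw [Pi.smul_apply, h2, Pi.add_apply, h3, smul_eq_mul]
  ring

theorem coeFn_oddPart (g : LC ℝ) : ∀ᵐ y, oddPart g y = (g y - g (-y)) / 2 := by
  filter_upwards [Lp.coeFn_smul (1 / 2 : ℝ) (g - reflect g), Lp.coeFn_sub g (reflect g),
    coeFn_reflect g] with y h1 h2 h3
  refine h1.trans ?_
  rw [Pi.smul_apply, h2, Pi.sub_apply, h3, smul_eq_mul]
  ring

theorem norm_evenPart_le (g : LC ℝ) : ‖evenPart g‖ ≤ ‖g‖ := by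
  have h : evenPart g = (1 / 2 : ℝ) • (g + reflect g) := rfl
  have h2 := norm_add_le g (reflect g)
  rw [LinearIsometry.norm_map] at h2
  rw [h, norm_smul, Real.norm_of_nonneg (by norm_num)]
  linarith

theorem norm_oddPart_le (g : LC ℝ) : ‖oddPart g‖ ≤ ‖g‖ := by
  have h : oddPart g = (1 / 2 : ℝ) • (g - reflect g) := rfl
  have h2 := norm_sub_le g (reflect g)
  rw [LinearIsometry.norm_map] at h2
  rw [h, norm_smul, Real.norm_of_nonneg (by norm_num)]
  linarith

theorem sgn_coe {x : ℝ} (hx : x ∈ Ioo (0 : ℝ) 1) : sgn (x : AddCircle (2 : ℝ)) = 1 := by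
  rw [sgn, rep_coe ⟨by linarith [hx.1], hx.2.le⟩, if_pos hx.1]

theorem sgn_coe_neg {x : ℝ} (hx : x ∈ Ioo (0 : ℝ) 1) : sgn (-(x : AddCircle (2 : ℝ))) = -1 := by
  rw [sgn, ← AddCircle.coe_neg, rep_coe ⟨by linarith [hx.2], by linarith [hx.1]⟩,
    if_neg (by linarith [hx.1])]

/-- Multiplication by the sign exchanges even and odd parts, without changing them on `(0,1)`. -/
theorem half_evenPart_sgnMul (g : LC ℝ) : half (evenPart (sgnMul g)) = half (oddPart g) := by
  refine Lp.ext ?_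
  filter_upwards [coeFn_half (evenPart (sgnMul g)), coeFn_half (oddPart g),
    ae_half (coeFn_evenPart (sgnMul g)), ae_half (coeFn_oddPart g), ae_half (coeFn_sgnMul g),
    ae_half_neg (coeFn_sgnMul g), ae_restrict_mem measurableSet_Ioo] with x h1 h2 h3 h4 h5 h6 hx
  rw [h1, h2, h3, h4, h5, h6, sgn_coe hx, sgn_coe_neg hx]
  simp only [smul_eq_mul]
  ring

theorem half_oddPart_sgnMul (g : LC ℝ) : half (oddPart (sgnMul g)) = half (evenPart g) := by
  refine Lp.ext ?_
  filter_upwards [coeFn_half (oddPart (sgnMul g)), coeFn_half (evenPart g),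
    ae_half (coeFn_oddPart (sgnMul g)), ae_half (coeFn_evenPart g), ae_half (coeFn_sgnMul g),
    ae_half_neg (coeFn_sgnMul g), ae_restrict_mem measurableSet_Ioo] with x h1 h2 h3 h4 h5 h6 hx
  rw [h1, h2, h3, h4, h5, h6, sgn_coe hx, sgn_coe_neg hx]
  simp only [smul_eq_mul]
  ring

theorem half_vel (g : LC ℝ) : half (vel g) = half (oddPart g) := by
  refine Lp.ext ?_
  filter_upwards [coeFn_half (vel g), coeFn_half (oddPart g), ae_half (coeFn_vel g),
    ae_half (coeFn_oddPart g), ae_restrict_mem measurableSet_Ioo] with x h1 h2 h3 h4 hx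
  rw [h1, h2, h3, h4, sgn_coe hx]
  simp only [smul_eq_mul]
  ring

theorem intervalIntegral_ext_half {g : LC ℝ} {F : ℝ → ℝ}
    (h : ∀ᵐ x : ℝ ∂(volume.restrict (Ioo (0 : ℝ) 1)), g (x : AddCircle (2 : ℝ)) = F x)
    {x : ℝ} (hx : x ∈ Icc (0 : ℝ) 1) :
    ∫ s in (0 : ℝ)..x, (half g).ext s = ∫ s in (0 : ℝ)..x, F s := by
  refine intervalIntegral.integral_congr_ae ?_
  have h1 : ∀ᵐ s : ℝ, s ≠ 1 := by simp [ae_iff]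
  filter_upwards [(ae_restrict_iff' measurableSet_Ioo).mp h,
    (ae_restrict_iff' measurableSet_Ioo).mp (coeFn_half g),
    (ae_restrict_iff' measurableSet_Ioo).mp (L2.ext_ae (half g)), h1] with s a1 a2 a3 a4 hs
  rw [uIoc_of_le hx.1] at hs
  have hs' : s ∈ Ioo (0 : ℝ) 1 := ⟨hs.1, lt_of_le_of_ne (hs.2.trans hx.2) a4⟩
  rw [a3 hs', a2 hs', a1 hs']

/-- The regularity on `(0,1)` of the even and odd parts of an element of the domain of the generator
of translations. The odd part vanishes at both end points. -/
theorem half_of_generator {f D : LC ℝ} (h : HasDerivAt (fun h => transl ℝ h f) (-D) 0) :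
    (∃ κ : ℝ, (half (evenPart f) : ℝ → ℝ) =ᵐ[volume.restrict (Ioo (0 : ℝ) 1)]
      L2.prim κ (half (oddPart D))) ∧
    ((half (oddPart f) : ℝ → ℝ) =ᵐ[volume.restrict (Ioo (0 : ℝ) 1)]
      L2.prim 0 (half (evenPart D))) ∧ L2.prim 0 (half (evenPart D)) 1 = 0 := by
  obtain ⟨⟨κ, hκ⟩, h0⟩ := ae_eq_primitive_of_generator h
  have iD := fun a b => intervalIntegrable_of_locallyIntegrable (locallyIntegrable_lift D) a b
  have iN : ∀ a b,
      IntervalIntegrable (fun s : ℝ => D (((-s : ℝ)) : AddCircle (2 : ℝ))) volume a b :=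
    fun a b => by simpa using ((IntervalIntegrable.iff_comp_neg (by simp)).mp (iD (-a) (-b)))
  have hneg : ∀ x : ℝ, ∫ s in (0 : ℝ)..(-x), D (s : AddCircle (2 : ℝ)) =
      -∫ s in (0 : ℝ)..x, D (((-s : ℝ)) : AddCircle (2 : ℝ)) := by
    intro x
    rw [intervalIntegral.integral_comp_neg (fun s => D (s : AddCircle (2 : ℝ))), neg_zero,
      intervalIntegral.integral_symm]
  have eo : ∀ x ∈ Icc (0 : ℝ) 1, ∫ s in (0 : ℝ)..x, (half (oddPart D)).ext s =
      ((∫ s in (0 : ℝ)..x, D (s : AddCircle (2 : ℝ))) +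
        ∫ s in (0 : ℝ)..(-x), D (s : AddCircle (2 : ℝ))) / 2 := by
    intro x hx
    rw [intervalIntegral_ext_half (F := fun s => (D (s : AddCircle (2 : ℝ)) -
      D (((-s : ℝ)) : AddCircle (2 : ℝ))) / 2) (by simpa using ae_half (coeFn_oddPart D)) hx,
      hneg, intervalIntegral.integral_div, intervalIntegral.integral_sub (iD _ _) (iN _ _)]
    ring
  have ee : ∀ x ∈ Icc (0 : ℝ) 1, ∫ s in (0 : ℝ)..x, (half (evenPart D)).ext s =
      ((∫ s in (0 : ℝ)..x, D (s : AddCircle (2 : ℝ))) -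
        ∫ s in (0 : ℝ)..(-x), D (s : AddCircle (2 : ℝ))) / 2 := by
    intro x hx
    rw [intervalIntegral_ext_half (F := fun s => (D (s : AddCircle (2 : ℝ)) +
      D (((-s : ℝ)) : AddCircle (2 : ℝ))) / 2) (by simpa using ae_half (coeFn_evenPart D)) hx,
      hneg, intervalIntegral.integral_div, intervalIntegral.integral_add (iD _ _) (iN _ _)]
    ring
  have hκ' : ∀ᵐ x : ℝ ∂(volume.restrict (Ioo (0 : ℝ) 1)), f (x : AddCircle (2 : ℝ)) =
      κ + ∫ s in (0 : ℝ)..x, D (s : AddCircle (2 : ℝ)) := by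
    filter_upwards [ae_restrict_of_ae hκ, ae_restrict_mem measurableSet_Ioo] with x h1 hx
    exact h1 ⟨by linarith [hx.1], hx.2⟩
  have hκn : ∀ᵐ x : ℝ ∂(volume.restrict (Ioo (0 : ℝ) 1)), f (-(x : AddCircle (2 : ℝ))) =
      κ + ∫ s in (0 : ℝ)..(-x), D (s : AddCircle (2 : ℝ)) := by
    have := (Measure.measurePreserving_neg (volume : Measure ℝ)).quasiMeasurePreserving.ae hκ
    filter_upwards [ae_restrict_of_ae this, ae_restrict_mem measurableSet_Ioo] with x h1 hx
    rw [← AddCircle.coe_neg]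
    exact h1 ⟨by linarith [hx.2], by linarith [hx.1]⟩
  refine ⟨⟨κ, ?_⟩, ?_, ?_⟩
  · filter_upwards [coeFn_half (evenPart f), ae_half (coeFn_evenPart f), hκ', hκn,
      ae_restrict_mem measurableSet_Ioo] with x h1 h2 h3 h4 hx
    rw [h1, h2, h3, h4, L2.prim, eo x (Ioo_subset_Icc_self hx)]
    ring
  · filter_upwards [coeFn_half (oddPart f), ae_half (coeFn_oddPart f), hκ', hκn,
      ae_restrict_mem measurableSet_Ioo] with x h1 h2 h3 h4 hx
    rw [h1, h2, h3, h4, L2.prim, ee x (Ioo_subset_Icc_self hx)]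
    ring
  · rw [L2.prim, ee 1 (by simp), intervalIntegral.integral_interval_sub_left (iD _ _) (iD _ _), h0]
    simp

/-! ### Uniqueness by the energy identity -/

theorem IsClassicalSolution.hasDerivWithinAt_toL2 {T : ℝ} {a : ℝ → ℝ} {c : ℝ} {g₀ g₁ : ℝ → ℝ}
    {p u : ℝ → H1} (h : IsClassicalSolution T a c g₀ g₁ p u) {t : ℝ} (ht : t ∈ Icc 0 T) :
    HasDerivWithinAt (fun s => (p s).toL2) (derivWithin (fun s => (p s).toL2) (Icc 0 T) t)
      (Icc 0 T) t ∧
    HasDerivWithinAt (fun s => (u s).toL2) (derivWithin (fun s => (u s).toL2) (Icc 0 T) t)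
      (Icc 0 T) t := by
  have hd := h.contDiffOn_L2.differentiableOn one_ne_zero t ht
  exact ⟨hd.fst.hasDerivWithinAt, hd.snd.hasDerivWithinAt⟩

/-- The momentum balance of the difference of two solutions, tested with the difference of the
velocities. The damping contributes with a sign because `a` is monotone. -/
theorem inner_damping_nonpos {a : ℝ → ℝ} (ha : Monotone a) {v w v' w' q r : L2}
    (hv : ∀ᵐ x ∂(volume.restrict (Ioo (0 : ℝ) 1)), v' x + q x + a (v x) = 0)
    (hw : ∀ᵐ x ∂(volume.restrict (Ioo (0 : ℝ) 1)), w' x + r x + a (w x) = 0) :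
    inner ℝ (v - w) ((v' - w') + (q - r)) ≤ 0 := by
  rw [MeasureTheory.L2.inner_def]
  refine integral_nonpos_of_ae ?_
  filter_upwards [hv, hw, Lp.coeFn_sub v w, Lp.coeFn_add (v' - w') (q - r), Lp.coeFn_sub v' w',
    Lp.coeFn_sub q r] with x h1 h2 h3 h4 h5 h6
  rw [h3, h4, Pi.sub_apply, Pi.add_apply, h5, h6, Pi.sub_apply, Pi.sub_apply]
  have e : v' x - w' x + (q x - r x) = -(a (v x) - a (w x)) := by linarith
  rw [e]
  simp only [Pi.zero_apply, RCLike.inner_apply, conj_trivial]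
  rcases le_total (v x) (w x) with h | h <;> have := ha h <;> nlinarith

/-- A classical solution is unique, because the energy `‖δp‖² + ‖δu‖²` of the difference of two
solutions is nonincreasing and vanishes at time `0`. -/
theorem IsClassicalSolution.unique {T : ℝ} (hT : 0 < T) {a : ℝ → ℝ} (ha : Monotone a) {c : ℝ}
    {g₀ g₁ : ℝ → ℝ} {p u p' u' : ℝ → H1} (h : IsClassicalSolution T a c g₀ g₁ p u)
    (h' : IsClassicalSolution T a c g₀ g₁ p' u') :
    EqOn p' p (Icc 0 T) ∧ EqOn u' u (Icc 0 T) := by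
  set q : ℝ → L2 := fun t => (p' t).toL2 - (p t).toL2
  set v : ℝ → L2 := fun t => (u' t).toL2 - (u t).toL2
  have hq : ∀ t ∈ Icc 0 T, HasDerivWithinAt q (derivWithin (fun s => (p' s).toL2) (Icc 0 T) t -
      derivWithin (fun s => (p s).toL2) (Icc 0 T) t) (Icc 0 T) t := fun t ht =>
    (h'.hasDerivWithinAt_toL2 ht).1.sub (h.hasDerivWithinAt_toL2 ht).1
  have hv : ∀ t ∈ Icc 0 T, HasDerivWithinAt v (derivWithin (fun s => (u' s).toL2) (Icc 0 T) t -
      derivWithin (fun s => (u s).toL2) (Icc 0 T) t) (Icc 0 T) t := fun t ht =>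
    (h'.hasDerivWithinAt_toL2 ht).2.sub (h.hasDerivWithinAt_toL2 ht).2
  have hE := fun t ht => (hq t ht).norm_sq.add (hv t ht).norm_sq
  -- the flux terms cancel by integration by parts, and the damping term has a sign
  have hanti : AntitoneOn (fun t => ‖q t‖ ^ 2 + ‖v t‖ ^ 2) (Icc 0 T) := by
    refine antitoneOn_of_deriv_nonpos (convex_Icc 0 T) (fun t ht => (hE t ht).continuousWithinAt)
      (fun t ht => ?_) fun t ht => ?_
    · exact ((hE t (interior_subset ht)).hasDerivAt
        (mem_interior_iff_mem_nhds.mp ht)).differentiableAt.differentiableWithinAt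
    · refine (((hE t (interior_subset ht)).hasDerivAt
        (mem_interior_iff_mem_nhds.mp ht)).deriv).trans_le ?_
      rw [interior_Icc] at ht
      have ht' : t ∈ Ioc 0 T := Ioo_subset_Ioc_self ht
      have hmass : derivWithin (fun s => (p' s).toL2) (Icc 0 T) t -
          derivWithin (fun s => (p s).toL2) (Icc 0 T) t = -(u' t - u t).dx := by
        rw [H1.dx_sub]
        refine Lp.ext ?_
        filter_upwards [h'.mass t ht', h.mass t ht', Lp.coeFn_sub
          (derivWithin (fun s => (p' s).toL2) (Icc 0 T) t)
          (derivWithin (fun s => (p s).toL2) (Icc 0 T) t), Lp.coeFn_neg ((u' t).dx - (u t).dx),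
          Lp.coeFn_sub (u' t).dx (u t).dx] with x h1 h2 h3 h4 h5
        rw [h3, h4, Pi.sub_apply, Pi.neg_apply, h5, Pi.sub_apply]
        linarith
      have hmom := inner_damping_nonpos ha (h'.momentum t ht') (h.momentum t ht')
      have hb := (h'.boundary t ht').sub (h.boundary t ht')
      rw [sub_self, sub_self] at hb
      have hparts := H1.integral_by_parts (q := p' t - p t) hb
      rw [H1.toL2_sub, H1.toL2_sub] at hparts
      rw [inner_add_right] at hmom
      rw [hmass, inner_neg_right]
      rw [H1.dx_sub (p' t)] at hparts
      linarith
  have h0 : q 0 = 0 ∧ v 0 = 0 := by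
    constructor
    · refine sub_eq_zero.mpr (Lp.ext ?_)
      filter_upwards [h.initial_p, h'.initial_p] with x h1 h2
      rw [h1, h2]
    · refine sub_eq_zero.mpr (Lp.ext ?_)
      filter_upwards [h.initial_u, h'.initial_u] with x h1 h2
      rw [h1, h2]
  have hz : ∀ t ∈ Icc 0 T, q t = 0 ∧ v t = 0 := by
    intro t ht
    have := hanti ⟨le_rfl, hT.le⟩ ht ht.1
    simp only [h0.1, h0.2, norm_zero] at this
    have h1 : ‖q t‖ = 0 := by nlinarith [sq_nonneg ‖q t‖, sq_nonneg ‖v t‖]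
    have h2 : ‖v t‖ = 0 := by nlinarith [sq_nonneg ‖q t‖, sq_nonneg ‖v t‖]
    exact ⟨norm_eq_zero.mp h1, norm_eq_zero.mp h2⟩
  exact ⟨fun t ht => H1.toL2_injective (sub_eq_zero.mp (hz t ht).1),
    fun t ht => H1.toL2_injective (sub_eq_zero.mp (hz t ht).2)⟩

/-! ### Curves of class `C^k` on a compact interval -/

section Curves

variable {E : Type*} [NormedAddCommGroup E] [NormedSpace ℝ E] {T : ℝ}

theorem derivWithin_eqOn {F F' : ℝ → E} (hT : 0 < T)
    (h : ∀ t ∈ Icc 0 T, HasDerivWithinAt F (F' t) (Icc 0 T) t) :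
    EqOn (derivWithin F (Icc 0 T)) F' (Icc 0 T) := fun t ht =>
  (h t ht).derivWithin (uniqueDiffOn_Icc hT t ht)

theorem contDiffOn_one_of_hasDerivWithinAt {F F' : ℝ → E} (hT : 0 < T)
    (h : ∀ t ∈ Icc 0 T, HasDerivWithinAt F (F' t) (Icc 0 T) t) (hc : ContinuousOn F' (Icc 0 T)) :
    ContDiffOn ℝ 1 F (Icc 0 T) := by
  rw [show (1 : WithTop ℕ∞) = 0 + 1 by norm_num,
    contDiffOn_succ_iff_derivWithin (uniqueDiffOn_Icc hT)]
  refine ⟨fun t ht => (h t ht).differentiableWithinAt, by simp, ?_⟩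
  rw [contDiffOn_zero]
  exact hc.congr (derivWithin_eqOn hT h)

theorem contDiffOn_two_of_hasDerivWithinAt {F F' F'' : ℝ → E} (hT : 0 < T)
    (h : ∀ t ∈ Icc 0 T, HasDerivWithinAt F (F' t) (Icc 0 T) t)
    (h' : ∀ t ∈ Icc 0 T, HasDerivWithinAt F' (F'' t) (Icc 0 T) t)
    (hc : ContinuousOn F'' (Icc 0 T)) : ContDiffOn ℝ 2 F (Icc 0 T) := by
  rw [show (2 : WithTop ℕ∞) = 1 + 1 by norm_num,
    contDiffOn_succ_iff_derivWithin (uniqueDiffOn_Icc hT)]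
  refine ⟨fun t ht => (h t ht).differentiableWithinAt, by simp, ?_⟩
  exact (contDiffOn_one_of_hasDerivWithinAt hT h' hc).congr (derivWithin_eqOn hT h)

theorem ckNorm_one_le {F F' : ℝ → E} {C : ℝ} (hT : 0 < T)
    (h : ∀ t ∈ Icc 0 T, HasDerivWithinAt F (F' t) (Icc 0 T) t)
    (b : ∀ t ∈ Icc 0 T, ‖F t‖ ≤ C) (b' : ∀ t ∈ Icc 0 T, ‖F' t‖ ≤ C) : ckNorm 1 T F ≤ 2 * C := by
  have : Nonempty (Icc (0 : ℝ) T) := ⟨⟨0, le_rfl, hT.le⟩⟩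
  have e0 : ⨆ t : Icc (0 : ℝ) T, ‖iteratedDerivWithin 0 F (Icc 0 T) t‖ ≤ C :=
    ciSup_le fun t => by rw [iteratedDerivWithin_zero]; exact b t t.2
  have e1 : ⨆ t : Icc (0 : ℝ) T, ‖iteratedDerivWithin 1 F (Icc 0 T) t‖ ≤ C :=
    ciSup_le fun t => by
      rw [iteratedDerivWithin_one, derivWithin_eqOn hT h t.2]; exact b' t t.2
  rw [ckNorm, Finset.sum_range_succ, Finset.sum_range_one]
  linarith

theorem ckNorm_two_le {F F' F'' : ℝ → E} {C : ℝ} (hT : 0 < T)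
    (h : ∀ t ∈ Icc 0 T, HasDerivWithinAt F (F' t) (Icc 0 T) t)
    (h' : ∀ t ∈ Icc 0 T, HasDerivWithinAt F' (F'' t) (Icc 0 T) t)
    (b : ∀ t ∈ Icc 0 T, ‖F t‖ ≤ C) (b' : ∀ t ∈ Icc 0 T, ‖F' t‖ ≤ C)
    (b'' : ∀ t ∈ Icc 0 T, ‖F'' t‖ ≤ C) : ckNorm 2 T F ≤ 3 * C := by
  have : Nonempty (Icc (0 : ℝ) T) := ⟨⟨0, le_rfl, hT.le⟩⟩
  have e1 : ckNorm 1 T F ≤ 2 * C := ckNorm_one_le hT h b b'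
  have e2 : ⨆ t : Icc (0 : ℝ) T, ‖iteratedDerivWithin 2 F (Icc 0 T) t‖ ≤ C :=
    ciSup_le fun t => by
      rw [iteratedDerivWithin_succ, derivWithin_congr (f := derivWithin F (Icc 0 T))
        (fun s _ => by rw [iteratedDerivWithin_one]) (by rw [iteratedDerivWithin_one]),
        derivWithin_congr (derivWithin_eqOn hT h) (derivWithin_eqOn hT h t.2),
        derivWithin_eqOn hT h' t.2]
      exact b'' t t.2
  rw [ckNorm, Finset.sum_range_succ]
  rw [ckNorm] at e1
  linarith

theorem hasDerivWithinAt_iteratedDerivWithin {F : ℝ → E} (hT : 0 < T) {n : ℕ}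
    (h : ContDiffOn ℝ n F (Icc 0 T)) {j : ℕ} (hj : j < n) {t : ℝ} (ht : t ∈ Icc 0 T) :
    HasDerivWithinAt (iteratedDerivWithin j F (Icc 0 T))
      (iteratedDerivWithin (j + 1) F (Icc 0 T) t) (Icc 0 T) t := by
  rw [iteratedDerivWithin_succ]
  exact ((h.differentiableOn_iteratedDerivWithin (by exact_mod_cast hj) (uniqueDiffOn_Icc hT)) t
    ht).hasDerivWithinAt

theorem norm_iteratedDerivWithin_le_ckNorm {F : ℝ → E} (hT : 0 < T) {n : ℕ}
    (h : ContDiffOn ℝ n F (Icc 0 T)) {j : ℕ} (hj : j ≤ n) {t : ℝ} (ht : t ∈ Icc 0 T) :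
    ‖iteratedDerivWithin j F (Icc 0 T) t‖ ≤ ckNorm n T F := by
  have hc : ContinuousOn (iteratedDerivWithin j F (Icc 0 T)) (Icc 0 T) :=
    h.continuousOn_iteratedDerivWithin (by exact_mod_cast hj) (uniqueDiffOn_Icc hT)
  have hb : BddAbove (range fun t : Icc (0 : ℝ) T => ‖iteratedDerivWithin j F (Icc 0 T) t‖) := by
    obtain ⟨R, hR⟩ := isCompact_Icc.exists_bound_of_continuousOn hc
    exact ⟨R, by rintro _ ⟨s, rfl⟩; exact hR s s.2⟩
  refine (le_ciSup hb ⟨t, ht⟩).trans ?_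
  exact Finset.single_le_sum
    (f := fun j => ⨆ t : Icc (0 : ℝ) T, ‖iteratedDerivWithin j F (Icc 0 T) t‖)
    (fun i _ => Real.iSup_nonneg fun _ => norm_nonneg _) (Finset.mem_range.mpr (by omega))

end Curves

/-! ### Boundary data on the circle -/

/-- The constant function `1` on the circle. -/
def one : LC ℝ := (memLp_const (1 : ℝ)).toLp

/-- The even function on the circle that equals `x` on `(0,1)`. -/
def ramp : LC ℝ :=
  (MemLp.of_bound (p := 2) (μ := (volume : Measure (AddCircle (2 : ℝ)))) (f := fun y => |rep y|)
    (measurable_rep.abs).aestronglyMeasurable 1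
    (ae_of_all _ fun y => by rw [Real.norm_eq_abs, abs_abs]; exact abs_rep_le y)).toLp

theorem coeFn_one : ∀ᵐ y, one y = 1 := (memLp_const (1 : ℝ)).coeFn_toLp

theorem coeFn_ramp : ∀ᵐ y, ramp y = |rep y| := MemLp.coeFn_toLp _

theorem essBdd_one : EssBdd 1 one := by
  filter_upwards [coeFn_one] with y hy
  rw [hy, norm_one]

theorem essBdd_ramp : EssBdd 1 ramp := by
  filter_upwards [coeFn_ramp] with y hy
  rw [hy, Real.norm_eq_abs, abs_abs]
  exact abs_rep_le y

/-- The even function on the circle that is affine on `(0,1)` with boundary values `r` and `s`. -/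
def interp (r s : ℝ) : LC ℝ := r • one + (s - r) • ramp

theorem essBdd_interp {r s b : ℝ} (hr : |r| ≤ b) (hs : |s| ≤ b) : EssBdd (3 * b) (interp r s) := by
  refine ((essBdd_one.smul r).add (essBdd_ramp.smul (s - r))).mono ?_
  have := abs_sub s r
  linarith

theorem hasDerivWithinAt_interp {r s : ℝ → ℝ} {r' s' t : ℝ} {S : Set ℝ}
    (hr : HasDerivWithinAt r r' S t) (hs : HasDerivWithinAt s s' S t) :
    HasDerivWithinAt (fun t => interp (r t) (s t)) (interp r' s') S t :=
  (hr.smul_const one).add ((hs.sub hr).smul_const ramp)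

theorem continuousOn_interp {r s : ℝ → ℝ} {S : Set ℝ} (hr : ContinuousOn r S)
    (hs : ContinuousOn s S) : ContinuousOn (fun t => interp (r t) (s t)) S :=
  (hr.smul continuousOn_const).add ((hs.sub hr).smul continuousOn_const)

theorem vel_one : vel one = 0 := by
  refine Lp.ext ?_
  filter_upwards [coeFn_vel one, coeFn_one,
    (Measure.measurePreserving_neg volume).quasiMeasurePreserving.ae coeFn_one,
    Lp.coeFn_zero ℝ 2 (volume : Measure (AddCircle (2 : ℝ)))] with y h1 h2 h3 h4
  rw [h1, h2, h3, h4]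
  simp

theorem transl_one (t : ℝ) : transl ℝ t one = one := by
  refine Lp.ext ?_
  filter_upwards [coeFn_transl t one, coeFn_one,
    (measurePreserving_circle_sub t).quasiMeasurePreserving.ae coeFn_one] with y h1 h2 h3
  rw [h1, h2]
  exact h3

theorem coeFn_half_one : ∀ᵐ x : ℝ ∂(volume.restrict (Ioo (0 : ℝ) 1)), half one x = 1 := by
  filter_upwards [coeFn_half one, ae_half coeFn_one] with x h1 h2
  rw [h1, h2]

theorem coeFn_half_interp (r s : ℝ) :
    ∀ᵐ x : ℝ ∂(volume.restrict (Ioo (0 : ℝ) 1)), half (interp r s) x = r + (s - r) * x := by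
  filter_upwards [coeFn_half (interp r s), ae_half coeFn_one, ae_half coeFn_ramp,
    ae_half (Lp.coeFn_add (r • one) ((s - r) • ramp)), ae_half (Lp.coeFn_smul r one),
    ae_half (Lp.coeFn_smul (s - r) ramp), ae_restrict_mem measurableSet_Ioo] with
    x h1 h2 h3 h4 h5 h6 hx
  rw [h1, interp, h4, Pi.add_apply, h5, h6, Pi.smul_apply, Pi.smul_apply, h2, h3,
    rep_coe ⟨by linarith [hx.1], hx.2.le⟩, abs_of_pos hx.1]
  simp

/-- The function `g` on the circle is even. It suffices to compare `g` at `x` and `-x` for almost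
every `x` in `(0,1)`. -/
def IsEven (g : LC ℝ) : Prop :=
  ∀ᵐ x : ℝ ∂(volume.restrict (Ioo (0 : ℝ) 1)), g (-(x : AddCircle (2 : ℝ))) =
    g (x : AddCircle (2 : ℝ))

theorem IsEven.half_evenPart {g : LC ℝ} (h : IsEven g) : half (evenPart g) = half g := by
  refine Lp.ext ?_
  filter_upwards [h, coeFn_half (evenPart g), coeFn_half g, ae_half (coeFn_evenPart g)]
    with x h1 h2 h3 h4
  rw [h2, h3, h4, h1]
  ring

theorem IsEven.half_oddPart {g : LC ℝ} (h : IsEven g) : half (oddPart g) = 0 := by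
  refine Lp.ext ?_
  filter_upwards [h, coeFn_half (oddPart g), ae_half (coeFn_oddPart g),
    Lp.coeFn_zero ℝ 2 (volume.restrict (Ioo (0 : ℝ) 1))] with x h1 h2 h3 h4
  rw [h2, h3, h4, h1]
  simp

theorem isEven_one : IsEven one := by
  filter_upwards [ae_half coeFn_one, ae_half_neg coeFn_one] with x h1 h2
  rw [h1, h2]

theorem isEven_ramp : IsEven ramp := by
  filter_upwards [ae_half coeFn_ramp, ae_half_neg coeFn_ramp, ae_restrict_mem measurableSet_Ioo]
    with x h1 h2 hx
  rw [h1, h2, ← AddCircle.coe_neg, rep_coe ⟨by linarith [hx.1], hx.2.le⟩,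
    rep_coe ⟨by linarith [hx.2], by linarith [hx.1]⟩, abs_neg]

theorem IsEven.add {f g : LC ℝ} (hf : IsEven f) (hg : IsEven g) : IsEven (f + g) := by
  filter_upwards [hf, hg, ae_half (Lp.coeFn_add f g), ae_half_neg (Lp.coeFn_add f g)]
    with x h1 h2 h3 h4
  rw [h3, h4, Pi.add_apply, Pi.add_apply, h1, h2]

theorem IsEven.smul {f : LC ℝ} (hf : IsEven f) (r : ℝ) : IsEven (r • f) := by
  filter_upwards [hf, ae_half (Lp.coeFn_smul r f), ae_half_neg (Lp.coeFn_smul r f)]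
    with x h1 h2 h3
  rw [h2, h3, Pi.smul_apply, Pi.smul_apply, h1]

theorem isEven_interp (r s : ℝ) : IsEven (interp r s) :=
  (isEven_one.smul r).add (isEven_ramp.smul (s - r))

theorem isEven_vel (f : LC ℝ) : IsEven (vel f) := by
  filter_upwards [ae_half (coeFn_vel f), ae_half_neg (coeFn_vel f),
    ae_restrict_mem measurableSet_Ioo] with x h1 h2 hx
  rw [h1, h2, sgn_coe hx, sgn_coe_neg hx, neg_neg]
  simp only [smul_eq_mul]
  ring

theorem IsEven.compLp {f : LC ℝ} (hf : IsEven f) {a : ℝ → ℝ} {ℓ : ℝ≥0} (hL : LipschitzWith ℓ a)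
    (h0 : a 0 = 0) : IsEven (hL.compLp h0 f) := by
  filter_upwards [hf, ae_half (hL.coeFn_compLp h0 f), ae_half_neg (hL.coeFn_compLp h0 f)]
    with x h1 h2 h3
  rw [h2, h3, Function.comp_apply, Function.comp_apply, h1]

/-! ### From mild solutions on the circle to classical solutions -/

/-- The orthogonal projection of pairs of functions onto `H¹(0,1)`. It fixes the pairs `(f, f')` and
is used to regard a differentiable curve of such pairs as a differentiable curve in `H¹(0,1)`. -/
def h1Proj : L2 × L2 →L[ℝ] H1 :=
  h1Submodule.orthogonalProjectionOnto ∘L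
    ((WithLp.prodContinuousLinearEquiv 2 ℝ L2 L2).symm : L2 × L2 →L[ℝ] WithLp 2 (L2 × L2))

theorem h1Proj_of_prim {x y : L2} {κ : ℝ}
    (h : (x : ℝ → ℝ) =ᵐ[volume.restrict (Ioo (0 : ℝ) 1)] L2.prim κ y) :
    (h1Proj (x, y)).toL2 = x ∧ (h1Proj (x, y)).dx = y := by
  have hm : WithLp.toLp 2 (x, y) ∈ h1Submodule := isWeakDeriv_of_ae_eq_prim h
  have e : h1Proj (x, y) = ⟨WithLp.toLp 2 (x, y), hm⟩ :=
    Submodule.orthogonalProjectionOnto_mem_subspace_eq_self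
      (⟨WithLp.toLp 2 (x, y), hm⟩ : h1Submodule)
  rw [e]
  exact ⟨rfl, rfl⟩

theorem norm_h1Proj_le (x y : L2) : ‖h1Proj (x, y)‖ ≤ ‖x‖ + ‖y‖ := by
  refine (Submodule.norm_orthogonalProjectionOnto_apply_le h1Submodule
    (WithLp.toLp 2 (x, y))).trans ?_
  rw [WithLp.prod_norm_eq_of_L2]
  exact Real.sqrt_le_iff.mpr ⟨by positivity, show ‖x‖ ^ 2 + ‖y‖ ^ 2 ≤ _ by
    nlinarith [mul_nonneg (norm_nonneg x) (norm_nonneg y)]⟩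

theorem prim_add_smul_one (A : L2) (κ r : ℝ) {x : ℝ} (hx : x ∈ Icc (0 : ℝ) 1) :
    L2.prim κ (A + r • half one) x = L2.prim 0 A x + (κ + r * x) := by
  have e : ∫ s in (0 : ℝ)..x, (A + r • half one : L2).ext s = ∫ s in (0 : ℝ)..x, (A.ext s + r) := by
    refine intervalIntegral.integral_congr_ae ?_
    have h1 : ∀ᵐ s : ℝ, s ≠ 1 := by simp [ae_iff]
    filter_upwards [(ae_restrict_iff' measurableSet_Ioo).mp (L2.ext_ae A),
      (ae_restrict_iff' measurableSet_Ioo).mp (L2.ext_ae (A + r • half one)),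
      (ae_restrict_iff' measurableSet_Ioo).mp (Lp.coeFn_add A (r • half one)),
      (ae_restrict_iff' measurableSet_Ioo).mp (Lp.coeFn_smul r (half one)),
      (ae_restrict_iff' measurableSet_Ioo).mp coeFn_half_one, h1] with s a1 a2 a3 a4 a5 a6 hs
    rw [uIoc_of_le hx.1] at hs
    have hs' : s ∈ Ioo (0 : ℝ) 1 := ⟨hs.1, lt_of_le_of_ne (hs.2.trans hx.2) a6⟩
    rw [a1 hs', a2 hs', a3 hs', Pi.add_apply, a4 hs', Pi.smul_apply, a5 hs']
    simp
  rw [L2.prim, L2.prim, e, intervalIntegral.integral_add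
    (intervalIntegrable_of_locallyIntegrable (L2.locallyIntegrable_ext A) _ _)
    intervalIntegrable_const, intervalIntegral.integral_const]
  simp only [sub_zero, smul_eq_mul]
  ring

section State

/-! In this section `W` is the state, `V` its time derivative, `f` the forcing, `N` the damping term
`a(u)`, and `b₀, b₁` and `b₀', b₁'` are the boundary values and their time derivatives. -/

variable {W V f N : LC ℝ} {b₀ b₁ b₀' b₁' : ℝ}

theorem half_evenPart_force (hN : IsEven N)
    (hf : f = (b₀ - b₁) • one - sgnMul (interp b₀' b₁') - sgnMul N) :
    half (evenPart f) = (b₀ - b₁) • half one := by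
  rw [hf]
  simp only [map_sub, map_smul, half_evenPart_sgnMul, hN.half_oddPart,
    (isEven_interp _ _).half_oddPart, isEven_one.half_evenPart, sub_zero]

theorem half_oddPart_force (hN : IsEven N)
    (hf : f = (b₀ - b₁) • one - sgnMul (interp b₀' b₁') - sgnMul N) :
    half (oddPart f) = -half (interp b₀' b₁') - half N := by
  rw [hf]
  simp only [map_sub, map_smul, half_oddPart_sgnMul, hN.half_evenPart,
    (isEven_interp _ _).half_evenPart, isEven_one.half_oddPart, smul_zero, zero_sub]

/-- The velocity reconstructed from a mild solution on the circle is the primitive of its space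
derivative, with the prescribed boundary values. -/
theorem velocity_eq_prim (hgen : HasDerivAt (fun h => transl ℝ h W) (V - f) 0) (hN : IsEven N)
    (hf : f = (b₀ - b₁) • one - sgnMul (interp b₀' b₁') - sgnMul N) :
    ((half (vel W + interp b₀ b₁) : ℝ → ℝ) =ᵐ[volume.restrict (Ioo (0 : ℝ) 1)]
      L2.prim b₀ (-half (evenPart V))) ∧ L2.prim b₀ (-half (evenPart V)) 1 = b₁ := by
  obtain ⟨-, h2, h3⟩ := half_of_generator (f := W) (D := f - V) (by rwa [neg_sub])
  -- the mean value `b₁ - b₀` of `∂ₓ u` is carried by the constant part of the forcing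
  have e : -half (evenPart V) = half (evenPart (f - V)) + (b₁ - b₀) • half one := by
    rw [map_sub, map_sub, half_evenPart_force hN hf, sub_smul, sub_smul]
    abel
  constructor
  · filter_upwards [h2, coeFn_half_interp b₀ b₁, Lp.coeFn_add (half (vel W)) (half (interp b₀ b₁)),
      ae_restrict_mem measurableSet_Ioo] with x a1 a2 a3 hx
    rw [map_add, a3, Pi.add_apply, a2, half_vel, a1, e,
      prim_add_smul_one _ _ _ (Ioo_subset_Icc_self hx)]
  · rw [e, prim_add_smul_one _ _ _ (by simp), h3]
    ring

end State

theorem norm_half_add_le {x y : LC ℝ} {R : ℝ} (hx : ‖x‖ ≤ R) (hy : ‖y‖ ≤ R) :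
    ‖half (vel x + y)‖ ≤ 2 * R :=
  (norm_half_le _).trans ((norm_add_le _ _).trans (by linarith [norm_vel_le x]))

theorem norm_half_evenPart_le {x : LC ℝ} {R : ℝ} (hx : ‖x‖ ≤ R) : ‖half (evenPart x)‖ ≤ R :=
  (norm_half_le _).trans ((norm_evenPart_le x).trans hx)

theorem norm_half_oddPart_sub_le {x y : LC ℝ} {R : ℝ} (hx : ‖x‖ ≤ R) (hy : ‖y‖ ≤ R) :
    ‖half (oddPart (x - y))‖ ≤ 2 * R :=
  (norm_half_le _).trans ((norm_oddPart_le _).trans ((norm_sub_le _ _).trans (by linarith)))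

/-- A twice continuously differentiable mild solution on the circle yields a classical solution with
the regularity and the bounds that are claimed. -/
theorem exists_solution_of_mild {T R : ℝ} (hT : 0 < T) {a : ℝ → ℝ} {ℓ : ℝ≥0}
    (hL : LipschitzWith ℓ a) (ha0 : a 0 = 0) {c : ℝ} {g₀ g₁ g₀' g₁' g₀'' g₁'' : ℝ → ℝ}
    (hg₀ : ∀ t ∈ Icc 0 T, HasDerivWithinAt g₀ (g₀' t) (Icc 0 T) t)
    (hg₁ : ∀ t ∈ Icc 0 T, HasDerivWithinAt g₁ (g₁' t) (Icc 0 T) t)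
    (hg₀' : ∀ t ∈ Icc 0 T, HasDerivWithinAt g₀' (g₀'' t) (Icc 0 T) t)
    (hg₁' : ∀ t ∈ Icc 0 T, HasDerivWithinAt g₁' (g₁'' t) (Icc 0 T) t)
    (hg₀'' : ContinuousOn g₀'' (Icc 0 T)) (hg₁'' : ContinuousOn g₁'' (Icc 0 T))
    (h₀ : g₀ 0 = 0) (h₁ : g₁ 0 = 0) {W V Z f k : ℝ → LC ℝ} (ck : Continuous k)
    (hW : ∀ t, HasDerivAt W (V t) t) (hf : ∀ t, HasDerivAt f (k t) t)
    (eW : ∀ t, W t = c • one + (transl ℝ).mild f t)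
    (ef : ∀ t ∈ Icc 0 T, f t = (g₀ t - g₁ t) • one - sgnMul (interp (g₀' t) (g₁' t)) -
      sgnMul (hL.compLp ha0 (vel (W t) + interp (g₀ t) (g₁ t))))
    (hV : ∀ t ∈ Icc 0 T, HasDerivWithinAt V (Z t) (Icc 0 T) t) (cZ : ContinuousOn Z (Icc 0 T))
    (bW : ∀ t ∈ Icc 0 T, ‖W t‖ ≤ R) (bV : ∀ t ∈ Icc 0 T, ‖V t‖ ≤ R)
    (bZ : ∀ t ∈ Icc 0 T, ‖Z t‖ ≤ R) (bf : ∀ t ∈ Icc 0 T, ‖f t‖ ≤ R)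
    (bk : ∀ t ∈ Icc 0 T, ‖k t‖ ≤ R) (bg : ∀ t ∈ Icc 0 T, ‖interp (g₀ t) (g₁ t)‖ ≤ R)
    (bg' : ∀ t ∈ Icc 0 T, ‖interp (g₀' t) (g₁' t)‖ ≤ R)
    (bg'' : ∀ t ∈ Icc 0 T, ‖interp (g₀'' t) (g₁'' t)‖ ≤ R) :
    ∃ p u : ℝ → H1, IsClassicalSolution T a c g₀ g₁ p u ∧
      ContDiffOn ℝ 1 (fun t => (p t, u t)) (Icc 0 T) ∧
      ContDiffOn ℝ 2 (fun t => ((p t).toL2, (u t).toL2)) (Icc 0 T) ∧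
      ckNorm 1 T (fun t => (p t, u t)) + ckNorm 2 T (fun t => ((p t).toL2, (u t).toL2)) ≤
        15 * R := by
  have cf : Continuous f := continuous_iff_continuousAt.mpr fun t => (hf t).continuousAt
  have cV : ContinuousOn V (Icc 0 T) := fun t ht => (hV t ht).continuousWithinAt
  have hR : 0 ≤ R := (norm_nonneg _).trans (bW 0 ⟨le_rfl, hT.le⟩)
  have hgen : ∀ t, HasDerivAt (fun h => transl ℝ h (W t)) (V t - f t) 0 := fun t => by
    have hw := hW t
    rw [show W = fun t => c • one + (transl ℝ).mild f t from funext eW] at hw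
    simp only [eW]
    exact (transl ℝ).hasDerivAt_translate_mild cf (fun s => by rw [map_smul, transl_one]) hw
  have hN : ∀ t, IsEven (hL.compLp ha0 (vel (W t) + interp (g₀ t) (g₁ t))) := fun t =>
    ((isEven_vel _).add (isEven_interp _ _)).compLp hL ha0
  set p : ℝ → H1 := fun t => h1Proj (half (evenPart (W t)), half (oddPart (f t - V t))) with hp
  set u : ℝ → H1 := fun t =>
    h1Proj (half (vel (W t) + interp (g₀ t) (g₁ t)), -half (evenPart (V t)))
    with hu
  have ep : ∀ t, (p t).toL2 = half (evenPart (W t)) ∧ (p t).dx = half (oddPart (f t - V t)) := by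
    intro t
    obtain ⟨⟨κ, hκ⟩, -⟩ := half_of_generator (f := W t) (D := f t - V t)
      (by rw [neg_sub]; exact hgen t)
    exact h1Proj_of_prim hκ
  have eu : ∀ t ∈ Icc 0 T, (u t).toL2 = half (vel (W t) + interp (g₀ t) (g₁ t)) ∧
      (u t).dx = -half (evenPart (V t)) := fun t ht =>
    h1Proj_of_prim (velocity_eq_prim (hgen t) (hN t) (ef t ht)).1
  have dE : ∀ {F : ℝ → LC ℝ} {F' : LC ℝ} {t : ℝ}, HasDerivWithinAt F F' (Icc 0 T) t →
      HasDerivWithinAt (fun t => half (evenPart (F t))) (half (evenPart F')) (Icc 0 T) t :=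
    fun h => (half ∘L evenPart).hasFDerivAt.comp_hasDerivWithinAt _ h
  have dO : ∀ {F : ℝ → LC ℝ} {F' : LC ℝ} {t : ℝ}, HasDerivWithinAt F F' (Icc 0 T) t →
      HasDerivWithinAt (fun t => half (oddPart (F t))) (half (oddPart F')) (Icc 0 T) t :=
    fun h => (half ∘L oddPart).hasFDerivAt.comp_hasDerivWithinAt _ h
  have dU : ∀ {F G : ℝ → LC ℝ} {F' G' : LC ℝ} {t : ℝ}, HasDerivWithinAt F F' (Icc 0 T) t →
      HasDerivWithinAt G G' (Icc 0 T) t →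
      HasDerivWithinAt (fun t => half (vel (F t) + G t)) (half (vel F' + G')) (Icc 0 T) t :=
    fun h h' => half.hasFDerivAt.comp_hasDerivWithinAt _
      ((vel.hasFDerivAt.comp_hasDerivWithinAt _ h).add h')
  have dW := fun t (_ : t ∈ Icc 0 T) => (hW t).hasDerivWithinAt (s := Icc 0 T)
  have di := fun t ht => hasDerivWithinAt_interp (hg₀ t ht) (hg₁ t ht)
  have di' := fun t ht => hasDerivWithinAt_interp (hg₀' t ht) (hg₁' t ht)
  -- the time derivatives in `L²`
  have d1p : ∀ t ∈ Icc 0 T, HasDerivWithinAt (fun t => (p t).toL2) (half (evenPart (V t)))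
      (Icc 0 T) t := fun t ht =>
    (dE (dW t ht)).congr (fun s _ => (ep s).1) (ep t).1
  have d1u : ∀ t ∈ Icc 0 T, HasDerivWithinAt (fun t => (u t).toL2)
      (half (vel (V t) + interp (g₀' t) (g₁' t))) (Icc 0 T) t := fun t ht =>
    (dU (dW t ht) (di t ht)).congr (fun s hs => (eu s hs).1) (eu t ht).1
  have d1 := fun t ht => (d1p t ht).prodMk (d1u t ht)
  have d2 := fun t ht => (dE (hV t ht)).prodMk (dU (hV t ht) (di' t ht))
  have c2 : ContinuousOn (fun t => (half (evenPart (Z t)),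
      half (vel (Z t) + interp (g₀'' t) (g₁'' t)))) (Icc 0 T) :=
    ((half ∘L evenPart).continuous.comp_continuousOn cZ).prodMk
      (half.continuous.comp_continuousOn ((vel.continuous.comp_continuousOn cZ).add
        (continuousOn_interp hg₀'' hg₁'')))
  -- the time derivatives in `H¹`
  have dp : ∀ t ∈ Icc 0 T, HasDerivWithinAt p
      (h1Proj (half (evenPart (V t)), half (oddPart (k t - Z t)))) (Icc 0 T) t := fun t ht =>
    h1Proj.hasFDerivAt.comp_hasDerivWithinAt t
      ((dE (dW t ht)).prodMk (dO ((hf t).hasDerivWithinAt.sub (hV t ht))))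
  have du : ∀ t ∈ Icc 0 T, HasDerivWithinAt u
      (h1Proj (half (vel (V t) + interp (g₀' t) (g₁' t)), -half (evenPart (Z t)))) (Icc 0 T) t :=
    fun t ht => h1Proj.hasFDerivAt.comp_hasDerivWithinAt t
      ((dU (dW t ht) (di t ht)).prodMk (dE (hV t ht)).neg)
  have dH := fun t ht => (dp t ht).prodMk (du t ht)
  have ci' : ContinuousOn (fun t => interp (g₀' t) (g₁' t)) (Icc 0 T) := fun t ht =>
    (di' t ht).continuousWithinAt
  have cH : ContinuousOn (fun t => (h1Proj (half (evenPart (V t)), half (oddPart (k t - Z t))),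
      h1Proj (half (vel (V t) + interp (g₀' t) (g₁' t)), -half (evenPart (Z t))))) (Icc 0 T) :=
    (h1Proj.continuous.comp_continuousOn
      (((half ∘L evenPart).continuous.comp_continuousOn cV).prodMk
        ((half ∘L oddPart).continuous.comp_continuousOn (ck.continuousOn.sub cZ)))).prodMk
    (h1Proj.continuous.comp_continuousOn
      ((half.continuous.comp_continuousOn ((vel.continuous.comp_continuousOn cV).add ci')).prodMk
        ((half ∘L evenPart).continuous.comp_continuousOn cZ).neg))
  have hsol : IsClassicalSolution T a c g₀ g₁ p u := by
    refine ⟨fun t ht => (dH t ht).continuousWithinAt,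
      (contDiffOn_two_of_hasDerivWithinAt hT d1 d2 c2).of_le (by norm_num), ?_, ?_, ?_, ?_, ?_⟩
    · intro t ht
      have ht' := Ioc_subset_Icc_self ht
      rw [derivWithin_eqOn hT d1p ht', (eu t ht').2]
      filter_upwards [Lp.coeFn_neg (half (evenPart (V t)))] with x hx
      rw [hx, Pi.neg_apply, add_neg_cancel]
    · intro t ht
      have ht' := Ioc_subset_Icc_self ht
      rw [derivWithin_eqOn hT d1u ht', (ep t).2, (eu t ht').1]
      have e : half (vel (V t) + interp (g₀' t) (g₁' t)) + half (oddPart (f t - V t)) =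
          -half (hL.compLp ha0 (vel (W t) + interp (g₀ t) (g₁ t))) := by
        rw [map_sub, map_sub, half_oddPart_force (hN t) (ef t ht'), map_add, half_vel]
        abel
      set N := hL.compLp ha0 (vel (W t) + interp (g₀ t) (g₁ t))
      filter_upwards [Lp.coeFn_add (half (vel (V t) + interp (g₀' t) (g₁' t)))
        (half (oddPart (f t - V t))), Lp.coeFn_neg (half N), coeFn_half N,
        ae_half (hL.coeFn_compLp ha0 (vel (W t) + interp (g₀ t) (g₁ t))),
        coeFn_half (vel (W t) + interp (g₀ t) (g₁ t))] with x a1 a2 a3 a4 a5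
      rw [← Pi.add_apply, ← a1, e, a2, Pi.neg_apply, a3, a4, a5, Function.comp_apply,
        neg_add_cancel]
    · intro t ht
      have ht' := Ioc_subset_Icc_self ht
      obtain ⟨h1, h2⟩ := velocity_eq_prim (hgen t) (hN t) (ef t ht')
      exact ⟨_, (L2.continuous_prim _ _).continuousOn, by rw [(eu t ht').1]; exact h1,
        L2.prim_zero _ _, h2⟩
    · have e : (p 0).toL2 = c • half one := by
        rw [(ep 0).1, eW]
        simp only [IsometryGroup.mild, intervalIntegral.integral_same, add_zero, map_smul,
          isEven_one.half_evenPart]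
      rw [e]
      filter_upwards [Lp.coeFn_smul c (half one), coeFn_half_one] with x h1 h2
      rw [h1, Pi.smul_apply, h2, smul_eq_mul, mul_one]
    · have e : (u 0).toL2 = 0 := by
        rw [(eu 0 ⟨le_rfl, hT.le⟩).1, eW]
        simp [IsometryGroup.mild, vel_one, interp, h₀, h₁]
      rw [e]
      exact Lp.coeFn_zero ℝ 2 _
  refine ⟨p, u, hsol, contDiffOn_one_of_hasDerivWithinAt hT dH cH,
    contDiffOn_two_of_hasDerivWithinAt hT d1 d2 c2, ?_⟩
  have n1 : ckNorm 1 T (fun t => (p t, u t)) ≤ 2 * (3 * R) := by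
    refine ckNorm_one_le hT dH (fun t ht => ?_) fun t ht => ?_
    · refine norm_prod_le_iff.mpr ⟨?_, ?_⟩ <;> refine (norm_h1Proj_le _ _).trans ?_
      · linarith [norm_half_evenPart_le (bW t ht), norm_half_oddPart_sub_le (bf t ht) (bV t ht)]
      · rw [norm_neg]
        linarith [norm_half_evenPart_le (bV t ht), norm_half_add_le (bW t ht) (bg t ht)]
    · refine norm_prod_le_iff.mpr ⟨?_, ?_⟩ <;> refine (norm_h1Proj_le _ _).trans ?_
      · linarith [norm_half_evenPart_le (bV t ht), norm_half_oddPart_sub_le (bk t ht) (bZ t ht)]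
      · rw [norm_neg]
        linarith [norm_half_evenPart_le (bZ t ht), norm_half_add_le (bV t ht) (bg' t ht)]
  have n2 : ckNorm 2 T (fun t => ((p t).toL2, (u t).toL2)) ≤ 3 * (3 * R) := by
    refine ckNorm_two_le hT d1 d2 (fun t ht => ?_) (fun t ht => ?_) fun t ht => ?_ <;>
      refine norm_prod_le_iff.mpr ⟨?_, ?_⟩
    · rw [(ep t).1]
      linarith [norm_half_evenPart_le (bW t ht)]
    · rw [(eu t ht).1]
      linarith [norm_half_add_le (bW t ht) (bg t ht)]
    · linarith [norm_half_evenPart_le (bV t ht)]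
    · linarith [norm_half_add_le (bV t ht) (bg' t ht)]
    · linarith [norm_half_evenPart_le (bZ t ht)]
    · linarith [norm_half_add_le (bZ t ht) (bg'' t ht)]
  linarith

/-! ### Existence, with uniform bounds -/

/-- The successive derivatives of a boundary datum, with their bounds. -/
theorem IsBoundaryDatum.derivatives {T M : ℝ} (hT : 0 < T) {g : ℝ → ℝ}
    (hg : IsBoundaryDatum T g) (hM : ckNorm 4 T g ≤ M) :
    ∃ g' g'' g''' : ℝ → ℝ, g' 0 = 0 ∧
      (∀ t ∈ Icc 0 T, HasDerivWithinAt g (g' t) (Icc 0 T) t) ∧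
      (∀ t ∈ Icc 0 T, HasDerivWithinAt g' (g'' t) (Icc 0 T) t) ∧
      (∀ t ∈ Icc 0 T, HasDerivWithinAt g'' (g''' t) (Icc 0 T) t) ∧
      ContinuousOn g''' (Icc 0 T) ∧
      ∀ t ∈ Icc 0 T, |g t| ≤ M ∧ |g' t| ≤ M ∧ |g'' t| ≤ M ∧ |g''' t| ≤ M := by
  obtain ⟨h4, -, h1⟩ := hg
  have hd := fun j (hj : j < 4) t (ht : t ∈ Icc 0 T) =>
    hasDerivWithinAt_iteratedDerivWithin (n := 4) hT h4 hj ht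
  have hb := fun j (hj : j ≤ 4) t (ht : t ∈ Icc 0 T) =>
    (norm_iteratedDerivWithin_le_ckNorm (n := 4) hT h4 hj ht).trans hM
  refine ⟨iteratedDerivWithin 1 g (Icc 0 T), iteratedDerivWithin 2 g (Icc 0 T),
    iteratedDerivWithin 3 g (Icc 0 T), by rwa [iteratedDerivWithin_one], ?_,
    hd 1 (by norm_num), hd 2 (by norm_num),
    fun t ht => (hd 3 (by norm_num) t ht).continuousWithinAt,
    fun t ht => ⟨?_, hb 1 (by norm_num) t ht, hb 2 (by norm_num) t ht, hb 3 (by norm_num) t ht⟩⟩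
  · simpa only [iteratedDerivWithin_zero] using hd 0 (by norm_num)
  · simpa only [iteratedDerivWithin_zero, Real.norm_eq_abs] using hb 0 (by norm_num) t ht

theorem norm_le_add_of_norm_deriv_le {E : Type*} [NormedAddCommGroup E] [NormedSpace ℝ E]
    {F F' : ℝ → E} {T C C₀ : ℝ} (hC : 0 ≤ C) (h : ∀ t, HasDerivAt F (F' t) t)
    (b : ∀ t ∈ Icc 0 T, ‖F' t‖ ≤ C) (b₀ : ‖F 0‖ ≤ C₀) {t : ℝ} (ht : t ∈ Icc 0 T) :
    ‖F t‖ ≤ C₀ + C * T := by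
  have h1 := norm_image_sub_le_of_norm_deriv_le_segment' (fun s _ => (h s).hasDerivWithinAt)
    (fun s hs => b s (Ico_subset_Icc_self hs)) t ht
  have h2 := norm_le_norm_add_norm_sub' (F t) (F 0)
  have h3 : C * (t - 0) ≤ C * T := mul_le_mul_of_nonneg_left (by linarith [ht.2]) hC
  linarith

/-- Existence of a solution with the additional regularity. The truncation level `K` and the cutoff
depend only on `T`, `a₁` and `M`, so that the bound is uniform in the data. -/
theorem exists_regular_solution {T a₀ a₁ a₂ a₃ M : ℝ} (hT : 0 < T) (ha₀ : 0 < a₀) (ha₁ : 0 < a₁)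
    (ha₂ : 0 < a₂) (ha₃ : 0 < a₃) (hM : 0 ≤ M) :
    ∃ C : ℝ, ∀ (a : ℝ → ℝ) (c : ℝ) (g₀ g₁ : ℝ → ℝ), IsDampingLaw a₀ a₁ a₂ a₃ a →
      IsBoundaryDatum T g₀ → IsBoundaryDatum T g₁ →
      |c| ≤ M → ckNorm 4 T g₀ ≤ M → ckNorm 4 T g₁ ≤ M →
      ∃ p u : ℝ → H1, IsClassicalSolution T a c g₀ g₁ p u ∧
        ContDiffOn ℝ 1 (fun t => (p t, u t)) (Icc 0 T) ∧
        ContDiffOn ℝ 2 (fun t => ((p t).toL2, (u t).toL2)) (Icc 0 T) ∧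
        ckNorm 1 T (fun t => (p t, u t)) + ckNorm 2 T (fun t => ((p t).toL2, (u t).toL2)) ≤ C := by
  lift a₁ to ℝ≥0 using ha₁.le
  lift a₂ to ℝ≥0 using ha₂.le
  lift a₃ to ℝ≥0 using ha₃.le
  -- `5 * M` bounds the data of the problem on the circle, and `1` makes the bound positive
  set b : ℝ := 5 * M + 1
  have hb : 0 < b := by positivity
  set R₁ := regBound b a₁ T
  have hR₁ : 0 < R₁ := regBound_pos hb a₁.2 T
  set K : ℝ := R₁ + b with hK
  obtain ⟨τ, τ', m, hτ, hτK, bτ, bτ', lτ'⟩ := exists_cutoff (add_pos hR₁ hb : 0 < K)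
  set R₂ := regBound b (doubledBound a₁ a₂ m) T
  have hR₂ : 0 < R₂ := regBound_pos hb (NNReal.coe_nonneg _) T
  set R₃ := b + a₁ * K
  have hR₃ : 0 < R₃ := by positivity
  -- the constant in `‖f‖_{L²} ≤ σ ‖f‖_{L^∞}` on the circle
  set σ := √((volume : Measure (AddCircle (2 : ℝ))).real univ)
  have hσ : 0 ≤ σ := Real.sqrt_nonneg _
  set R := σ * b + (σ * R₁ + σ * R₁ * T) + σ * R₂ + (σ * R₃ + σ * R₃ * T)
  refine ⟨15 * R, fun a c g₀ g₁ ha hg₀ hg₁ hc n₀ n₁ => ?_⟩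
  obtain ⟨a', a'', da, da', la'', ba', ba''⟩ := ha.regular
  have ha0 : a 0 = 0 := ha.2.1
  have b1 : ∀ x, |a' x| ≤ a₁ := fun x => by
    rw [abs_of_nonneg (ha₀.le.trans (ba' x).1)]
    exact (ba' x).2
  have hL : LipschitzWith a₁ a := lipschitzWith_of_hasFDerivAt
    (fun q => (da q).hasFDerivAt) (fun q => by simpa using b1 q)
  have l2 : LipschitzWith a₃ a'' := LipschitzWith.of_dist_le_mul fun x y => la'' x y
  obtain ⟨g₀', g₀'', g₀''', z₀, d₀, d₀', d₀'', c₀, bd₀⟩ := hg₀.derivatives hT n₀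
  obtain ⟨g₁', g₁'', g₁''', z₁, d₁, d₁', d₁'', c₁, bd₁⟩ := hg₁.derivatives hT n₁
  have cg₀ : ContinuousOn g₀'' (Icc 0 T) := fun t ht => (d₀'' t ht).continuousWithinAt
  have cg₁ : ContinuousOn g₁'' (Icc 0 T) := fun t ht => (d₁'' t ht).continuousWithinAt
  have bi : ∀ {r s : ℝ}, |r| ≤ M → |s| ≤ M → EssBdd b (interp r s) := fun hr hs =>
    (essBdd_interp hr hs).mono (by linarith)
  have bB : ∀ {r s r' s' : ℝ}, |r| ≤ M → |s| ≤ M → |r'| ≤ M → |s'| ≤ M →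
      EssBdd b ((r - s) • one - sgnMul (interp r' s')) := fun {r s _ _} hr hs hr' hs' =>
    ((essBdd_one.smul (r - s)).sub (essBdd_interp hr' hs').sgnMul).mono (by
      have := abs_sub r s
      linarith)
  have dB : ∀ {r s r' s' : ℝ → ℝ} {x y x' y' t : ℝ}, HasDerivWithinAt r x (Icc 0 T) t →
      HasDerivWithinAt s y (Icc 0 T) t → HasDerivWithinAt r' x' (Icc 0 T) t →
      HasDerivWithinAt s' y' (Icc 0 T) t →
      HasDerivWithinAt (fun t => (r t - s t) • one - sgnMul (interp (r' t) (s' t)))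
        ((x - y) • one - sgnMul (interp x' y')) (Icc 0 T) t := fun hr hs hr' hs' =>
    ((hr.sub hs).smul_const one).sub
      (sgnMul.hasFDerivAt.comp_hasDerivWithinAt _ (hasDerivWithinAt_interp hr' hs'))
  have hi0 : interp 0 0 = 0 := by simp [interp]
  obtain ⟨W, V, Z, f, k, ck, hW, hf, eW, ef, bV, bk, hV, cZ, bZ⟩ := exists_C2_mild hT.le hb ha0 da
    da' b1 ba'' l2 hL hK hτ hτK bτ bτ' lτ' (W₀ := c • one)
    (B := fun t => (g₀ t - g₁ t) • one - sgnMul (interp (g₀' t) (g₁' t)))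
    (B' := fun t => (g₀' t - g₁' t) • one - sgnMul (interp (g₀'' t) (g₁'' t)))
    (B'' := fun t => (g₀'' t - g₁'' t) • one - sgnMul (interp (g₀''' t) (g₁''' t)))
    (G := fun t => interp (g₀ t) (g₁ t)) (G' := fun t => interp (g₀' t) (g₁' t))
    (G'' := fun t => interp (g₀'' t) (g₁'' t))
    (fun t ht => dB (d₀ t ht) (d₁ t ht) (d₀' t ht) (d₁' t ht))
    (fun t ht => dB (d₀' t ht) (d₁' t ht) (d₀'' t ht) (d₁'' t ht))
    (((cg₀.sub cg₁).smul continuousOn_const).sub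
      (sgnMul.continuous.comp_continuousOn (continuousOn_interp c₀ c₁)))
    (fun t ht => bB (bd₀ t ht).2.1 (bd₁ t ht).2.1 (bd₀ t ht).2.2.1 (bd₁ t ht).2.2.1)
    (fun t ht => bB (bd₀ t ht).2.2.1 (bd₁ t ht).2.2.1 (bd₀ t ht).2.2.2 (bd₁ t ht).2.2.2)
    (fun t ht => hasDerivWithinAt_interp (d₀ t ht) (d₁ t ht))
    (fun t ht => hasDerivWithinAt_interp (d₀' t ht) (d₁' t ht))
    (continuousOn_interp cg₀ cg₁)
    (fun t ht => bi (bd₀ t ht).2.1 (bd₁ t ht).2.1)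
    (fun t ht => bi (bd₀ t ht).2.2.1 (bd₁ t ht).2.2.1)
    (by rw [map_smul, vel_one, smul_zero])
    (by simp only [hg₀.2.1, hg₁.2.1, z₀, z₁, hi0, map_zero, sub_self, zero_smul])
    (by simp only [hg₀.2.1, hg₁.2.1, hi0]) (by simp only [z₀, z₁, hi0])
  have hW0 : W 0 = c • one := by rw [eW]; simp [IsometryGroup.mild]
  -- the forcing vanishes at time `0` by the compatibility of the data
  have hf0 : f 0 = 0 := by
    rw [ef 0 ⟨le_rfl, hT.le⟩, hW0]
    simp only [hg₀.2.1, hg₁.2.1, z₀, z₁, hi0, map_zero, sub_self, zero_smul, map_smul, vel_one,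
      smul_zero, add_zero, LipschitzWith.compLp_zero]
  have nW0 : ‖W 0‖ ≤ σ * b := by
    rw [hW0]
    exact ((essBdd_one.smul c).mono (by linarith)).norm_le hb.le
  have nV := fun t ht => (bV t ht).norm_le hR₁.le
  have nZ := fun t ht => (bZ t ht).norm_le hR₂.le
  have nk := fun t ht => (bk t ht).norm_le hR₃.le
  have p0 : 0 ≤ σ * b := by positivity
  have p1 : 0 ≤ σ * R₁ := by positivity
  have p2 : 0 ≤ σ * R₂ := by positivity
  have p3 : 0 ≤ σ * R₃ := by positivity
  have p4 : 0 ≤ σ * R₁ * T := by positivity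
  have p5 : 0 ≤ σ * R₃ * T := by positivity
  refine exists_solution_of_mild hT hL ha0 d₀ d₁ d₀' d₁' cg₀ cg₁ hg₀.2.1 hg₁.2.1 ck hW hf eW ef hV
    cZ (fun t ht => ?_) (fun t ht => (nV t ht).trans ?_) (fun t ht => (nZ t ht).trans ?_)
    (fun t ht => ?_) (fun t ht => (nk t ht).trans ?_)
    (fun t ht => ((bi (bd₀ t ht).1 (bd₁ t ht).1).norm_le hb.le).trans ?_)
    (fun t ht => ((bi (bd₀ t ht).2.1 (bd₁ t ht).2.1).norm_le hb.le).trans ?_)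
    (fun t ht => ((bi (bd₀ t ht).2.2.1 (bd₁ t ht).2.2.1).norm_le hb.le).trans ?_)
  · have := norm_le_add_of_norm_deriv_le p1 hW nV nW0 ht
    linarith
  · linarith
  · linarith
  · have := norm_le_add_of_norm_deriv_le p3 hf nk (C₀ := 0) (by rw [hf0, norm_zero]) ht
    linarith
  all_goals linarith

end

end DampedWave

theorem mainTheorem2 (T a₀ a₁ a₂ a₃ M : ℝ) (hT : 0 < T)
    (ha₀ : 0 < a₀) (ha₁ : 0 < a₁) (ha₂ : 0 < a₂) (ha₃ : 0 < a₃) :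
    ∃ C : ℝ, ∀ (a : ℝ → ℝ) (c : ℝ) (g₀ g₁ : ℝ → ℝ),
      DampedWave.IsDampingLaw a₀ a₁ a₂ a₃ a →
      DampedWave.IsBoundaryDatum T g₀ → DampedWave.IsBoundaryDatum T g₁ →
      |c| ≤ M → DampedWave.ckNorm 4 T g₀ ≤ M → DampedWave.ckNorm 4 T g₁ ≤ M →
      ∃ p u : ℝ → DampedWave.H1,
        DampedWave.IsClassicalSolution T a c g₀ g₁ p u ∧
        (∀ p' u' : ℝ → DampedWave.H1, DampedWave.IsClassicalSolution T a c g₀ g₁ p' u' →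
          EqOn p' p (Icc 0 T) ∧ EqOn u' u (Icc 0 T)) ∧
        ContDiffOn ℝ 1 (fun t => (p t, u t)) (Icc 0 T) ∧
        ContDiffOn ℝ 2 (fun t => ((p t).toL2, (u t).toL2)) (Icc 0 T) ∧
        DampedWave.ckNorm 1 T (fun t => (p t, u t)) +
          DampedWave.ckNorm 2 T (fun t => ((p t).toL2, (u t).toL2)) ≤ C := by
  -- for `M < 0` no data satisfy `|c| ≤ M`
  rcases lt_or_ge M 0 with hM | hM
  · exact ⟨0, fun a c g₀ g₁ _ _ _ hc => absurd ((abs_nonneg c).trans hc) (not_le.mpr hM)⟩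
  obtain ⟨C, hC⟩ := DampedWave.exists_regular_solution hT ha₀ ha₁ ha₂ ha₃ hM
  refine ⟨C, fun a c g₀ g₁ ha hg₀ hg₁ hc n₀ n₁ => ?_⟩
  obtain ⟨p, u, hsol, h1, h2, hb⟩ := hC a c g₀ g₁ ha hg₀ hg₁ hc n₀ n₁
  obtain ⟨a', -, da, -, -, ba', -⟩ := ha.regular
  have hmono : Monotone a := monotone_of_deriv_nonneg (fun x => (da x).differentiableAt) fun x => by
    rw [(da x).deriv]
    exact ha₀.le.trans (ba' x).1
  exact ⟨p, u, hsol, fun p' u' h' => hsol.unique hT hmono h', h1, h2, hb⟩
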